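/- Let $n\ge 0$ and let $\triangle\subset\mathbb R^n$ be the simplex with vertices $(n,-1,\ldots,-1),\ (-1,n,\ldots,-1),\ \ldots,\ (-1,\ldots,-1,n),\ (-1,\ldots,-1)$, that is, a lattice translate of $n+1$ times the standard unimodular simplex. Then $\triangle$ is reflexive: it is a lattice polytope (with respect to $\mathbb Z^n$) with the origin in its interior, and its polar dual $\{y : \langle x,y\rangle\ge -1 \text{ for all } x\in\triangle\}$ is a lattice polytope. Moreover $\triangle$ admits a regular projective triangulation, i.e. a finite triangulation $\mathcal T$ of $\triangle$ with lattice points as vertices such that 1. $\mathcal T$ is unimodular: every maximal simplex is an $n$-simplex of normalized volume $1$; 2. $\mathcal T$ is coherent: there is a convex function $f$ on $\triangle$ such that for every maximal simplex $s$ of $\mathcal T$ there is an affine function $g_s$ with $f=g_s$ on $s$ and $g_s<f$ on $\triangle\setminus s$; 3. the origin is a vertex of every maximal simplex of $\mathcal T$. Such a $\mathcal T$ can be obtained by iterated star subdivisions of the fan $\Sigma_\triangle$ of cones over the proper faces of $\triangle$ (the empty face giving $\{0\}$), ordered by faces: there are a $\mathcal T$ as above and an enumeration $v_1,\ldots,v_N$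 without repetition of all lattice points of $\partial\triangle$, such that the dimension of the smallest face of $\triangle$ containing $v_i$ is non-increasing in $i$, and such that the fan of the cones over the simplices of $\mathcal T$ equals $\Sigma^N$, where $\Sigma^0=\Sigma_\triangle$ and $\Sigma^i=(\Sigma^{i-1})^*(v_i)$. Here, for a fan $\Sigma$ and a lattice vector $v$ in its support, the star subdivision $\Sigma^*(v)$ consists of the cones $\sigma\in\Sigma$ with $v\notin\sigma$, and of the cones generated by $\tau$ and $v$ for $v\notin\tau\in\Sigma$ with $\{v\}\cup\tau\subset\sigma$ for some $\sigma\in\Sigma$. -/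

import Mathlib

namespace ToricTriangulation

variable {n : ℕ}

/-! ### Lattice polytopes in `ℝⁿ`, with lattice `ℤⁿ` -/

/-- The points of the lattice `ℤⁿ ⊆ ℝⁿ`. -/
def IsLatticePoint (x : Fin n → ℝ) : Prop :=
  ∃ m : Fin n → ℤ, ∀ i, x i = (m i : ℝ)

/-- A lattice polytope: the convex hull of finitely many lattice points. -/
def IsLatticePolytope (P : Set (Fin n → ℝ)) : Prop :=
  ∃ S : Set (Fin n → ℝ), S.Finite ∧ (∀ x ∈ S, IsLatticePoint x) ∧ P = convexHull ℝ S

/-- The polar dual `P^∨ = {y | ⟨x, y⟩ ≥ -1 for all x ∈ P}`. -/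
def polarDual (P : Set (Fin n → ℝ)) : Set (Fin n → ℝ) :=
  {y | ∀ x ∈ P, -1 ≤ ∑ i, x i * y i}

/-- A reflexive polytope: a lattice polytope with the origin in its interior whose polar dual is
a lattice polytope, too. -/
def IsReflexive (P : Set (Fin n → ℝ)) : Prop :=
  IsLatticePolytope P ∧ (0 : Fin n → ℝ) ∈ interior P ∧ IsLatticePolytope (polarDual P)

/-- The polytope in `ℝⁿ` with vertices `(n,-1,…,-1), (-1,n,…,-1), …, (-1,…,-1,n)` and
`(-1,…,-1)`. -/
def projectiveSpacePolytope (n : ℕ) : Set (Fin n → ℝ) :=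
  convexHull ℝ (insert (fun _ => (-1 : ℝ))
    (Set.range fun i : Fin n => fun j : Fin n => if j = i then (n : ℝ) else -1))

/-- The dimension of the smallest face of `P` that contains `x`. The faces of a polytope are its
exposed faces. -/
noncomputable def faceDim (P : Set (Fin n → ℝ)) (x : Fin n → ℝ) : ℕ :=
  Module.finrank ℝ
    (vectorSpan ℝ (⋂₀ {F : Set (Fin n → ℝ) | IsExposed ℝ P F ∧ x ∈ F}))

/-! ### Triangulations -/

/-- `T` is a (finite) triangulation of `P` all of whose vertices are lattice points. -/
def IsLatticeTriangulation (T : Geometry.SimplicialComplex ℝ (Fin n → ℝ))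
    (P : Set (Fin n → ℝ)) : Prop :=
  T.faces.Finite ∧ T.space = P ∧ ∀ v ∈ T.vertices, IsLatticePoint v

/-- The normalized volume (`n!` times the Euclidean volume) of the `n`-simplex with vertices
`v 0, …, v n`. -/
noncomputable def normalizedVolume (v : Fin (n + 1) → Fin n → ℝ) : ℝ :=
  |(Matrix.of fun i j : Fin n => v i.succ j - v 0 j).det|

/-- Every maximal simplex is an `n`-simplex of normalized volume `1`. -/
def IsUnimodular (T : Geometry.SimplicialComplex ℝ (Fin n → ℝ)) : Prop :=
  ∀ s ∈ T.facets, ∃ v : Fin (n + 1) → Fin n → ℝ,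
    Set.range v = (s : Set (Fin n → ℝ)) ∧ normalizedVolume v = 1

/-- Coherence of a triangulation `T` of `P`: there is a convex function on `P` that is affine on
each maximal simplex, such that the affine function of each maximal simplex lies strictly below it
at all points of `P` outside that simplex (a strictly convex `T`-piecewise linear function). -/
def IsCoherent (T : Geometry.SimplicialComplex ℝ (Fin n → ℝ)) (P : Set (Fin n → ℝ)) : Prop :=
  ∃ f : (Fin n → ℝ) → ℝ, ConvexOn ℝ P f ∧
    ∀ s ∈ T.facets, ∃ g : (Fin n → ℝ) →ᵃ[ℝ] ℝ,
      (∀ x ∈ convexHull ℝ (s : Set (Fin n → ℝ)), f x = g x) ∧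
      ∀ x ∈ P, x ∉ convexHull ℝ (s : Set (Fin n → ℝ)) → g x < f x

/-- A regular projective triangulation of `P`: a triangulation with lattice points as vertices
that is unimodular and coherent, and has the origin as a vertex of every maximal simplex. -/
def IsRegularProjectiveTriangulation (T : Geometry.SimplicialComplex ℝ (Fin n → ℝ))
    (P : Set (Fin n → ℝ)) : Prop :=
  IsLatticeTriangulation T P ∧ IsUnimodular T ∧ IsCoherent T P ∧
    ∀ s ∈ T.facets, (0 : Fin n → ℝ) ∈ s

/-! ### Fans and star subdivisions -/

/-- The fan `Σ_P` of the cones over the proper faces of `P`; the empty face gives the cone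
`{0}`. -/
def faceFan (P : Set (Fin n → ℝ)) : Set (PointedCone ℝ (Fin n → ℝ)) :=
  {σ | ∃ F : Set (Fin n → ℝ), IsExposed ℝ P F ∧ F ≠ P ∧ σ = PointedCone.hull ℝ F}

/-- The collection `Σ_{P,T}` of the cones over the simplices of `T`; where the origin is a vertex
of every maximal simplex, it is the fan induced by `T`. -/
def triangulationFan (T : Geometry.SimplicialComplex ℝ (Fin n → ℝ)) :
    Set (PointedCone ℝ (Fin n → ℝ)) :=
  {σ | ∃ s ∈ T.faces, σ = PointedCone.hull ℝ (s : Set (Fin n → ℝ))}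

/-- The star subdivision `Σ^*(v)`: the cones of `Σ` that do not contain `v`, and the cones
generated by `τ` and `v` where `v ∉ τ ∈ Σ` and `{v} ∪ τ ⊆ σ` for some `σ ∈ Σ`. -/
def starSubdivision (Fan : Set (PointedCone ℝ (Fin n → ℝ))) (v : Fin n → ℝ) :
    Set (PointedCone ℝ (Fin n → ℝ)) :=
  {σ | σ ∈ Fan ∧ v ∉ σ} ∪
    {ρ | ∃ τ ∈ Fan, v ∉ τ ∧ (∃ σ ∈ Fan, v ∈ σ ∧ τ ≤ σ) ∧ ρ = τ ⊔ PointedCone.hull ℝ {v}}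

end ToricTriangulation

/-! A lattice point of `△` is encoded by homogeneous coordinates `u : Fin (n + 1) → ℕ` of sum `n +
1`. The support of `u` is the smallest face containing the point, the origin is `(1, …, 1)`, and
boundary points are those with a zero coordinate. All of this is considered on the simplex dilated
by an arbitrary `d`.

Star subdivisions are followed through coefficients rather than cones. If the new ray `v` has
coefficients `κ` in its cone, a point with coefficients `a` trades the largest multiple `c κ ≤ a`
for `c` times `v` (`IsStep`). The support of the final coefficients then names the cone containing
the point.

The order of the points comes from a recursion on `d` (`hasProgram`). Write `1_T` for the indicator
of `T`. The lattice points with support exactly `T` are `1_T + u'`, where `u'` is supported in `T`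
and has sum `m = d - |T|`: they form a smaller dilated simplex. If `m = 0` there is one point.
Otherwise one first stars at the corners `1_T + m eⱼ`, which cuts the region between the face and
the inner simplex in a staircase pattern (`IsPartialSplit.step`), and then runs the program for `m`
inside the inner simplex (`exists_program_corner`). Larger faces come first. At each stage a vector
in `ℕ^I` with sum divisible by `d` keeps natural number coefficients on the new rays, up to a
remainder of the same kind (`IsPartialSplit.exists_natCast`, `exists_program_card`). In the end
every lattice point is an integral combination of the generators of its cone.

On the geometric side, `IsRegularFan` describes a complete simplicial fan with a strictly convex
support function by existence and uniqueness of coefficients. `IsRegularFan.star` preserves this: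
trading is reversible, and the new ray may be given a value slightly below the interpolated one. All
rays end on the boundary of `△`, so coning the fan's boundary pieces with the origin gives the
triangulation. Its coherence comes from the support function (`IsBoundaryFan.isCoherent`), its
unimodularity from integrality (`IsBoundaryFan.isUnimodular`). -/

namespace ToricTriangulation

/-! ### Star subdivisions in terms of coefficients -/

section Run

variable {Λ Λ' : Type*}

/-- The effect of the star subdivision at a ray `p.1`, whose coefficients with respect to the fan
are `p.2`, on the coefficients of a point: `a` becomes `b`. -/
def IsStep (p : Λ × (Λ →₀ ℝ)) (a b : Λ →₀ ℝ) : Prop :=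
  ∃ c : ℝ, 0 ≤ c ∧ c • p.2 ≤ a ∧ (∃ r ∈ p.2.support, a r = c * p.2 r) ∧
    b = a - c • p.2 + Finsupp.single p.1 c

/-- The effect of a sequence of star subdivisions on the coefficients of a point. -/
def IsRun : List (Λ × (Λ →₀ ℝ)) → (Λ →₀ ℝ) → (Λ →₀ ℝ) → Prop
  | [], a, b => a = b
  | p :: P, a, b => ∃ c, IsStep p a c ∧ IsRun P c b

theorem isRun_append {P Q : List (Λ × (Λ →₀ ℝ))} {a b : Λ →₀ ℝ} :
    IsRun (P ++ Q) a b ↔ ∃ c, IsRun P a c ∧ IsRun Q c b := by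
  induction P generalizing a with
  | nil => simp [IsRun]
  | cons p P ih =>
    simp only [List.cons_append, IsRun, ih]
    constructor
    · rintro ⟨c, h, e, h1, h2⟩
      exact ⟨e, ⟨c, h, h1⟩, h2⟩
    · rintro ⟨e, ⟨c, h, h1⟩, h2⟩
      exact ⟨c, h, e, h1, h2⟩

theorem isStep_self {p : Λ × (Λ →₀ ℝ)} {a : Λ →₀ ℝ} (ha : 0 ≤ a)
    (h : ∃ r ∈ p.2.support, a r = 0) : IsStep p a a := by
  obtain ⟨r, hr, h0⟩ := h
  exact ⟨0, le_rfl, by simpa using ha, ⟨r, hr, by simp [h0]⟩, by simp⟩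

theorem isRun_self {P : List (Λ × (Λ →₀ ℝ))} {a : Λ →₀ ℝ} (ha : 0 ≤ a)
    (h : ∀ p ∈ P, ∃ r ∈ p.2.support, a r = 0) : IsRun P a a := by
  induction P with
  | nil => rfl
  | cons p P ih =>
    exact ⟨a, isStep_self ha (h p (by simp)), ih fun q hq => h q (by simp [hq])⟩

/-- A summand that vanishes on the support of `p.2` neither limits nor enlarges the multiple that
can be traded. This lets a program act on one part of a point while another part is carried along.
-/
theorem IsStep.add_left {p : Λ × (Λ →₀ ℝ)} {a b e : Λ →₀ ℝ} (h : IsStep p a b) (he : 0 ≤ e)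
    (hd : ∀ r ∈ p.2.support, e r = 0) : IsStep p (e + a) (e + b) := by
  obtain ⟨c, hc, hle, ⟨r, hr, hr'⟩, rfl⟩ := h
  refine ⟨c, hc, hle.trans (le_add_of_nonneg_left he), ⟨r, hr, by simp [hd r hr, hr']⟩, ?_⟩
  abel

theorem IsRun.add_left {P : List (Λ × (Λ →₀ ℝ))} {a b e : Λ →₀ ℝ} (h : IsRun P a b) (he : 0 ≤ e)
    (hd : ∀ p ∈ P, ∀ r ∈ p.2.support, e r = 0) : IsRun P (e + a) (e + b) := by
  induction P generalizing a with
  | nil => exact congrArg _ h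
  | cons p P ih =>
    obtain ⟨c, h1, h2⟩ := h
    exact ⟨e + c, h1.add_left he (hd p (by simp)), ih h2 fun q hq => hd q (by simp [hq])⟩

theorem IsStep.nonneg {p : Λ × (Λ →₀ ℝ)} {a b : Λ →₀ ℝ} (h : IsStep p a b) : 0 ≤ b := by
  obtain ⟨c, hc, hle, -, rfl⟩ := h
  exact add_nonneg (sub_nonneg.2 hle) (Finsupp.single_nonneg.2 hc)

/-- Relabelling of a sequence of star subdivisions. -/
noncomputable def mapProgram (f : Λ → Λ') (P : List (Λ × (Λ →₀ ℝ))) : List (Λ' × (Λ' →₀ ℝ)) :=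
  P.map fun p => (f p.1, p.2.mapDomain f)

theorem IsStep.mapDomain {f : Λ → Λ'} (hf : f.Injective) {p : Λ × (Λ →₀ ℝ)} {a b : Λ →₀ ℝ}
    (h : IsStep p a b) : IsStep (f p.1, p.2.mapDomain f) (a.mapDomain f) (b.mapDomain f) := by
  classical
  obtain ⟨c, hc, hle, ⟨r, hr, hr'⟩, rfl⟩ := h
  refine ⟨c, hc, ?_, ⟨f r, ?_, ?_⟩, ?_⟩
  · intro y
    rw [← Finsupp.mapDomain_smul]
    by_cases hy : y ∈ Set.range f
    · obtain ⟨x, rfl⟩ := hy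
      simpa only [Finsupp.mapDomain_apply hf] using hle x
    · simp only [Finsupp.mapDomain_of_notMem_range _ _ hy, le_refl]
  · rw [Finsupp.mapDomain_support_of_injective hf]
    exact Finset.mem_image_of_mem f hr
  · simpa only [Finsupp.mapDomain_apply hf] using hr'
  · rw [Finsupp.mapDomain_add, Finsupp.mapDomain_single, ← Finsupp.mapDomain_smul]
    congr 1
    exact map_sub (Finsupp.mapDomain.addMonoidHom f) a (c • p.2)

theorem IsRun.mapDomain {f : Λ → Λ'} (hf : f.Injective) {P : List (Λ × (Λ →₀ ℝ))} {a b : Λ →₀ ℝ}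
    (h : IsRun P a b) : IsRun (mapProgram f P) (a.mapDomain f) (b.mapDomain f) := by
  induction P generalizing a with
  | nil => exact congrArg _ h
  | cons p P ih =>
    obtain ⟨c, h1, h2⟩ := h
    exact ⟨c.mapDomain f, h1.mapDomain hf, ih h2⟩

/-- The coefficients recorded in `P` are those which the earlier star subdivisions, including those
in `A`, make of the initial coefficients. -/
def IsAdapted (init : Λ → Λ →₀ ℝ) : List (Λ × (Λ →₀ ℝ)) → List (Λ × (Λ →₀ ℝ)) → Prop
  | _, [] => True
  | A, p :: P => IsRun A (init p.1) p.2 ∧ IsAdapted init (A ++ [p]) P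

theorem isAdapted_append {init : Λ → Λ →₀ ℝ} {A P Q : List (Λ × (Λ →₀ ℝ))} :
    IsAdapted init A (P ++ Q) ↔ IsAdapted init A P ∧ IsAdapted init (A ++ P) Q := by
  induction P generalizing A with
  | nil => simp [IsAdapted]
  | cons p P ih => simp [IsAdapted, ih, and_assoc]

/-- The list `A` prepares the ground: once it has turned the new initial coefficients into the
relabelled old ones, the relabelled program sees exactly what the original saw. It is applied with
`A` a corner program and `f` a shift, and with `f = id` to put programs of different faces one after
another. -/
theorem IsAdapted.mapProgram {init : Λ → Λ →₀ ℝ} {init' : Λ' → Λ' →₀ ℝ} {f : Λ → Λ'}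
    (hf : f.Injective) {A : List (Λ' × (Λ' →₀ ℝ))} {B P : List (Λ × (Λ →₀ ℝ))}
    (h : IsAdapted init B P)
    (hA : ∀ p ∈ P, IsRun A (init' (f p.1)) ((init p.1).mapDomain f)) :
    IsAdapted init' (A ++ mapProgram f B) (mapProgram f P) := by
  induction P generalizing B with
  | nil => trivial
  | cons p P ih =>
    refine ⟨isRun_append.2 ⟨_, hA p (by simp), h.1.mapDomain hf⟩, ?_⟩
    have := ih h.2 fun q hq => hA q (by simp [hq])
    simpa [ToricTriangulation.mapProgram] using this

theorem mapProgram_id (P : List (Λ × (Λ →₀ ℝ))) : mapProgram id P = P := by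
  simp [mapProgram, Finsupp.mapDomain_id]

end Run

/-! ### Lattice points of dilated simplices -/

section Labels

variable {I : Type*} [Fintype I]

/-- The set of nonzero coordinates. -/
def labelSupport (u : I → ℕ) : Finset I := Finset.univ.filter fun i => u i ≠ 0

@[simp] theorem mem_labelSupport {u : I → ℕ} {i : I} : i ∈ labelSupport u ↔ u i ≠ 0 := by
  simp [labelSupport]

variable [DecidableEq I]

/-- The coefficients of `x` with respect to the vertices `d • eᵢ` of the dilated simplex. -/
noncomputable def vertexState (d : ℕ) (x : I → ℝ) : (I → ℕ) →₀ ℝ :=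
  ∑ i, Finsupp.single (Pi.single i d) (x i / d)

omit [Fintype I] in
theorem single_injective {d : ℕ} (hd : d ≠ 0) :
    Function.Injective fun i : I => (Pi.single i d : I → ℕ) := by
  intro i j h
  by_contra hij
  have := congrFun h i
  simp [hij, hd] at this

theorem vertexState_single {d : ℕ} (hd : d ≠ 0) (x : I → ℝ) (i : I) :
    vertexState d x (Pi.single i d) = x i / d := by
  classical
  rw [vertexState, Finsupp.finsetSum_apply, Finset.sum_eq_single i]
  · simp
  · intro j _ hj
    exact Finsupp.single_eq_of_ne fun h => hj (single_injective hd h).symm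
  · simp

theorem vertexState_eq_zero {d : ℕ} {x : I → ℝ} {r : I → ℕ}
    (h : ∀ i, r = Pi.single i d → x i = 0) : vertexState d x r = 0 := by
  classical
  rw [vertexState, Finsupp.finsetSum_apply]
  refine Finset.sum_eq_zero fun i _ => ?_
  rw [Finsupp.single_apply]
  split_ifs with hi
  · simp [h i hi.symm]
  · rfl

theorem vertexState_nonneg {d : ℕ} {x : I → ℝ} (hx : ∀ i, 0 ≤ x i) : 0 ≤ vertexState d x :=
  Finset.sum_nonneg fun i _ => Finsupp.single_nonneg.2 (div_nonneg (hx i) (Nat.cast_nonneg d))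

theorem vertexState_add (d : ℕ) (x y : I → ℝ) :
    vertexState d (x + y) = vertexState d x + vertexState d y := by
  simp [vertexState, add_div, Finset.sum_add_distrib]

theorem vertexState_smul (d : ℕ) (c : ℝ) (x : I → ℝ) :
    vertexState d (c • x) = c • vertexState d x := by
  simp [vertexState, Finset.smul_sum, mul_div_assoc]

theorem vertexState_sub (d : ℕ) (x y : I → ℝ) :
    vertexState d (x - y) = vertexState d x - vertexState d y := by
  have := vertexState_add d (x - y) y
  rw [sub_add_cancel] at this
  rw [this, add_sub_cancel_right]

theorem vertexState_piSingle {d : ℕ} (i : I) (c : ℝ) :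
    vertexState d (Pi.single i c) = Finsupp.single (Pi.single i d) (c / d) := by
  rw [vertexState, Finset.sum_eq_single i]
  · simp
  · intro j _ hj
    simp [hj]
  · simp

theorem exists_of_mem_support_vertexState {d : ℕ} {x : I → ℝ} {r : I → ℕ}
    (h : r ∈ (vertexState d x).support) : ∃ i, r = Pi.single i d ∧ x i ≠ 0 := by
  by_contra hc
  push Not at hc
  exact Finsupp.mem_support_iff.1 h (vertexState_eq_zero hc)

theorem mem_support_vertexState {d : ℕ} (hd : d ≠ 0) {x : I → ℝ} {i : I} (h : x i ≠ 0) :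
    Pi.single i d ∈ (vertexState d x).support := by
  rw [Finsupp.mem_support_iff, vertexState_single hd]
  exact div_ne_zero h (Nat.cast_ne_zero.2 hd)

theorem labelSupport_single {d : ℕ} (hd : d ≠ 0) (i : I) :
    labelSupport (Pi.single i d) = {i} := by
  ext j
  by_cases h : j = i
  · subst h; simp [hd]
  · simp [h]

/-- The indicator function of a set of coordinates. -/
def indicatorLabel (T : Finset I) : I → ℕ := fun i => if i ∈ T then 1 else 0

theorem sum_indicatorLabel (T : Finset I) : ∑ i, indicatorLabel T i = T.card := by
  simp [indicatorLabel]

theorem labelSupport_indicatorLabel_add {T : Finset I} {u : I → ℕ} (hu : labelSupport u ⊆ T) :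
    labelSupport (indicatorLabel T + u) = T := by
  ext i
  simp only [mem_labelSupport, Pi.add_apply, indicatorLabel]
  split_ifs with h
  · simp [h]
  · simp only [zero_add, h, iff_false, not_not]
    by_contra hi
    exact h (hu (mem_labelSupport.2 hi))

/-- The source of the recursion: subtracting 1 on `T` carries the interior lattice points of the
face `T` to all lattice points of the face `T` in a smaller dilate. -/
theorem exists_indicatorLabel_add {u : I → ℕ} {T : Finset I} (h : labelSupport u = T) :
    ∃ u', u = indicatorLabel T + u' ∧ labelSupport u' ⊆ T ∧ T.card + ∑ i, u' i = ∑ i, u i := by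
  have key : u = indicatorLabel T + (u - indicatorLabel T) := by
    ext i
    have : i ∈ T ↔ u i ≠ 0 := by rw [← h, mem_labelSupport]
    simp only [Pi.add_apply, Pi.sub_apply, indicatorLabel]
    split_ifs with hi
    · have := this.1 hi
      omega
    · omega
  refine ⟨u - indicatorLabel T, key, ?_, ?_⟩
  · intro i hi
    rw [← h, mem_labelSupport]
    intro h0
    simp [h0] at hi
  · conv_rhs => rw [key]
    simp [Finset.sum_add_distrib, sum_indicatorLabel, -Pi.sub_apply]

/-- The relabelling of the lattice points of a dilated simplex as the lattice points in the relative
interior of a face of a larger one. -/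
def shiftLabel (T : Finset I) (u : I → ℕ) : I → ℕ := indicatorLabel T + u

omit [Fintype I] in
theorem shiftLabel_injective (T : Finset I) : Function.Injective (shiftLabel T) :=
  add_right_injective _

-- A shifted label has at least two nonzero coordinates. Hence the two summands of `mixedState` have
-- disjoint supports and their coefficients can be read off separately.
omit [Fintype I] in
theorem not_shiftLabel_eq_single {T : Finset I} (hT : 2 ≤ T.card) {u : I → ℕ} {i : I} {d : ℕ} :
    shiftLabel T u ≠ Pi.single i d := by
  intro h
  obtain ⟨j, hj, hji⟩ := Finset.exists_mem_ne (by omega : 1 < T.card) i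
  have := congrFun h j
  simp [shiftLabel, indicatorLabel, hj, hji] at this

/-- A combination of the points `shiftLabel T (m • eᵢ)` and the vertices `d • eᵢ`. -/
noncomputable def mixedState (d m : ℕ) (T : Finset I) (w b : I → ℝ) : (I → ℕ) →₀ ℝ :=
  (vertexState m w).mapDomain (shiftLabel T) + vertexState d b

variable {d m : ℕ} {T : Finset I}

theorem mixedState_sub_add (w b w' b' w'' b'' : I → ℝ) (c : ℝ) :
    mixedState d m T w b - c • mixedState d m T w' b' + mixedState d m T w'' b'' =
      mixedState d m T (w - c • w' + w'') (b - c • b' + b'') := by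
  simp only [mixedState, vertexState_add, vertexState_sub, vertexState_smul, Finsupp.mapDomain_add,
    ← Finsupp.mapDomain_smul, smul_add]
  rw [show ∀ x y : (I → ℕ) →₀ ℝ, (x - y).mapDomain (shiftLabel T) =
    x.mapDomain (shiftLabel T) - y.mapDomain (shiftLabel T) from
      map_sub (Finsupp.mapDomain.addMonoidHom (shiftLabel T))]
  abel

theorem mixedState_nonneg {w b : I → ℝ} (hw : ∀ i, 0 ≤ w i) (hb : ∀ i, 0 ≤ b i) :
    0 ≤ mixedState d m T w b := by
  refine add_nonneg ?_ (vertexState_nonneg hb)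
  intro y
  by_cases hy : y ∈ Set.range (shiftLabel T)
  · obtain ⟨x, rfl⟩ := hy
    rw [Finsupp.mapDomain_apply (shiftLabel_injective T)]
    exact vertexState_nonneg hw x
  · rw [Finsupp.mapDomain_of_notMem_range _ _ hy]
    simp

theorem mixedState_shift (hT : 2 ≤ T.card) (hm : m ≠ 0) (w b : I → ℝ) (i : I) :
    mixedState d m T w b (shiftLabel T (Pi.single i m)) = w i / m := by
  rw [mixedState, Finsupp.add_apply, Finsupp.mapDomain_apply (shiftLabel_injective T),
    vertexState_single hm, vertexState_eq_zero, add_zero]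
  exact fun j h => absurd h (not_shiftLabel_eq_single hT)

theorem mixedState_single (hT : 2 ≤ T.card) (hd : d ≠ 0) (w b : I → ℝ) (i : I) :
    mixedState d m T w b (Pi.single i d) = b i / d := by
  rw [mixedState, Finsupp.add_apply, Finsupp.mapDomain_of_notMem_range, vertexState_single hd,
    zero_add]
  rintro ⟨u, hu⟩
  exact not_shiftLabel_eq_single hT hu

theorem exists_of_mem_support_mixedState {w b : I → ℝ} {r : I → ℕ}
    (h : r ∈ (mixedState d m T w b).support) :
    (∃ i, r = shiftLabel T (Pi.single i m) ∧ w i ≠ 0) ∨ ∃ i, r = Pi.single i d ∧ b i ≠ 0 := by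
  classical
  rcases Finset.mem_union.1 (Finsupp.support_add h) with h | h
  · rw [Finsupp.mapDomain_support_of_injective (shiftLabel_injective T), Finset.mem_image] at h
    obtain ⟨u, hu, rfl⟩ := h
    obtain ⟨i, rfl, hi⟩ := exists_of_mem_support_vertexState hu
    exact Or.inl ⟨i, rfl, hi⟩
  · exact Or.inr (exists_of_mem_support_vertexState h)

end Labels

/-! ### Splitting a face along the corners of its inner simplex -/

section Block

variable {I : Type*} [Fintype I] [LinearOrder I]

/-- The coefficients `w`, `b` of `x` after the star subdivisions at the points
`shiftLabel T (m • eᵢ)` for `i ∈ J`. -/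
structure IsPartialSplit (T J : Finset I) (m : ℕ) (x w b : I → ℝ) : Prop where
  left_nonneg : ∀ i, 0 ≤ w i
  right_nonneg : ∀ i, 0 ≤ b i
  left_supp : ∀ i, i ∉ J → w i = 0
  right_supp : ∀ i, i ∉ T → b i = 0
  eq : ∀ i ∈ T, x i = (∑ j, w j) / m + w i + b i
  ordered : ∀ i ∈ T, ∀ j ∈ T, i < j → w j = 0 ∨ b i = 0
  exhausted : (∃ i ∈ T, w i = 0 ∧ b i = 0) ∨ ∀ i ∈ J, b i = 0

theorem isPartialSplit_empty {T : Finset I} {m : ℕ} {x : I → ℝ} (hx : ∀ i, 0 ≤ x i)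
    (hT : ∀ i, i ∉ T → x i = 0) : IsPartialSplit T ∅ m x 0 x where
  left_nonneg _ := le_rfl
  right_nonneg := hx
  left_supp _ _ := rfl
  right_supp := hT
  eq i _ := by simp
  ordered _ _ _ _ _ := Or.inl rfl
  exhausted := Or.inr (by simp)

/-- The coefficients of `shiftLabel T (m • eⱼ)` before the star subdivision at this point. -/
noncomputable def cornerState (T : Finset I) (m : ℕ) (j : I) : (I → ℕ) →₀ ℝ :=
  mixedState (T.card + m) m T
    (fun i => if i ∈ T ∧ i < j then m / (m + ((T.filter (· < j)).card : ℝ)) else 0)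
    (fun i => if i ∈ T ∧ j ≤ i then
      m / (m + ((T.filter (· < j)).card : ℝ)) + (if i = j then (m : ℝ) else 0) else 0)

/-- The conditions of a partial split leave no freedom here. With `c = (∑ w) / m` and `N` elements
of `T` below `j`, each of these has `w i = 1 - c`, so `m c = N (1 - c)` and `1 - c = m / (m + N)`;
the `b i` follow. -/
theorem IsPartialSplit.eq_cornerState {T : Finset I} {m : ℕ} (hm : m ≠ 0) {j : I}
    (hj : j ∈ T) {w b : I → ℝ}
    (h : IsPartialSplit T (T.filter (· < j)) m
      (fun i => (shiftLabel T (Pi.single j m) i : ℝ)) w b) :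
    mixedState (T.card + m) m T w b = cornerState T m j := by
  have hm' : (0 : ℝ) < m := by positivity
  set c := (∑ i, w i) / m with hc
  have hx : ∀ i ∈ T, 1 + (if i = j then (m : ℝ) else 0) = c + w i + b i := by
    intro i hi
    rw [← h.eq i hi]
    by_cases hij : i = j
    · subst hij; simp [shiftLabel, indicatorLabel, hi]
    · simp [shiftLabel, indicatorLabel, hi, hij]
  have hw0 : ∀ i, ¬ (i ∈ T ∧ i < j) → w i = 0 := fun i hi => h.left_supp i (by simpa using hi)
  have hb0 : ∀ i ∈ T, i < j → b i = 0 := by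
    -- The first alternative is impossible: it gives `c ≥ 1`, which forces every `w k` to vanish,
    -- and then `c = 0`.
    rcases h.exhausted with ⟨i, hi, h1, h2⟩ | h
    · exfalso
      have h3 := hx i hi
      have h4 : (1 : ℝ) ≤ c := by
        have : (0 : ℝ) ≤ if i = j then (m : ℝ) else 0 := by split_ifs <;> positivity
        linarith
      have h5 : ∀ k, w k = 0 := by
        intro k
        by_cases hk : k ∈ T ∧ k < j
        · have := hx k hk.1
          rw [if_neg hk.2.ne] at this
          have := h.left_nonneg k
          have := h.right_nonneg k
          linarith
        · exact hw0 k hk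
      have : c = 0 := by simp [hc, h5]
      linarith
    · intro i hi hij
      exact h i (by simp [hi, hij])
  set N : ℝ := ((T.filter (· < j)).card : ℝ) with hN
  have hw : ∀ i, i ∈ T → i < j → w i = 1 - c := by
    intro i hi hij
    have := hx i hi
    rw [if_neg hij.ne, hb0 i hi hij] at this
    linarith
  have hsum : ∑ i, w i = N * (1 - c) := by
    rw [← Finset.sum_subset (Finset.subset_univ (T.filter (· < j)))]
    · rw [Finset.sum_congr rfl (g := fun _ => 1 - c)]
      · rw [Finset.sum_const, nsmul_eq_mul]
      · intro i hi
        rw [Finset.mem_filter] at hi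
        exact hw i hi.1 hi.2
    · intro i _ hi
      exact h.left_supp i hi
  have hN0 : 0 ≤ N := Nat.cast_nonneg _
  have hD : 0 < m + N := by linarith
  have hc1 : 1 - c = m / (m + N) := by
    have h1 : m * c = N * (1 - c) := by rw [← hsum, hc, mul_comm, div_mul_cancel₀ _ hm'.ne']
    rw [eq_div_iff hD.ne']
    linarith
  rw [cornerState]
  congr 1
  · ext i
    split_ifs with hi
    · rw [hw i hi.1 hi.2, hc1]
    · exact hw0 i hi
  · ext i
    split_ifs with hi hij
    · have := hx i hi.1
      rw [hw0 i (by simp [hi.2]), if_pos hij] at this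
      linarith
    · have := hx i hi.1
      rw [hw0 i (by simp [hi.2]), if_neg hij] at this
      linarith
    · by_cases hiT : i ∈ T
      · exact hb0 i hiT (by simpa [hiT] using hi)
      · exact h.right_supp i hiT

/-- The star subdivision at `shiftLabel T (m • eⱼ)`. -/
noncomputable def cornerStep (T : Finset I) (m : ℕ) (j : I) : (I → ℕ) × ((I → ℕ) →₀ ℝ) :=
  (shiftLabel T (Pi.single j m), cornerState T m j)

theorem shift_mem_support_cornerState {T : Finset I} (hT : 2 ≤ T.card) {m : ℕ} (hm : m ≠ 0)
    {i j : I} (hi : i ∈ T) (hij : i < j) :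
    shiftLabel T (Pi.single i m) ∈ (cornerState T m j).support := by
  rw [Finsupp.mem_support_iff, cornerState, mixedState_shift hT hm, if_pos ⟨hi, hij⟩]
  positivity

theorem single_mem_support_cornerState {T : Finset I} (hT : 2 ≤ T.card) {m : ℕ} (hm : m ≠ 0)
    {i j : I} (hi : i ∈ T) (hij : j ≤ i) :
    Pi.single i (T.card + m) ∈ (cornerState T m j).support := by
  rw [Finsupp.mem_support_iff, cornerState, mixedState_single hT (by omega), if_pos ⟨hi, hij⟩]
  split_ifs <;> positivity

/-- The corner `j` involves exactly one generator for each `i ∈ T`: the inner corner if `i < j`, the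
outer vertex if `j ≤ i`. As long as the split is not blocked, the weights `w` and `b` sit on these
same generators, so the amount traded is a single minimum of ratios over `T`. -/
theorem IsPartialSplit.step {T : Finset I} (hT : 2 ≤ T.card) {m : ℕ} (hm : m ≠ 0) {j : I}
    (hj : j ∈ T) {x w b : I → ℝ} (h : IsPartialSplit T (T.filter (· < j)) m x w b) :
    ∃ w' b', IsPartialSplit T (T.filter (· ≤ j)) m x w' b' ∧
      IsStep (cornerStep T m j) (mixedState (T.card + m) m T w b)
        (mixedState (T.card + m) m T w' b') := by
  have hm' : (0 : ℝ) < m := by positivity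
  have hd : T.card + m ≠ 0 := by omega
  set N : ℝ := ((T.filter (· < j)).card : ℝ) with hN
  have hN0 : 0 ≤ N := by positivity
  have hsub : ∀ i, i ∉ T.filter (· ≤ j) → i ∉ T.filter (· < j) := by
    intro i hi h
    simp only [Finset.mem_filter] at hi h
    exact hi ⟨h.1, h.2.le⟩
  -- If both weights vanish at some `i`, the generator of the corner `j` belonging to `i` has
  -- coefficient 0, and the step moves nothing.
  by_cases hz : ∃ i ∈ T, w i = 0 ∧ b i = 0
  · refine ⟨w, b, ⟨h.left_nonneg, h.right_nonneg, fun i hi => h.left_supp i (hsub i hi),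
      h.right_supp, h.eq, h.ordered, Or.inl hz⟩,
      isStep_self (mixedState_nonneg h.left_nonneg h.right_nonneg) ?_⟩
    obtain ⟨i, hi, hwi, hbi⟩ := hz
    rcases lt_or_ge i j with hij | hij
    · exact ⟨_, shift_mem_support_cornerState hT hm hi hij, by
        rw [mixedState_shift hT hm, hwi, zero_div]⟩
    · exact ⟨_, single_mem_support_cornerState hT hm hi hij, by
        rw [mixedState_single hT hd, hbi, zero_div]⟩
  have hb0 : ∀ i ∈ T, i < j → b i = 0 := fun i hi hij =>
    h.exhausted.resolve_left hz i (by simp [hi, hij])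
  set q : ℝ := m / (m + N) with hq
  have hq0 : 0 < q := by positivity
  set wk : I → ℝ := fun i => if i ∈ T ∧ i < j then q else 0 with hwk
  set bk : I → ℝ := fun i => if i ∈ T ∧ j ≤ i then q + (if i = j then (m : ℝ) else 0) else 0
    with hbk
  have hck : cornerState T m j = mixedState (T.card + m) m T wk bk := rfl
  -- On `T`, `den` is `wk + bk`, of which only one is nonzero at each index. The minimum of `(w + b)
  -- / den` is therefore the largest `c` allowed.
  set den : I → ℝ := fun i => q + (if i = j then (m : ℝ) else 0) with hden
  have hden0 : ∀ i, 0 < den i := by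
    intro i
    simp only [hden]
    split_ifs <;> positivity
  obtain ⟨r, hr, hmin⟩ := Finset.exists_min_image T (fun i => (w i + b i) / den i) ⟨j, hj⟩
  set c : ℝ := (w r + b r) / den r with hc
  have hc0 : 0 ≤ c := div_nonneg (add_nonneg (h.left_nonneg r) (h.right_nonneg r)) (hden0 r).le
  have hcle : ∀ i ∈ T, c * den i ≤ w i + b i := by
    intro i hi
    rw [← le_div_iff₀ (hden0 i)]
    exact hmin i hi
  have hceq : c * den r = w r + b r := div_mul_cancel₀ _ (hden0 r).ne'
  have hw0 : ∀ i, ¬ (i ∈ T ∧ i < j) → w i = 0 := fun i hi => h.left_supp i (by simpa using hi)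
  have hwle : ∀ i, c * wk i ≤ w i := by
    intro i
    simp only [hwk]
    split_ifs with hi
    · have := hcle i hi.1
      rw [hb0 i hi.1 hi.2] at this
      simpa [hden, hi.2.ne] using this
    · simpa using h.left_nonneg i
  have hble : ∀ i, c * bk i ≤ b i := by
    intro i
    simp only [hbk]
    split_ifs with hi hij
    · have := hcle i hi.1
      rw [hw0 i (by simp [hi.2])] at this
      simpa [hden, hij] using this
    · have := hcle i hi.1
      rw [hw0 i (by simp [hi.2])] at this
      simpa [hden, hij] using this
    · simpa using h.right_nonneg i
  have hwj : w j = 0 := hw0 j (by simp)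
  have hsumwk : ∑ i, wk i = N * q := by
    simp only [hwk]
    rw [← Finset.sum_filter, Finset.sum_const, nsmul_eq_mul, hN]
    congr 3
    ext i; simp
  have hpj : ∀ i, i ≠ j → (Pi.single j (c * m) : I → ℝ) i = 0 := fun i hi => by simp [hi]
  -- A corner carries the coefficient `w j / m`, so a coefficient `c` at the new corner is the
  -- weight `c * m`.
  refine ⟨w - c • wk + Pi.single j (c * m), b - c • bk + 0, ⟨?_, ?_, ?_, ?_, ?_, ?_, ?_⟩,
    c, hc0, ?_, ?_, ?_⟩
  · intro i
    have h1 := hwle i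
    have h2 : 0 ≤ (Pi.single j (c * m) : I → ℝ) i := by
      by_cases hi : i = j
      · subst hi; simp only [Pi.single_eq_same]; positivity
      · rw [hpj i hi]
    simp only [Pi.add_apply, Pi.sub_apply, Pi.smul_apply, smul_eq_mul]
    linarith
  · intro i
    simpa using hble i
  · intro i hi
    have h1 : ¬ (i ∈ T ∧ i < j) := by simpa using hsub i hi
    have h2 : i ≠ j := by rintro rfl; simp [hj] at hi
    simp [hw0 i h1, hwk, h1, h2]
  · intro i hi
    simp [h.right_supp i hi, hbk, hi]
  · intro i hi
    have hs : ∑ k, (w - c • wk + (Pi.single j (c * m) : I → ℝ)) k = ∑ k, w k - c * (N * q) + c * m := by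
      simp [Finset.sum_add_distrib, Finset.sum_sub_distrib, ← Finset.mul_sum, hsumwk]
    rw [hs, h.eq i hi]
    have hq' : (∑ k, w k - c * (N * q) + c * m) / m = (∑ k, w k) / m + c * q := by
      rw [hq]
      field_simp
      ring
    rw [hq']
    simp only [Pi.add_apply, Pi.sub_apply, Pi.smul_apply, smul_eq_mul, hwk, hbk]
    rcases lt_trichotomy i j with hij | hij | hij
    · simp [hi, hij, hij.ne, hij.not_ge]
    · subst hij; simp [hi]; ring
    · simp [hi, hij.le, hij.ne', hij.not_gt]
      ring
  · intro i hi k hk hik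
    rcases lt_or_ge i j with hij | hij
    · right
      simp [hb0 i hi hij, hbk, hij.not_ge]
    · left
      have : ¬ (k ∈ T ∧ k < j) := fun h' => (hij.trans hik.le).not_gt h'.2
      have hkj : k ≠ j := (hij.trans_lt hik).ne'
      simp [hw0 k this, hwk, (hij.trans_lt hik).not_gt, hkj]
  -- The index `r` attaining the minimum decides the alternative. For `r ≠ j` both new weights
  -- vanish at `r`; for `r = j` the new `b j` vanishes, as the earlier `b i` already did.
  · rcases lt_trichotomy r j with hrj | hrj | hrj
    · left
      refine ⟨r, hr, ?_, ?_⟩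
      · rw [hb0 r hr hrj] at hceq
        simp only [hden, if_neg hrj.ne, add_zero] at hceq
        simp [hwk, hr, hrj, hrj.ne, hceq]
      · simp [hb0 r hr hrj, hbk, hrj.not_ge]
    · right
      intro i hi
      rw [Finset.mem_filter] at hi
      rcases hi.2.lt_or_eq with hij | hij
      · simp [hb0 i hi.1 hij, hbk, hij.not_ge]
      · subst hij
        subst hrj
        rw [hwj] at hceq
        simp only [hden, if_true, zero_add] at hceq
        simp [hbk, hr, hceq]
    · left
      refine ⟨r, hr, ?_, ?_⟩
      · simp [hw0 r (by simp [hrj.le]), hwk, hrj.not_gt, hrj.ne']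
      · rw [hw0 r (by simp [hrj.le])] at hceq
        simp only [hden, if_neg hrj.ne', add_zero, zero_add] at hceq
        simp [hbk, hr, hrj.le, hrj.ne', hceq]
  · have : 0 ≤ mixedState (T.card + m) m T (w - c • wk + 0) (b - c • bk + 0) :=
      mixedState_nonneg (fun i => by simpa using hwle i) (fun i => by simpa using hble i)
    rw [← mixedState_sub_add] at this
    simpa [cornerStep, hck, mixedState, vertexState] using this
  · simp only [cornerStep]
    rcases lt_or_ge r j with hrj | hrj
    · refine ⟨_, shift_mem_support_cornerState hT hm hr hrj, ?_⟩
      rw [hck, mixedState_shift hT hm, mixedState_shift hT hm]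
      rw [hb0 r hr hrj] at hceq
      simp only [hden, if_neg hrj.ne, add_zero] at hceq
      simp only [hwk, hr, hrj, and_self, if_true]
      rw [← mul_div_assoc, hceq]
    · refine ⟨_, single_mem_support_cornerState hT hm hr hrj, ?_⟩
      rw [hck, mixedState_single hT hd, mixedState_single hT hd]
      rw [hw0 r (by simp [hrj])] at hceq
      simp only [hden, zero_add] at hceq
      simp only [hbk, hr, hrj, and_self, if_true]
      rw [← mul_div_assoc, hceq]
  · rw [← mixedState_sub_add, ← hck]
    congr 1
    simp only [mixedState, vertexState_piSingle, Finsupp.mapDomain_single, cornerStep]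
    rw [mul_div_assoc, div_self hm'.ne', mul_one]
    simp [vertexState]

end Block

/-! ### The full corner program and its integrality -/

section Corners

variable {I : Type*} [Fintype I] [LinearOrder I]

/-- A lattice point as a real vector. -/
abbrev realLabel (u : I → ℕ) : I → ℝ := fun i => u i

/-- The star subdivisions at the points `shiftLabel T (m • eᵢ)` for `i ∈ T`. -/
noncomputable def cornerProgram (T : Finset I) (m : ℕ) : List ((I → ℕ) × ((I → ℕ) →₀ ℝ)) :=
  T.sort.map (cornerStep T m)

omit [Fintype I] in
theorem toFinset_of_sort_eq_append {T : Finset I} {pre suf : List I} {j : I}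
    (h : T.sort = pre ++ j :: suf) :
    pre.toFinset = T.filter (· < j) ∧ (pre ++ [j]).toFinset = T.filter (· ≤ j) ∧ j ∈ T := by
  have hs : T.sort.Pairwise (· < ·) := T.sortedLT_sort.pairwise
  have hmem : ∀ i, i ∈ T ↔ i ∈ pre ∨ i = j ∨ i ∈ suf := by
    intro i
    rw [← Finset.mem_sort (r := (· ≤ ·)), h]
    simp
  rw [h, List.pairwise_append, List.pairwise_cons] at hs
  obtain ⟨-, ⟨h2, -⟩, h3⟩ := hs
  refine ⟨?_, ?_, (hmem j).2 (by simp)⟩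
  · ext i
    rw [List.mem_toFinset, Finset.mem_filter, hmem]
    constructor
    · exact fun hi => ⟨Or.inl hi, h3 i hi j (by simp)⟩
    · rintro ⟨hi | rfl | hi, hij⟩
      · exact hi
      · exact absurd hij (lt_irrefl _)
      · exact absurd hij (h2 i hi).not_gt
  · ext i
    rw [List.mem_toFinset, Finset.mem_filter, hmem]
    simp only [List.mem_append, List.mem_singleton]
    constructor
    · rintro (hi | rfl)
      · exact ⟨Or.inl hi, (h3 i hi j (by simp)).le⟩
      · exact ⟨Or.inr (Or.inl rfl), le_rfl⟩
    · rintro ⟨hi | rfl | hi, hij⟩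
      · exact Or.inl hi
      · exact Or.inr rfl
      · exact absurd hij (h2 i hi).not_ge

/-- Formulated for prefixes of the sorted list: the full list gives the final split, and the prefix
before `j` gives the coefficients to be recorded for the corner `j`. -/
theorem exists_isRun_corners {T : Finset I} (hT : 2 ≤ T.card) {m : ℕ} (hm : m ≠ 0) {x : I → ℝ}
    (hx : ∀ i, 0 ≤ x i) (hxT : ∀ i, i ∉ T → x i = 0) (pre : List I) :
    ∀ suf, T.sort = pre ++ suf → ∃ w b, IsPartialSplit T pre.toFinset m x w b ∧
      IsRun (pre.map (cornerStep T m)) (vertexState (T.card + m) x)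
        (mixedState (T.card + m) m T w b) := by
  induction pre using List.reverseRecOn with
  | nil =>
    intro suf _
    exact ⟨0, x, isPartialSplit_empty hx hxT, by simp [IsRun, mixedState, vertexState]⟩
  | append_singleton pre j ih =>
    intro suf h
    rw [List.append_assoc] at h
    obtain ⟨w, b, h1, h2⟩ := ih _ h
    obtain ⟨e1, e2, hj⟩ := toFinset_of_sort_eq_append h
    rw [e1] at h1
    obtain ⟨w', b', h3, h4⟩ := h1.step hT hm hj
    refine ⟨w', b', e2 ▸ h3, ?_⟩
    rw [List.map_append]
    exact isRun_append.2 ⟨_, h2, _, h4, rfl⟩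

theorem exists_isRun_cornerProgram {T : Finset I} (hT : 2 ≤ T.card) {m : ℕ} (hm : m ≠ 0)
    {x : I → ℝ} (hx : ∀ i, 0 ≤ x i) (hxT : ∀ i, i ∉ T → x i = 0) :
    ∃ w b, IsPartialSplit T T m x w b ∧
      IsRun (cornerProgram T m) (vertexState (T.card + m) x)
        (mixedState (T.card + m) m T w b) := by
  obtain ⟨w, b, h1, h2⟩ := exists_isRun_corners hT hm hx hxT T.sort [] (by simp)
  rw [Finset.sort_toFinset] at h1
  exact ⟨w, b, h1, h2⟩

theorem shiftLabel_of_notMem {T : Finset I} {u : I → ℕ} (hu : labelSupport u ⊆ T) {i : I}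
    (hi : i ∉ T) : shiftLabel T u i = 0 := by
  by_contra h
  rw [← labelSupport_indicatorLabel_add hu] at hi
  exact hi (mem_labelSupport.2 h)

theorem labelSupport_single_subset {m : ℕ} {T : Finset I} {j : I} (hj : j ∈ T) :
    labelSupport (Pi.single j m) ⊆ T := by
  intro i hi
  by_cases h : i = j
  · exact h ▸ hj
  · simp [h] at hi

theorem isAdapted_cornerProgram {T : Finset I} (hT : 2 ≤ T.card) {m : ℕ} (hm : m ≠ 0) :
    IsAdapted (fun u => vertexState (T.card + m) (realLabel u)) [] (cornerProgram T m) := by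
  have key : ∀ suf pre : List I, T.sort = pre ++ suf →
      IsAdapted (fun u => vertexState (T.card + m) (realLabel u)) (pre.map (cornerStep T m))
        (suf.map (cornerStep T m)) := by
    intro suf
    induction suf with
    | nil => intro pre _; trivial
    | cons j suf ih =>
      intro pre h
      refine ⟨?_, ?_⟩
      · obtain ⟨e1, -, hj⟩ := toFinset_of_sort_eq_append h
        obtain ⟨w, b, h1, h2⟩ := exists_isRun_corners hT hm
          (x := realLabel (shiftLabel T (Pi.single j m))) (fun i => Nat.cast_nonneg _)
          (fun i hi => by simp [shiftLabel_of_notMem (labelSupport_single_subset hj) hi]) pre _ h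
        rw [e1] at h1
        rw [h1.eq_cornerState hm hj] at h2
        exact h2
      · have := ih (pre ++ [j]) (by simpa using h)
        simpa using this
  exact key T.sort [] rfl

/-- Each corner has coordinate sum `T.card + m`, so the coefficients `w i / m` contribute that
multiple of `(∑ w) / m`. -/
theorem IsPartialSplit.sum_eq {T : Finset I} {m : ℕ} (hm : m ≠ 0) {x w b : I → ℝ}
    (hxT : ∀ i, i ∉ T → x i = 0) (h : IsPartialSplit T T m x w b) :
    ∑ i, x i = (T.card + m : ℕ) * ((∑ i, w i) / m) + ∑ i, b i := by
  have hm' : (m : ℝ) ≠ 0 := Nat.cast_ne_zero.2 hm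
  have h1 : ∀ f : I → ℝ, (∀ i, i ∉ T → f i = 0) → ∑ i, f i = ∑ i ∈ T, f i := fun f hf =>
    (Finset.sum_subset (Finset.subset_univ T) fun i _ hi => hf i hi).symm
  rw [h1 x hxT, h1 b h.right_supp, Finset.sum_congr rfl h.eq, Finset.sum_add_distrib,
    Finset.sum_add_distrib, ← h1 w h.left_supp, Finset.sum_const, nsmul_eq_mul]
  push_cast
  field_simp

/-- A lattice point in the relative interior of the face lies in the inner simplex, so nothing is
left at the outer vertices. Hence the recursive program starts from the coefficients it expects. -/
theorem isRun_cornerProgram_shiftLabel {T : Finset I} (hT : 2 ≤ T.card) {m : ℕ} (hm : m ≠ 0)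
    {u : I → ℕ} (hu : labelSupport u ⊆ T) (hsum : ∑ i, u i = m) :
    IsRun (cornerProgram T m) (vertexState (T.card + m) (realLabel (shiftLabel T u)))
      ((vertexState m (realLabel u)).mapDomain (shiftLabel T)) := by
  have hxT : ∀ i, i ∉ T → realLabel (shiftLabel T u) i = 0 := fun i hi => by
    simp [shiftLabel_of_notMem hu hi]
  obtain ⟨w, b, h1, h2⟩ := exists_isRun_cornerProgram hT hm
    (x := realLabel (shiftLabel T u)) (fun i => Nat.cast_nonneg _) hxT
  have hs := h1.sum_eq hm hxT
  have hd : (0 : ℝ) < (T.card + m : ℕ) := by positivity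
  have hsx : ∑ i, realLabel (shiftLabel T u) i = (T.card + m : ℕ) := by
    rw [← Nat.cast_sum]
    congr 1
    simp [shiftLabel, Finset.sum_add_distrib, sum_indicatorLabel, hsum]
  rw [hsx] at hs
  set c := (∑ i, w i) / m with hc
  have hb0 : 0 ≤ ∑ i, b i := Finset.sum_nonneg fun i _ => h1.right_nonneg i
  have hxi : ∀ i ∈ T, realLabel (shiftLabel T u) i = 1 + u i := fun i hi => by
    simp [realLabel, shiftLabel, indicatorLabel, hi]
  -- If both weights vanish at some `i`, then `c = 1 + u i ≥ 1`, while the sum equation gives `c ≤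
  -- 1`. If `b` vanishes, the sum equation gives `c = 1` directly.
  have hc1 : c = 1 := by
    rcases h1.exhausted with ⟨i, hi, hwi, hbi⟩ | h
    · have h3 := h1.eq i hi
      rw [hwi, hbi, ← hc, hxi i hi] at h3
      have h4 : (0 : ℝ) ≤ u i := Nat.cast_nonneg _
      nlinarith
    · have : ∑ i, b i = 0 := Finset.sum_eq_zero fun i _ => by
        by_cases hi : i ∈ T
        · exact h i hi
        · exact h1.right_supp i hi
      rw [this, add_zero] at hs
      nlinarith
  have hsb : ∑ i, b i = 0 := by rw [hc1] at hs; linarith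
  have hb : b = 0 := by
    ext i
    exact (Finset.sum_eq_zero_iff_of_nonneg fun i _ => h1.right_nonneg i).1 hsb i
      (Finset.mem_univ i)
  have hw : w = realLabel u := by
    ext i
    by_cases hi : i ∈ T
    · have h3 := h1.eq i hi
      rw [hb, ← hc, hxi i hi, hc1, show (0 : I → ℝ) i = 0 from rfl] at h3
      change w i = u i
      linarith
    · rw [h1.left_supp i hi]
      have : u i = 0 := by
        by_contra h0
        exact hi (hu (mem_labelSupport.2 h0))
      change (0 : ℝ) = u i
      rw [this, Nat.cast_zero]
  subst hw hb
  simpa [mixedState, vertexState] using h2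

theorem exists_natCast_eq {a : ℝ} (ha : 0 ≤ a) (h : a ∈ (Int.castAddHom ℝ).range) :
    (⌊a⌋₊ : ℝ) = a := by
  obtain ⟨z, rfl⟩ := h
  simp only [Int.coe_castAddHom] at *
  lift z to ℕ using by exact_mod_cast ha
  simp

/-- The quantity `c = (∑ w) / m` is integral, hence so is each `w i + b i = x i - c` on `T`. By
`ordered`, at most one index has both weights nonzero, and there `w i` is what the other weights
leave of `m c`. -/
theorem IsPartialSplit.exists_natCast {T : Finset I} (hT : 2 ≤ T.card) {m : ℕ} (hm : m ≠ 0)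
    {x : I → ℕ} {w b : I → ℝ} (hx : labelSupport x ⊆ T) (hd : T.card + m ∣ ∑ i, x i)
    (h : IsPartialSplit T T m (realLabel x) w b) :
    ∃ w' b' : I → ℕ, w = realLabel w' ∧ b = realLabel b' ∧ m ∣ ∑ i, w' i ∧
      T.card + m ∣ ∑ i, b' i ∧ (∀ i, b' i ≤ x i) ∧ labelSupport w' ⊆ T ∧
      ¬ T ⊆ labelSupport b' := by
  obtain ⟨e, he⟩ := hd
  have hm' : (0 : ℝ) < m := by positivity
  have hxT : ∀ i, i ∉ T → realLabel x i = 0 := by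
    intro i hi
    have : x i = 0 := by
      by_contra h0
      exact hi (hx (mem_labelSupport.2 h0))
    simp [this]
  have hs := h.sum_eq hm hxT
  set Z : AddSubgroup ℝ := (Int.castAddHom ℝ).range with hZ
  have hnat : ∀ a : ℕ, (a : ℝ) ∈ Z := fun a => ⟨a, by simp⟩
  have hsx : ∑ i, realLabel x i = (T.card + m : ℕ) * (e : ℝ) := by
    rw [← Nat.cast_sum, he, Nat.cast_mul]
  have hdpos : (0 : ℝ) < (T.card + m : ℕ) := by positivity
  set c := (∑ i, w i) / m with hc
  have hwc : ∑ i, w i = m * c := by rw [hc, mul_comm, div_mul_cancel₀ _ hm'.ne']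
  have hc0 : 0 ≤ c := div_nonneg (Finset.sum_nonneg fun i _ => h.left_nonneg i) hm'.le
  obtain ⟨i₀, hi₀⟩ : T.Nonempty := Finset.card_pos.1 (by omega)
  -- Either `c` equals the coordinate `x i` where both weights vanish, or `b = 0` and `c` is the
  -- quotient of the coordinate sum by `T.card + m`.
  have hcZ : c ∈ Z := by
    rcases h.exhausted with ⟨i, hi, hwi, hbi⟩ | h'
    · have := h.eq i hi
      rw [hwi, hbi, add_zero, add_zero, ← hc] at this
      exact this ▸ hnat _
    · have : ∑ i, b i = 0 := Finset.sum_eq_zero fun i _ => by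
        by_cases hi : i ∈ T
        · exact h' i hi
        · exact h.right_supp i hi
      rw [this, add_zero, hsx] at hs
      rw [← mul_left_cancel₀ hdpos.ne' hs]
      exact hnat e
  have hwb : ∀ i ∈ T, w i + b i ∈ Z := by
    intro i hi
    have : w i + b i = x i - c := by
      rw [show (x i : ℝ) = realLabel x i from rfl, h.eq i hi]; ring
    rw [this]
    exact Z.sub_mem (hnat _) hcZ
  have hwZ : ∀ i, w i ∈ Z := by
    intro i
    by_cases hi : i ∈ T
    · by_cases hwi : w i = 0
      · rw [hwi]; exact Z.zero_mem
      by_cases hbi : b i = 0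
      · simpa [hbi] using hwb i hi
      -- Since `w i ≠ 0` and `b i ≠ 0`, `ordered` kills `b j` for `j < i` and `w j` for `j > i`;
      -- every other `w j` is thus integral.
      have h1 : w i = m * c - ∑ j ∈ Finset.univ.erase i, w j := by
        rw [← hwc, ← Finset.add_sum_erase _ _ (Finset.mem_univ i)]
        ring
      rw [h1]
      refine Z.sub_mem ?_ (Z.sum_mem fun j hj => ?_)
      · rw [← nsmul_eq_mul]
        exact Z.nsmul_mem hcZ m
      · by_cases hjT : j ∈ T
        · rcases lt_or_gt_of_ne (Finset.ne_of_mem_erase hj) with hlt | hlt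
          · have := (h.ordered j hjT i hi hlt).resolve_left hwi
            simpa [this] using hwb j hjT
          · rw [(h.ordered i hi j hjT hlt).resolve_right hbi]
            exact Z.zero_mem
        · rw [h.left_supp j hjT]
          exact Z.zero_mem
    · rw [h.left_supp i hi]
      exact Z.zero_mem
  have hbZ : ∀ i, b i ∈ Z := by
    intro i
    by_cases hi : i ∈ T
    · have := Z.sub_mem (hwb i hi) (hwZ i)
      rwa [add_sub_cancel_left] at this
    · rw [h.right_supp i hi]
      exact Z.zero_mem
  have hw' : ∀ i, ((⌊w i⌋₊ : ℕ) : ℝ) = w i := fun i => exists_natCast_eq (h.left_nonneg i) (hwZ i)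
  have hb' : ∀ i, ((⌊b i⌋₊ : ℕ) : ℝ) = b i := fun i => exists_natCast_eq (h.right_nonneg i) (hbZ i)
  have hc' : ((⌊c⌋₊ : ℕ) : ℝ) = c := exists_natCast_eq hc0 hcZ
  refine ⟨fun i => ⌊w i⌋₊, fun i => ⌊b i⌋₊, funext fun i => (hw' i).symm,
    funext fun i => (hb' i).symm, ⟨⌊c⌋₊, ?_⟩, ?_, ?_, ?_, ?_⟩
  · have : ((∑ i, ⌊w i⌋₊ : ℕ) : ℝ) = (m * ⌊c⌋₊ : ℕ) := by
      push_cast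
      rw [Finset.sum_congr rfl fun i _ => hw' i, hc', hwc]
    exact_mod_cast this
  · have : (T.card + m) * e = (T.card + m) * ⌊c⌋₊ + ∑ i, ⌊b i⌋₊ := by
      have h1 : (((T.card + m) * e : ℕ) : ℝ) = ((T.card + m) * ⌊c⌋₊ + ∑ i, ⌊b i⌋₊ : ℕ) := by
        rw [Nat.cast_mul, ← hsx, hs, Nat.cast_add _ (∑ i, ⌊b i⌋₊), Nat.cast_mul, hc', Nat.cast_sum,
          Finset.sum_congr rfl fun i _ => hb' i]
      exact_mod_cast h1
    rw [← Nat.dvd_add_right (Dvd.intro _ rfl), ← this]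
    exact Dvd.intro _ rfl
  · intro i
    have : ((⌊b i⌋₊ : ℕ) : ℝ) ≤ x i := by
      rw [hb']
      by_cases hi : i ∈ T
      · have := h.eq i hi
        have := h.left_nonneg i
        simp only [realLabel] at *
        linarith
      · rw [h.right_supp i hi]
        exact Nat.cast_nonneg _
    exact_mod_cast this
  · intro i hi
    by_contra hiT
    rw [mem_labelSupport, h.left_supp i hiT] at hi
    simp at hi
  · intro hsub
    rcases h.exhausted with ⟨i, hi, -, hbi⟩ | h'
    · have := hsub hi
      simp [hbi] at this
    · have := hsub hi₀
      simp [h' i₀ hi₀] at this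

end Corners

/-! ### Programs for families of faces, by recursion on the dilation factor -/

section Program

variable {I : Type*} [Fintype I] [LinearOrder I]

/-- A sequence of star subdivisions at the lattice points of the dilated simplex whose supports
belong to `Ts`. -/
structure IsSubdivisionProgram (d : ℕ) (Ts : List (Finset I))
    (P : List ((I → ℕ) × ((I → ℕ) →₀ ℝ))) : Prop where
  adapted : IsAdapted (fun u => vertexState d (realLabel u)) [] P
  nodup : (P.map Prod.fst).Nodup
  mem_iff : ∀ u, u ∈ P.map Prod.fst ↔ ∑ i, u i = d ∧ labelSupport u ∈ Ts
  sorted : (P.map Prod.fst).Pairwise fun u v => (labelSupport v).card ≤ (labelSupport u).card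
  support_subset : ∀ p ∈ P, ∀ r ∈ p.2.support, labelSupport r ⊆ labelSupport p.1
  exists_not_subset : ∀ p ∈ P, ∀ S : Finset I, ¬ labelSupport p.1 ⊆ S →
    ∃ r ∈ p.2.support, ¬ labelSupport r ⊆ S

/-- The star subdivisions `P` split the lattice point `x` into an integral combination and a
remainder at the vertices which has none of the supports in `Ts`. -/
def RunsIntegrally (d : ℕ) (Ts : List (Finset I)) (P : List ((I → ℕ) × ((I → ℕ) →₀ ℝ)))
    (x : I → ℕ) : Prop :=
  ∃ (N : (I → ℕ) →₀ ℝ) (b : I → ℕ),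
    IsRun P (vertexState d (realLabel x)) (N + vertexState d (realLabel b)) ∧ 0 ≤ N ∧
    (∀ r, ∃ z : ℕ, N r = z) ∧ (∀ r ∈ N.support, labelSupport r ∈ Ts) ∧ (∀ i, b i ≤ x i) ∧
    d ∣ ∑ i, b i ∧ ∀ T ∈ Ts, ¬ T ⊆ labelSupport b

omit [Fintype I] [LinearOrder I] in
theorem realLabel_nonneg (x : I → ℕ) : ∀ i, 0 ≤ realLabel x i := fun _ => Nat.cast_nonneg _

omit [LinearOrder I] in
theorem labelSupport_mono {x y : I → ℕ} (h : ∀ i, x i ≤ y i) :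
    labelSupport x ⊆ labelSupport y := by
  intro i hi
  rw [mem_labelSupport] at *
  have := h i
  omega

theorem labelSupport_subset_of_mem_support {d : ℕ} {x r : I → ℕ}
    (h : r ∈ (vertexState d (realLabel x)).support) : labelSupport r ⊆ labelSupport x := by
  obtain ⟨i, rfl, hi⟩ := exists_of_mem_support_vertexState h
  exact labelSupport_single_subset (mem_labelSupport.2 fun h => hi (by simp [h]))

/-- Star subdivisions at points outside a face do not affect the points of this face. -/
theorem IsSubdivisionProgram.isRun_self {d : ℕ} {Ts : List (Finset I)}
    {P : List ((I → ℕ) × ((I → ℕ) →₀ ℝ))} (h : IsSubdivisionProgram d Ts P) {x : I → ℕ}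
    (hx : ∀ T ∈ Ts, ¬ T ⊆ labelSupport x) :
    IsRun P (vertexState d (realLabel x)) (vertexState d (realLabel x)) := by
  refine ToricTriangulation.isRun_self (vertexState_nonneg (realLabel_nonneg x)) fun p hp => ?_
  have hp' := (h.mem_iff p.1).1 (List.mem_map_of_mem hp)
  obtain ⟨r, hr, hr'⟩ := h.exists_not_subset p hp _ (hx _ hp'.2)
  refine ⟨r, hr, ?_⟩
  by_contra h0
  exact hr' (labelSupport_subset_of_mem_support (Finsupp.mem_support_iff.2 h0))

theorem isSubdivisionProgram_nil (d : ℕ) :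
    IsSubdivisionProgram d ([] : List (Finset I)) [] where
  adapted := trivial
  nodup := by simp
  mem_iff := by simp
  sorted := by simp
  support_subset := by simp
  exists_not_subset := by simp

/-- Subdividing inside `T` leaves alone every point whose support does not contain `T`. By `h1` this
covers all points of `P`, so the coefficients recorded there remain correct. -/
theorem IsSubdivisionProgram.cons {d : ℕ} {T : Finset I} {Ts : List (Finset I)}
    {B P : List ((I → ℕ) × ((I → ℕ) →₀ ℝ))} (hB : IsSubdivisionProgram d [T] B)
    (hP : IsSubdivisionProgram d Ts P) (h1 : ∀ S ∈ Ts, ¬ T ⊆ S)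
    (h2 : ∀ S ∈ Ts, S.card ≤ T.card) : IsSubdivisionProgram d (T :: Ts) (B ++ P) where
  adapted := by
    refine isAdapted_append.2 ⟨hB.adapted, ?_⟩
    have := hP.adapted.mapProgram (init' := fun u => vertexState d (realLabel u)) (A := B)
      Function.injective_id ?_
    · simpa only [mapProgram_id, List.nil_append, List.append_nil] using this
    · intro p hp
      rw [Finsupp.mapDomain_id]
      refine hB.isRun_self fun S hS => ?_
      rw [List.mem_singleton.1 hS]
      exact h1 _ ((hP.mem_iff p.1).1 (List.mem_map_of_mem hp)).2
  nodup := by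
    rw [List.map_append, List.nodup_append]
    refine ⟨hB.nodup, hP.nodup, ?_⟩
    rintro u hu _ hv rfl
    have h3 := ((hB.mem_iff u).1 hu).2
    rw [List.mem_singleton] at h3
    exact h1 _ ((hP.mem_iff u).1 hv).2 h3.ge
  mem_iff u := by
    rw [List.map_append, List.mem_append, hB.mem_iff, hP.mem_iff, List.mem_singleton,
      List.mem_cons]
    tauto
  sorted := by
    rw [List.map_append, List.pairwise_append]
    refine ⟨hB.sorted, hP.sorted, fun u hu v hv => ?_⟩
    rw [List.mem_singleton.1 ((hB.mem_iff u).1 hu).2]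
    exact h2 _ ((hP.mem_iff v).1 hv).2
  support_subset p hp := by
    rcases List.mem_append.1 hp with hp | hp
    · exact hB.support_subset p hp
    · exact hP.support_subset p hp
  exists_not_subset p hp := by
    rcases List.mem_append.1 hp with hp | hp
    · exact hB.exists_not_subset p hp
    · exact hP.exists_not_subset p hp

/-- The integral part produced by `B` sits on labels of support `T`. No step of `P` involves such a
label, because the supports in `Ts` do not contain `T`; so `P` acts on the remainder alone. -/
theorem RunsIntegrally.append {d : ℕ} {T : Finset I} {Ts : List (Finset I)}
    {B P : List ((I → ℕ) × ((I → ℕ) →₀ ℝ))} (hP : IsSubdivisionProgram d Ts P)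
    (h1 : ∀ S ∈ Ts, ¬ T ⊆ S) {x : I → ℕ} (hx : RunsIntegrally d [T] B x)
    (h : ∀ b : I → ℕ, (∀ i, b i ≤ x i) → d ∣ ∑ i, b i → ¬ T ⊆ labelSupport b →
      RunsIntegrally d Ts P b) : RunsIntegrally d (T :: Ts) (B ++ P) x := by
  obtain ⟨N, b, hrun, hN, hNz, hNs, hb, hbd, hbT⟩ := hx
  obtain ⟨N', b', hrun', hN', hNz', hNs', hb', hbd', hbT'⟩ := h b hb hbd (hbT T (by simp))
  refine ⟨N + N', b', isRun_append.2 ⟨_, hrun, ?_⟩, add_nonneg hN hN', ?_, ?_, ?_, hbd', ?_⟩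
  · rw [add_assoc]
    refine hrun'.add_left hN fun p hp r hr => ?_
    by_contra h0
    have h2 := hNs r (Finsupp.mem_support_iff.2 h0)
    rw [List.mem_singleton] at h2
    exact h1 _ ((hP.mem_iff p.1).1 (List.mem_map_of_mem hp)).2
      (h2 ▸ hP.support_subset p hp r hr)
  · intro r
    obtain ⟨z, hz⟩ := hNz r
    obtain ⟨z', hz'⟩ := hNz' r
    exact ⟨z + z', by simp [hz, hz']⟩
  · intro r hr
    rcases Finset.mem_union.1 (Finsupp.support_add hr) with hr | hr
    · exact List.mem_cons.2 (Or.inl (List.mem_singleton.1 (hNs r hr)))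
    · exact List.mem_cons.2 (Or.inr (hNs' r hr))
  · exact fun i => (hb' i).trans (hb i)
  · intro S hS
    rcases List.mem_cons.1 hS with rfl | hS
    · exact fun h => hbT S (by simp) (h.trans (labelSupport_mono hb'))
    · exact hbT' S hS

/-- The existence of a sequence of star subdivisions at all lattice points of the `d`-fold dilated
simplex, other than the vertices, whose supports belong to a family of sets. -/
def HasProgram (I : Type*) [Fintype I] [LinearOrder I] (d : ℕ) : Prop :=
  ∀ F : Finset (Finset I), IsLowerSet (F : Set (Finset I)) →
    ∃ (Ts : List (Finset I)) (P : List ((I → ℕ) × ((I → ℕ) →₀ ℝ))),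
      (∀ T, T ∈ Ts ↔ T ∈ F ∧ 2 ≤ T.card ∧ T.card ≤ d) ∧
      IsSubdivisionProgram d Ts P ∧
      ∀ x : I → ℕ, labelSupport x ∈ F → d ∣ ∑ i, x i →
        ∃ N : (I → ℕ) →₀ ℝ, IsRun P (vertexState d (realLabel x)) N ∧ 0 ≤ N ∧
          (∀ r, ∃ z : ℕ, N r = z) ∧ ∀ r ∈ N.support, labelSupport r ∈ F

omit [LinearOrder I] in
theorem card_labelSupport_le_sum (u : I → ℕ) : (labelSupport u).card ≤ ∑ i, u i := by
  rw [Finset.card_eq_sum_ones]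
  refine (Finset.sum_le_sum fun i hi => ?_).trans
    (Finset.sum_le_sum_of_subset (Finset.subset_univ _))
  exact Nat.one_le_iff_ne_zero.2 (mem_labelSupport.1 hi)

theorem eq_single_of_labelSupport_subset {u : I → ℕ} {i : I} (h : labelSupport u ⊆ {i}) :
    u = Pi.single i (∑ j, u j) := by
  have h0 : ∀ j, j ≠ i → u j = 0 := fun j hj => by
    by_contra h1
    exact hj (Finset.mem_singleton.1 (h (mem_labelSupport.2 h1)))
  ext j
  by_cases hj : j = i
  · subst hj
    rw [Pi.single_eq_same, Finset.sum_eq_single j (fun k _ hk => h0 k hk) (by simp)]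
  · rw [h0 j hj]; simp [hj]

/-- For `d = T.card` the only lattice point inside the face is `1_T`. The amount traded is the
minimum of `x` over `T`, a natural number, and the coordinate attaining it becomes 0. -/
theorem exists_program_card {T : Finset I} (hT : 2 ≤ T.card) :
    ∃ B, IsSubdivisionProgram T.card [T] B ∧
      ∀ x : I → ℕ, T.card ∣ ∑ i, x i → RunsIntegrally T.card [T] B x := by
  set k := T.card with hk
  have hk0 : k ≠ 0 := by omega
  have hsupp : labelSupport (indicatorLabel T) = T := by
    have := labelSupport_indicatorLabel_add (T := T) (u := 0) (by intro i; simp)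
    simpa using this
  have hmemT : ∀ r ∈ (vertexState k (realLabel (indicatorLabel T))).support,
      ∃ i ∈ T, r = Pi.single i k := by
    intro r hr
    obtain ⟨i, rfl, hi⟩ := exists_of_mem_support_vertexState hr
    refine ⟨i, ?_, rfl⟩
    by_contra h
    simp [indicatorLabel, h] at hi
  have hmemT' : ∀ i ∈ T, (Pi.single i k : I → ℕ) ∈
      (vertexState k (realLabel (indicatorLabel T))).support := fun i hi =>
    mem_support_vertexState hk0 (by simp [indicatorLabel, hi])
  refine ⟨[(indicatorLabel T, vertexState k (realLabel (indicatorLabel T)))], ?_, ?_⟩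
  · refine ⟨⟨rfl, trivial⟩, by simp, ?_, by simp, ?_, ?_⟩
    · intro u
      simp only [List.map_cons, List.map_nil, List.mem_singleton]
      constructor
      · rintro rfl
        exact ⟨sum_indicatorLabel T, hsupp⟩
      · rintro ⟨h1, h2⟩
        obtain ⟨u', rfl, h3, h4⟩ := exists_indicatorLabel_add h2
        have : ∑ i, u' i = 0 := by omega
        rw [Finset.sum_eq_zero_iff] at this
        ext i
        simp [this i]
    · simp only [List.mem_singleton, forall_eq]
      intro r hr
      obtain ⟨i, hi, rfl⟩ := hmemT r hr
      rw [hsupp]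
      exact labelSupport_single_subset hi
    · simp only [List.mem_singleton, forall_eq]
      intro S hS
      rw [hsupp, Finset.not_subset] at hS
      obtain ⟨i, hi, hiS⟩ := hS
      exact ⟨_, hmemT' i hi, by rw [labelSupport_single hk0]; simpa using hiS⟩
  · intro x hx
    obtain ⟨r, hr, hmin⟩ := Finset.exists_min_image T x (Finset.card_pos.1 (by omega))
    set c := x r with hc
    have hle : ∀ i, c * indicatorLabel T i ≤ x i := by
      intro i
      by_cases hi : i ∈ T
      · simpa [indicatorLabel, hi] using hmin i hi
      · simp [indicatorLabel, hi]
    have hbx : ∀ i, x i - c * indicatorLabel T i ≤ x i := fun i => Nat.sub_le _ _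
    have hcast : realLabel (fun i => x i - c * indicatorLabel T i) =
        realLabel x - (c : ℝ) • realLabel (indicatorLabel T) := by
      ext i
      simp [realLabel, Nat.cast_sub (hle i)]
    refine ⟨Finsupp.single (indicatorLabel T) (c : ℝ), fun i => x i - c * indicatorLabel T i,
      ⟨_, ⟨c, Nat.cast_nonneg _, ?_, ⟨Pi.single r k, hmemT' r hr, ?_⟩, rfl⟩, ?_⟩,
      Finsupp.single_nonneg.2 (Nat.cast_nonneg _), ?_, ?_, hbx, ?_, ?_⟩
    · rw [← sub_nonneg, ← vertexState_smul, ← vertexState_sub, ← hcast]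
      exact vertexState_nonneg (realLabel_nonneg _)
    · rw [vertexState_single hk0, vertexState_single hk0]
      simp [realLabel, indicatorLabel, hr, hc, div_eq_mul_inv]
    · rw [hcast, vertexState_sub, vertexState_smul]
      change _ = _
      abel
    · intro s
      classical
      rw [Finsupp.single_apply]
      split_ifs
      · exact ⟨c, rfl⟩
      · exact ⟨0, by simp⟩
    · intro s hs
      have := Finsupp.support_single_subset hs
      rw [Finset.mem_singleton] at this
      rw [this, hsupp]
      simp
    · have h1 : ∑ i, (x i - c * indicatorLabel T i) + c * k = ∑ i, x i := by
        rw [hk, ← sum_indicatorLabel T, Finset.mul_sum, ← Finset.sum_add_distrib]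
        exact Finset.sum_congr rfl fun i _ => Nat.sub_add_cancel (hle i)
      rw [← Nat.dvd_add_left (Dvd.intro_left c rfl), h1]
      exact hx
    · simp only [List.mem_singleton, forall_eq]
      intro h
      have := h hr
      simp [indicatorLabel, hr, hc] at this

/-- The corners of the inner simplex come first, then the shifted program for `m` on the faces of
`T`. Points whose support strictly contains `T` are excluded from the integrality claim because the
corner analysis requires coordinates vanishing off `T`. -/
theorem exists_program_corner {T : Finset I} (hT : 2 ≤ T.card) {m : ℕ} (hm : m ≠ 0)
    (hI : HasProgram I m) :
    ∃ B, IsSubdivisionProgram (T.card + m) [T] B ∧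
      ∀ x : I → ℕ, (T ⊆ labelSupport x → labelSupport x = T) → T.card + m ∣ ∑ i, x i →
        RunsIntegrally (T.card + m) [T] B x := by
  have hd : T.card + m ≠ 0 := by omega
  obtain ⟨Ts, P, hTs, hP, hint⟩ := hI T.powerset (by
    intro A B hBA hA
    simp only [Finset.coe_powerset, Set.mem_preimage, Set.mem_powerset_iff,
      Finset.coe_subset] at *
    exact hBA.trans hA)
  simp only [Finset.mem_powerset] at hTs hint
  have hPT : ∀ p ∈ P, labelSupport p.1 ⊆ T ∧ ∑ i, p.1 i = m ∧ 2 ≤ (labelSupport p.1).card := by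
    intro p hp
    have h1 := (hP.mem_iff p.1).1 (List.mem_map_of_mem hp)
    have h2 := (hTs _).1 h1.2
    exact ⟨h2.1, h1.1, h2.2.1⟩
  have hcs : ∀ j ∈ T, labelSupport (shiftLabel T (Pi.single j m)) = T := fun j hj =>
    labelSupport_indicatorLabel_add (labelSupport_single_subset hj)
  have hPr : ∀ p ∈ P, ∀ r ∈ p.2.support, labelSupport (shiftLabel T r) = T := fun p hp r hr =>
    labelSupport_indicatorLabel_add ((hP.support_subset p hp r hr).trans (hPT p hp).1)
  have hmapsupp : ∀ q ∈ mapProgram (shiftLabel T) P, ∃ p ∈ P, q.1 = shiftLabel T p.1 ∧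
      q.2.support = p.2.support.image (shiftLabel T) := by
    intro q hq
    obtain ⟨p, hp, rfl⟩ := List.mem_map.1 hq
    exact ⟨p, hp, rfl, Finsupp.mapDomain_support_of_injective (shiftLabel_injective T) _⟩
  have hlabels : (cornerProgram T m ++ mapProgram (shiftLabel T) P).map Prod.fst =
      (T.sort.map (fun j => (Pi.single j m : I → ℕ)) ++ P.map Prod.fst).map (shiftLabel T) := by
    simp [cornerProgram, mapProgram, cornerStep, Function.comp_def]
  have hmem : ∀ u, u ∈ (cornerProgram T m ++ mapProgram (shiftLabel T) P).map Prod.fst ↔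
      ∑ i, u i = T.card + m ∧ labelSupport u ∈ [T] := by
    intro u
    rw [hlabels, List.mem_map, List.mem_singleton]
    constructor
    · rintro ⟨v, hv, rfl⟩
      have hv' : labelSupport v ⊆ T ∧ ∑ i, v i = m := by
        rcases List.mem_append.1 hv with hv | hv
        · obtain ⟨j, hj, rfl⟩ := List.mem_map.1 hv
          exact ⟨labelSupport_single_subset ((Finset.mem_sort _).1 hj), by simp⟩
        · obtain ⟨p, hp, rfl⟩ := List.mem_map.1 hv
          exact ⟨(hPT p hp).1, (hPT p hp).2.1⟩
      refine ⟨?_, labelSupport_indicatorLabel_add hv'.1⟩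
      simp [shiftLabel, Finset.sum_add_distrib, sum_indicatorLabel, hv'.2]
    · rintro ⟨h1, h2⟩
      obtain ⟨v, rfl, h3, h4⟩ := exists_indicatorLabel_add h2
      refine ⟨v, ?_, rfl⟩
      have hvm : ∑ i, v i = m := by omega
      rw [List.mem_append]
      -- The recursive program omits the vertices of its simplex; these are exactly the corners
      -- already treated.
      by_cases hc : 2 ≤ (labelSupport v).card
      · right
        rw [hP.mem_iff, hTs]
        exact ⟨hvm, h3, hc, (card_labelSupport_le_sum v).trans hvm.le⟩
      · left
        have hne : (labelSupport v).Nonempty := by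
          rw [Finset.nonempty_iff_ne_empty]
          intro h0
          apply hm
          rw [← hvm]
          refine Finset.sum_eq_zero fun i _ => ?_
          by_contra hi
          have := mem_labelSupport.2 hi
          rw [h0] at this
          simp at this
        obtain ⟨i, hi⟩ := Finset.card_eq_one.1
          (by have := hne.card_pos; omega : (labelSupport v).card = 1)
        have hv := eq_single_of_labelSupport_subset hi.le
        rw [hvm] at hv
        rw [List.mem_map]
        exact ⟨i, (Finset.mem_sort _).2 (h3 (by simp [hi])), hv.symm⟩
  have hprog : IsSubdivisionProgram (T.card + m) [T]
      (cornerProgram T m ++ mapProgram (shiftLabel T) P) := by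
    refine ⟨?_, ?_, hmem, ?_, ?_, ?_⟩
    · refine isAdapted_append.2 ⟨isAdapted_cornerProgram hT hm, ?_⟩
      have := hP.adapted.mapProgram (init' := fun u => vertexState (T.card + m) (realLabel u))
        (shiftLabel_injective T) (A := cornerProgram T m) fun p hp =>
          isRun_cornerProgram_shiftLabel hT hm (hPT p hp).1 (hPT p hp).2.1
      simpa [mapProgram] using this
    · rw [hlabels]
      refine List.Nodup.map (shiftLabel_injective T) (List.nodup_append.2 ⟨?_, hP.nodup, ?_⟩)
      · exact (Finset.sort_nodup _ _).map (single_injective hm)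
      · rintro u hu _ hv rfl
        obtain ⟨j, -, rfl⟩ := List.mem_map.1 hu
        obtain ⟨p, hp, hpj⟩ := List.mem_map.1 hv
        have := (hPT p hp).2.2
        rw [hpj, labelSupport_single hm] at this
        simp at this
    · refine List.Pairwise.imp_of_mem (R := fun _ _ => True) ?_ (List.pairwise_of_forall fun _ _ => trivial)
      intro u v hu hv _
      rw [List.mem_singleton.1 ((hmem u).1 hu).2, List.mem_singleton.1 ((hmem v).1 hv).2]
    · intro q hq r hr
      rw [List.mem_singleton.1 ((hmem q.1).1 (List.mem_map_of_mem hq)).2]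
      rcases List.mem_append.1 hq with hq | hq
      · obtain ⟨j, hj, rfl⟩ := List.mem_map.1 hq
        rcases exists_of_mem_support_mixedState hr with ⟨i, rfl, hi⟩ | ⟨i, rfl, hi⟩
        · have : i ∈ T := by
            by_contra h
            simp [h] at hi
          exact (hcs i this).le
        · have : i ∈ T := by
            by_contra h
            simp [h] at hi
          exact labelSupport_single_subset this
      · obtain ⟨p, hp, -, h2⟩ := hmapsupp q hq
        rw [h2, Finset.mem_image] at hr
        obtain ⟨s, hs, rfl⟩ := hr
        exact (hPr p hp s hs).le
    · intro q hq S hS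
      rw [List.mem_singleton.1 ((hmem q.1).1 (List.mem_map_of_mem hq)).2] at hS
      rcases List.mem_append.1 hq with hq | hq
      · obtain ⟨j, hj, rfl⟩ := List.mem_map.1 hq
        obtain ⟨i, hi, hiS⟩ := Finset.not_subset.1 hS
        rcases lt_or_ge i j with hij | hij
        · exact ⟨_, shift_mem_support_cornerState hT hm hi hij, by rwa [hcs i hi]⟩
        · refine ⟨_, single_mem_support_cornerState hT hm hi hij, ?_⟩
          rw [labelSupport_single hd]
          simpa using hiS
      · obtain ⟨p, hp, -, h2⟩ := hmapsupp q hq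
        obtain ⟨r, hr, -⟩ := hP.exists_not_subset p hp ∅ (by
          rw [Finset.subset_empty, ← Finset.card_eq_zero]
          have := (hPT p hp).2.2
          omega)
        refine ⟨shiftLabel T r, ?_, ?_⟩
        · rw [h2]
          exact Finset.mem_image_of_mem _ hr
        · rwa [hPr p hp r hr]
  refine ⟨_, hprog, fun x hx hdx => ?_⟩
  by_cases hTx : T ⊆ labelSupport x
  · have hxT := hx hTx
    obtain ⟨w, b, hs, hrun⟩ := exists_isRun_cornerProgram hT hm (x := realLabel x)
      (realLabel_nonneg x) (fun i hi => by
        rw [← hxT, mem_labelSupport, not_not] at hi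
        simp [hi])
    obtain ⟨w', b', rfl, rfl, hw, hb, hbx, hwT, hbT⟩ := hs.exists_natCast hT hm hxT.le hdx
    obtain ⟨N, hN, hN0, hNz, hNs⟩ := hint w' hwT hw
    refine ⟨N.mapDomain (shiftLabel T), b', isRun_append.2 ⟨_, hrun, ?_⟩, ?_, ?_, ?_, hbx, hb,
      by simpa using hbT⟩
    -- The remainder at the outer vertices shares no label with the shifted program and is carried
    -- along unchanged.
    · rw [mixedState, add_comm, add_comm (N.mapDomain _)]
      refine (hN.mapDomain (shiftLabel_injective T)).add_left
        (vertexState_nonneg (realLabel_nonneg _)) fun q hq r hr => ?_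
      obtain ⟨p, hp, -, h2⟩ := hmapsupp q hq
      rw [h2, Finset.mem_image] at hr
      obtain ⟨s, -, rfl⟩ := hr
      exact vertexState_eq_zero fun i hi => absurd hi (not_shiftLabel_eq_single hT)
    · intro y
      by_cases hy : y ∈ Set.range (shiftLabel T)
      · obtain ⟨z, rfl⟩ := hy
        rw [Finsupp.mapDomain_apply (shiftLabel_injective T)]
        exact hN0 z
      · rw [Finsupp.mapDomain_of_notMem_range _ _ hy]
        exact le_rfl
    · intro y
      by_cases hy : y ∈ Set.range (shiftLabel T)
      · obtain ⟨z, rfl⟩ := hy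
        rw [Finsupp.mapDomain_apply (shiftLabel_injective T)]
        exact hNz z
      · rw [Finsupp.mapDomain_of_notMem_range _ _ hy]
        exact ⟨0, by simp⟩
    · intro r hr
      rw [Finsupp.mapDomain_support_of_injective (shiftLabel_injective T), Finset.mem_image] at hr
      obtain ⟨s, hs, rfl⟩ := hr
      rw [List.mem_singleton]
      exact labelSupport_indicatorLabel_add (hNs s hs)
  · refine ⟨0, x, ?_, le_rfl, fun r => ⟨0, by simp⟩, by simp, fun _ => le_rfl, hdx,
      by simpa using hTx⟩
    rw [zero_add]
    exact hprog.isRun_self (by simpa using hTx)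

/-- The condition on the subsets of `labelSupport x` is the invariant of the induction: whatever is
not in the list has been treated before and no longer lies in the support. Each treated face passes
a smaller remainder to the rest of the list. -/
theorem exists_program_list {d : ℕ} (hI : ∀ m < d, m ≠ 0 → HasProgram I m)
    (Ts : List (Finset I)) (h1 : Ts.Pairwise fun A B => B.card ≤ A.card ∧ A ≠ B)
    (h2 : ∀ T ∈ Ts, 2 ≤ T.card ∧ T.card ≤ d) :
    ∃ P, IsSubdivisionProgram d Ts P ∧ ∀ x : I → ℕ, d ∣ ∑ i, x i →
      (∀ T ⊆ labelSupport x, 2 ≤ T.card → T.card ≤ d → T ∈ Ts) → RunsIntegrally d Ts P x := by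
  induction Ts with
  | nil =>
    refine ⟨[], isSubdivisionProgram_nil d, fun x hx _ => ⟨0, x, ?_, le_rfl,
      fun r => ⟨0, by simp⟩, by simp, fun _ => le_rfl, hx, by simp⟩⟩
    simp [IsRun]
  | cons T Ts ih =>
    rw [List.pairwise_cons] at h1
    obtain ⟨P, hP, hint⟩ := ih h1.2 fun S hS => h2 S (by simp [hS])
    obtain ⟨hT2, hTd⟩ := h2 T (by simp)
    have hTS : ∀ S ∈ Ts, ¬ T ⊆ S := fun S hS hsub =>
      (h1.1 S hS).2 (Finset.eq_of_subset_of_card_le hsub (h1.1 S hS).1)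
    obtain ⟨B, hB, hBint⟩ : ∃ B, IsSubdivisionProgram d [T] B ∧
        ∀ x : I → ℕ, (T.card < d → T ⊆ labelSupport x → labelSupport x = T) → d ∣ ∑ i, x i →
          RunsIntegrally d [T] B x := by
      rcases hTd.lt_or_eq with hlt | heq
      · obtain ⟨m, rfl⟩ := Nat.exists_eq_add_of_le hTd
        have hm : m ≠ 0 := by omega
        obtain ⟨B, hB, hBint⟩ := exists_program_corner hT2 hm (hI m (by omega) hm)
        exact ⟨B, hB, fun x hx => hBint x (hx hlt)⟩
      · subst heq
        obtain ⟨B, hB, hBint⟩ := exists_program_card hT2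
        exact ⟨B, hB, fun x _ => hBint x⟩
    refine ⟨B ++ P, hB.cons hP hTS fun S hS => (h1.1 S hS).1, fun x hx hall => ?_⟩
    refine RunsIntegrally.append hP hTS (hBint x ?_ hx) ?_
    -- A support strictly larger than `T` contains some `insert i T`, which still has at most `d`
    -- elements. The invariant would put it in the list, whose largest member is `T`.
    · intro hlt hsub
      by_contra hne
      obtain ⟨i, hi, hiT⟩ := Finset.exists_of_ssubset (hsub.ssubset_of_ne (Ne.symm hne))
      have hc : (insert i T).card = T.card + 1 := Finset.card_insert_of_notMem hiT
      have h3 := hall (insert i T) (Finset.insert_subset hi hsub) (by omega) (by omega)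
      rcases List.mem_cons.1 h3 with h4 | h4
      · rw [h4] at hc
        omega
      · have := (h1.1 _ h4).1
        omega
    · intro b hb hbd hbT
      refine hint b hbd fun S hS hS2 hSd => ?_
      rcases List.mem_cons.1 (hall S (hS.trans (labelSupport_mono hb)) hS2 hSd) with rfl | h4
      · exact absurd hS hbT
      · exact h4

omit [Fintype I] [LinearOrder I] in
theorem exists_sorted_list (F : Finset (Finset I)) : ∃ L : List (Finset I),
    (∀ T, T ∈ L ↔ T ∈ F) ∧ L.Pairwise fun A B => B.card ≤ A.card ∧ A ≠ B := by
  let r : Finset I → Finset I → Prop := fun A B => B.card ≤ A.card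
  have : Std.Total r := ⟨fun A B => le_total _ _⟩
  have : IsTrans (Finset I) r := ⟨fun A B C h1 h2 => le_trans h2 h1⟩
  have : DecidableRel r := fun A B => inferInstanceAs (Decidable (B.card ≤ A.card))
  refine ⟨F.toList.insertionSort r, by simp, ?_⟩
  exact (List.pairwise_insertionSort r _).and
    ((List.perm_insertionSort r _).nodup_iff.2 F.nodup_toList)

theorem hasProgram (d : ℕ) (hd : d ≠ 0) : HasProgram I d := by
  induction d using Nat.strong_induction_on with
  | _ d ih =>
    intro F hF
    obtain ⟨Ts, hTs, hpair⟩ := exists_sorted_list (F.filter fun T => 2 ≤ T.card ∧ T.card ≤ d)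
    simp only [Finset.mem_filter] at hTs
    obtain ⟨P, hP, hint⟩ := exists_program_list ih Ts hpair fun T hT => ((hTs T).1 hT).2
    refine ⟨Ts, P, hTs, hP, fun x hxF hx => ?_⟩
    obtain ⟨N, b, hrun, hN0, hNz, hNs, hbx, hbd, hbT⟩ := hint x hx fun T hT h2 h3 =>
      (hTs T).2 ⟨hF hT hxF, h2, h3⟩
    -- For `d ≥ 2` the remainder contains no pair, so it is concentrated at one coordinate, which
    -- equals the whole sum. For `d = 1` no pair is listed, but divisibility is trivial.
    have hdvd : ∀ i, d ∣ b i := by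
      intro i
      by_cases hi : b i = 0
      · simp [hi]
      by_cases hd1 : d = 1
      · simp [hd1]
      have hsub : labelSupport b ⊆ {i} := by
        intro j hj
        by_contra hji
        rw [Finset.mem_singleton] at hji
        have hp : ({i, j} : Finset I) ⊆ labelSupport b := by
          intro k hk
          rw [Finset.mem_insert, Finset.mem_singleton] at hk
          rcases hk with rfl | rfl
          · exact mem_labelSupport.2 hi
          · exact hj
        have hc : ({i, j} : Finset I).card = 2 := Finset.card_pair (Ne.symm hji)
        exact hbT _ ((hTs _).2 ⟨hF (hp.trans (labelSupport_mono hbx)) hxF, by omega, by omega⟩) hp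
      rw [eq_single_of_labelSupport_subset hsub]
      simpa using hbd
    refine ⟨_, hrun, add_nonneg hN0 (vertexState_nonneg (realLabel_nonneg b)), ?_, ?_⟩
    · intro r
      obtain ⟨z, hz⟩ := hNz r
      have h2 : ∃ z : ℕ, vertexState d (realLabel b) r = z := by
        by_cases hr : ∃ i, r = Pi.single i d
        · obtain ⟨i, rfl⟩ := hr
          obtain ⟨e, he⟩ := hdvd i
          refine ⟨e, ?_⟩
          rw [vertexState_single hd, realLabel, he, Nat.cast_mul]
          exact mul_div_cancel_left₀ _ (Nat.cast_ne_zero.2 hd)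
        · push Not at hr
          exact ⟨0, by rw [vertexState_eq_zero fun i hi => absurd hi (hr i), Nat.cast_zero]⟩
      obtain ⟨z', hz'⟩ := h2
      exact ⟨z + z', by simp [hz, hz']⟩
    · intro r hr
      rcases Finset.mem_union.1 (Finsupp.support_add hr) with hr | hr
      · exact ((hTs _).1 (hNs r hr)).1
      · exact hF ((labelSupport_subset_of_mem_support hr).trans (labelSupport_mono hbx)) hxF

end Program

/-! ### Simplicial fans -/

section Fan

open Filter Topology

variable {Λ E : Type*} [AddCommGroup E] [Module ℝ E]

/-- `K` is the set of the generating sets of the cones of a complete simplicial fan with rays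
`vec v`, of pure dimension `n`, which has a strictly convex support function. -/
structure IsRegularFan (vec : Λ → E) (n : ℕ) (K : Set (Finset Λ)) : Prop where
  down : ∀ s ∈ K, ∀ t ⊆ s, t ∈ K
  finite : K.Finite
  exists_rep : ∀ x : E, ∃ a : Λ →₀ ℝ, 0 ≤ a ∧ a.support ∈ K ∧ Finsupp.linearCombination ℝ vec a = x
  unique : ∀ a b : Λ →₀ ℝ, 0 ≤ a → 0 ≤ b → a.support ∈ K → b.support ∈ K →
    Finsupp.linearCombination ℝ vec a = Finsupp.linearCombination ℝ vec b → a = b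
  pure : ∀ s ∈ K, ∃ t ∈ K, s ⊆ t ∧ t.card = n
  regular : ∃ ψ : Λ → ℝ, ∀ t ∈ K, t.card = n → ∃ g : E →ₗ[ℝ] ℝ,
    (∀ v ∈ t, g (vec v) = ψ v) ∧ ∀ v, {v} ∈ K → v ∉ t → g (vec v) < ψ v

theorem IsStep.linearCombination_eq {vec : Λ → E} {p : Λ × (Λ →₀ ℝ)} {a b : Λ →₀ ℝ}
    (h : IsStep p a b) (hp : Finsupp.linearCombination ℝ vec p.2 = vec p.1) :
    Finsupp.linearCombination ℝ vec b = Finsupp.linearCombination ℝ vec a := by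
  obtain ⟨c, -, -, -, rfl⟩ := h
  simp [hp]

theorem IsStep.unique {p : Λ × (Λ →₀ ℝ)} (hp : 0 ≤ p.2) {a b b' : Λ →₀ ℝ} (h : IsStep p a b)
    (h' : IsStep p a b') : b = b' := by
  obtain ⟨c, hc, hle, ⟨r, hr, hr'⟩, rfl⟩ := h
  obtain ⟨c', hc', hle', ⟨s, hs, hs'⟩, rfl⟩ := h'
  have hpos : ∀ t ∈ p.2.support, 0 < p.2 t := fun t ht =>
    lt_of_le_of_ne (hp t) (Finsupp.mem_support_iff.1 ht).symm
  have h1 : c' * p.2 r ≤ c * p.2 r := hr' ▸ hle' r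
  have h2 : c * p.2 s ≤ c' * p.2 s := hs' ▸ hle s
  have : c = c' := le_antisymm (le_of_mul_le_mul_right h2 (hpos s hs))
    (le_of_mul_le_mul_right h1 (hpos r hr))
  rw [this]

theorem exists_isStep {p : Λ × (Λ →₀ ℝ)} (hp : 0 ≤ p.2) (hp0 : p.2 ≠ 0) {a : Λ →₀ ℝ}
    (ha : 0 ≤ a) : ∃ b, IsStep p a b := by
  have hpos : ∀ t ∈ p.2.support, 0 < p.2 t := fun t ht =>
    lt_of_le_of_ne (hp t) (Finsupp.mem_support_iff.1 ht).symm
  obtain ⟨r, hr, hmin⟩ := Finset.exists_min_image p.2.support (fun r => a r / p.2 r)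
    (Finsupp.support_nonempty_iff.2 hp0)
  refine ⟨_, a r / p.2 r, div_nonneg (ha r) (hp r), ?_, ⟨r, hr, ?_⟩, rfl⟩
  · intro s
    by_cases hs : s ∈ p.2.support
    · exact (le_div_iff₀ (hpos s hs)).1 (hmin s hs)
    · simpa [Finsupp.notMem_support_iff.1 hs] using ha s
  · exact (div_mul_cancel₀ _ (hpos r hr).ne').symm

variable {vec : Λ → E} {n : ℕ} {K : Set (Finset Λ)}

/-- The positive and negative parts of a linear relation are two nonnegative representations of one
point, both supported in the same cone. -/
theorem IsRegularFan.linearIndepOn (hK : IsRegularFan vec n K) {s : Finset Λ} (hs : s ∈ K) :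
    LinearIndepOn ℝ vec (s : Set Λ) := by
  rw [linearIndepOn_iff]
  intro l hl h0
  rw [Finsupp.mem_supported, Finset.coe_subset] at hl
  set a : Λ →₀ ℝ := l.mapRange (fun x => max x 0) (by simp)
  set b : Λ →₀ ℝ := l.mapRange (fun x => max (-x) 0) (by simp)
  have hab : a - b = l := by
    ext v
    simp only [a, b, Finsupp.sub_apply, Finsupp.mapRange_apply]
    rcases le_total (l v) 0 with h | h <;> simp [h]
  have := hK.unique a b (fun v => by simp [a]) (fun v => by simp [b])
    (hK.down s hs _ (Finsupp.support_mapRange.trans hl))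
    (hK.down s hs _ (Finsupp.support_mapRange.trans hl)) (by
      rw [← sub_eq_zero, ← map_sub, hab, h0])
  rw [← hab, this, sub_self]

theorem IsRegularFan.exists_functional (hK : IsRegularFan vec n K) {s : Finset Λ} (hs : s ∈ K)
    (c : Λ → ℝ) : ∃ g : E →ₗ[ℝ] ℝ, ∀ v ∈ s, g (vec v) = c v := by
  have hli : LinearIndependent ℝ (fun v : (s : Set Λ) => vec v) := hK.linearIndepOn hs
  obtain ⟨g, hg⟩ := LinearMap.exists_extend
    ((Finsupp.linearCombination ℝ fun v : (s : Set Λ) => c v).comp hli.repr)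
  refine ⟨g, fun v hv => ?_⟩
  have h1 := LinearMap.congr_fun hg ⟨vec v, Submodule.subset_span ⟨⟨v, hv⟩, rfl⟩⟩
  simp only [LinearMap.comp_apply, Submodule.subtype_apply] at h1
  rw [h1]
  change Finsupp.linearCombination ℝ (fun v : (s : Set Λ) => c v) (hli.repr _) = c v
  rw [hli.repr_eq_single ⟨v, hv⟩ _ rfl]
  simp

variable [DecidableEq Λ]

/-- The combinatorial star subdivision at a new vertex `v` in the relative interior of `C`. -/
def starComplex (K : Set (Finset Λ)) (v : Λ) (C : Finset Λ) : Set (Finset Λ) :=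
  {s | s ∈ K ∧ ¬ C ⊆ s} ∪ {t | ∃ s ∈ K, ¬ C ⊆ s ∧ s ∪ C ∈ K ∧ t = insert v s}

theorem singleton_mem_starComplex {v w : Λ} {C : Finset Λ} (h : {w} ∈ starComplex K v C) :
    {w} ∈ K ∨ w = v := by
  rcases h with h | ⟨s, -, -, -, h⟩
  · exact Or.inl h.1
  · right
    have : v ∈ ({w} : Finset Λ) := h ▸ Finset.mem_insert_self v s
    exact (Finset.mem_singleton.1 this).symm

/-- A traded amount 0 leaves the point in an old cone not containing the new ray. A positive amount
empties some coordinate of `p.2.support` and puts the point in a new cone. -/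
theorem IsRegularFan.isRep_step (hK : IsRegularFan vec n K) {p : Λ × (Λ →₀ ℝ)} (hp : 0 ≤ p.2)
    {a b : Λ →₀ ℝ} (has : a.support ∈ K) (h : IsStep p a b) :
    0 ≤ b ∧ b.support ∈ starComplex K p.1 p.2.support := by
  refine ⟨h.nonneg, ?_⟩
  obtain ⟨c, hc, hle, ⟨r, hr, hr'⟩, rfl⟩ := h
  rcases hc.eq_or_lt with rfl | hc
  · simp only [zero_mul] at hr'
    simp only [zero_smul, sub_zero, Finsupp.single_zero, add_zero]
    exact Or.inl ⟨has, fun hsub => Finsupp.mem_support_iff.1 (hsub hr) hr'⟩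
  · right
    have hsub : (a - c • p.2).support ⊆ a.support := by
      intro t ht
      rw [Finsupp.mem_support_iff] at *
      intro h0
      have h1 := hle t
      have h2 : 0 ≤ c * p.2 t := mul_nonneg hc.le (hp t)
      have h3 : c * p.2 t = 0 := le_antisymm (by simpa [h0] using h1) h2
      simp [h0, h3] at ht
    have hsub' : p.2.support ⊆ a.support := by
      intro t ht
      rw [Finsupp.mem_support_iff] at *
      have h1 : c * p.2 t ≤ a t := hle t
      have h2 : 0 < p.2 t := lt_of_le_of_ne (hp t) (Ne.symm ht)
      exact ((mul_pos hc h2).trans_le h1).ne'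
    refine ⟨(a - c • p.2).support, hK.down _ has _ hsub, fun h => ?_,
      hK.down _ has _ (Finset.union_subset hsub hsub'), ?_⟩
    · have := h hr
      simp [hr'] at this
    · have hnn : ∀ t, 0 ≤ a t - c * p.2 t := fun t => sub_nonneg.2 (hle t)
      ext t
      simp only [Finsupp.mem_support_iff, Finset.mem_insert, Finsupp.add_apply, Finsupp.sub_apply,
        Finsupp.smul_apply, smul_eq_mul]
      by_cases ht : t = p.1
      · subst ht
        simp only [Finsupp.single_eq_same, true_or, iff_true]
        have := hnn p.1
        positivity
      · simp [Finsupp.single_eq_of_ne ht, ht]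

/-- Trading is reversed by replacing the new ray by its coefficients `p.2`. This is how uniqueness
of representations passes to the subdivided fan. -/
theorem IsRegularFan.exists_isStep_eq (hK : IsRegularFan vec n K) {p : Λ × (Λ →₀ ℝ)}
    (hp : 0 ≤ p.2) (hv : ∀ s ∈ K, p.1 ∉ s) {b : Λ →₀ ℝ} (hb : 0 ≤ b)
    (hbs : b.support ∈ starComplex K p.1 p.2.support) :
    ∃ a, 0 ≤ a ∧ a.support ∈ K ∧ IsStep p a b := by
  rcases hbs with ⟨h1, h2⟩ | ⟨s, hs, hCs, hsC, heq⟩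
  · obtain ⟨r, hr, hr'⟩ := Finset.not_subset.1 h2
    exact ⟨b, hb, h1, isStep_self hb ⟨r, hr, Finsupp.notMem_support_iff.1 hr'⟩⟩
  · obtain ⟨r, hr, hr'⟩ := Finset.not_subset.1 hCs
    have hrv : r ≠ p.1 := by
      rintro rfl
      exact hv _ hsC (Finset.mem_union_right _ hr)
    have he0 : 0 ≤ b.erase p.1 := by
      intro t
      by_cases ht : t = p.1
      · simp [ht]
      · simpa [Finsupp.erase_ne ht] using hb t
    have hes : (b.erase p.1).support ⊆ s := by
      rw [Finsupp.support_erase, heq]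
      exact Finset.erase_insert_subset _ _
    refine ⟨b.erase p.1 + b p.1 • p.2, add_nonneg he0 (smul_nonneg (hb _) hp), ?_, b p.1, hb _,
      le_add_of_nonneg_left he0, ⟨r, hr, ?_⟩, ?_⟩
    · refine hK.down _ hsC _ (Finsupp.support_add.trans ?_)
      exact Finset.union_subset_union hes Finsupp.support_smul
    · have : (b.erase p.1) r = 0 := Finsupp.notMem_support_iff.1 fun h => hr' (hes h)
      simp [this]
    · rw [add_sub_cancel_right, add_comm]
      exact (Finsupp.single_add_erase _ _).symm

/-- Covers rays already in the fan, such as the vertices of the polytope, which also occur in the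
final list. -/
theorem IsRegularFan.starComplex_singleton (hK : IsRegularFan vec n K) {v : Λ} :
    starComplex K v {v} = K := by
  ext s
  constructor
  · rintro (h | ⟨s, hs, hvs, h, rfl⟩)
    · exact h.1
    · rwa [Finset.union_comm, ← Finset.insert_eq] at h
  · intro hs
    by_cases h : v ∈ s
    · refine Or.inr ⟨s.erase v, hK.down _ hs _ (Finset.erase_subset _ _), by simp, ?_, ?_⟩
      · rw [Finset.union_comm, ← Finset.insert_eq, Finset.insert_erase h]
        exact hs
      · rw [Finset.insert_erase h]
    · exact Or.inl ⟨hs, by simpa using h⟩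

omit [DecidableEq Λ] in
theorem IsRegularFan.eq_single (hK : IsRegularFan vec n K) {v : Λ} (hv : {v} ∈ K) {a : Λ →₀ ℝ}
    (ha : 0 ≤ a) (has : a.support ∈ K) (h : Finsupp.linearCombination ℝ vec a = vec v) :
    a = Finsupp.single v 1 := by
  refine hK.unique _ _ ha (Finsupp.single_nonneg.2 zero_le_one) has ?_ (by simp [h])
  rwa [Finsupp.support_single _ one_ne_zero]

omit [DecidableEq Λ] in
theorem IsRegularFan.card_le (hK : IsRegularFan vec n K) {s : Finset Λ} (hs : s ∈ K) :
    s.card ≤ n := by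
  obtain ⟨t, -, h, rfl⟩ := hK.pure s hs
  exact Finset.card_le_card h

/-- Let `S` be the value at `v` interpolated from `ψ`. Giving the new ray the value `S - ε` bends
the support function strictly along the new walls, and a small `ε` does not spoil the old strict
inequalities. -/
theorem IsRegularFan.starComplex_regular (hK : IsRegularFan vec n K) {v : Λ} {κ : Λ →₀ ℝ}
    (hκ : 0 ≤ κ) (hκs : κ.support ∈ K) (hv : Finsupp.linearCombination ℝ vec κ = vec v)
    (hvK : ∀ s ∈ K, v ∉ s) (hfin : (starComplex K v κ.support).Finite) :
    ∃ ψ : Λ → ℝ, ∀ t ∈ starComplex K v κ.support, t.card = n → ∃ g : E →ₗ[ℝ] ℝ,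
      (∀ w ∈ t, g (vec w) = ψ w) ∧
        ∀ w, {w} ∈ starComplex K v κ.support → w ∉ t → g (vec w) < ψ w := by
  obtain ⟨ψ, hψ⟩ := hK.regular
  have hpos : ∀ t ∈ κ.support, 0 < κ t := fun t ht =>
    lt_of_le_of_ne (hκ t) (Finsupp.mem_support_iff.1 ht).symm
  have hgv : ∀ g : E →ₗ[ℝ] ℝ, g (vec v) = ∑ r ∈ κ.support, κ r * g (vec r) := by
    intro g
    rw [← hv, Finsupp.linearCombination_apply, Finsupp.sum, map_sum]
    simp
  set S : ℝ := ∑ r ∈ κ.support, κ r * ψ r with hS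
  have hvw : ∀ w, {w} ∈ K → w ≠ v := by
    rintro w hw rfl
    exact hvK _ hw (Finset.mem_singleton_self _)
  have hray : ∀ s ∈ K, ∀ w ∈ s, {w} ∈ K := fun s hs w hw =>
    hK.down s hs _ (Finset.singleton_subset_iff.2 hw)
  have hrays : {w : Λ | {w} ∈ K}.Finite :=
    hK.finite.preimage (Finset.singleton_injective.injOn)
  -- Each maximal cone only asks for `ε` to be small and positive; there are finitely many cones, so
  -- one `ε` serves all.
  have key : ∀ t ∈ starComplex K v κ.support, ∀ᶠ ε : ℝ in 𝓝[>] 0, t.card = n →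
      ∃ g : E →ₗ[ℝ] ℝ, (∀ w ∈ t, g (vec w) = Function.update ψ v (S - ε) w) ∧
        ∀ w, {w} ∈ starComplex K v κ.support → w ∉ t →
          g (vec w) < Function.update ψ v (S - ε) w := by
    rintro t (⟨htK, htC⟩ | ⟨s, hs, hCs, hsC, rfl⟩)
    · by_cases htn : t.card = n
      swap
      · exact Eventually.of_forall fun ε h => absurd h htn
      obtain ⟨g, hg, hg'⟩ := hψ t htK htn
      have hlt : g (vec v) < S := by
        rw [hgv, hS]
        obtain ⟨r, hr, hrt⟩ := Finset.not_subset.1 htC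
        refine Finset.sum_lt_sum (fun i hi => ?_) ⟨r, hr,
          mul_lt_mul_of_pos_left (hg' r (hray _ hκs r hr) hrt) (hpos r hr)⟩
        refine mul_le_mul_of_nonneg_left ?_ (hκ i)
        by_cases hit : i ∈ t
        · exact (hg i hit).le
        · exact (hg' i (hray _ hκs i hi) hit).le
      have hev : ∀ᶠ ε : ℝ in 𝓝[>] 0, g (vec v) < S - ε := by
        refine nhdsWithin_le_nhds (?_ : ∀ᶠ ε : ℝ in 𝓝 0, _)
        have : Tendsto (fun ε : ℝ => S - ε) (𝓝 0) (𝓝 (S - 0)) :=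
          tendsto_const_nhds.sub tendsto_id
        exact this.eventually_const_lt (by simpa using hlt)
      filter_upwards [hev] with ε hε _
      refine ⟨g, fun w hw => ?_, fun w hw hwt => ?_⟩
      · rw [Function.update_of_ne (hvw w (hray t htK w hw)), hg w hw]
      · by_cases hwv : w = v
        · subst hwv
          rwa [Function.update_self]
        · rw [Function.update_of_ne hwv]
          exact hg' w ((singleton_mem_starComplex hw).resolve_right hwv) hwt
    · by_cases htn : (insert v s).card = n
      swap
      · exact Eventually.of_forall fun ε h => absurd h htn
      have hvs : v ∉ s := hvK s hs
      obtain ⟨r, hr, hrs⟩ := Finset.not_subset.1 hCs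
      rw [Finset.card_insert_of_notMem hvs] at htn
      -- A dimension count: `s` has `n - 1` elements, so only one ray of `κ.support` is missing from
      -- it.
      have hT : insert r s = s ∪ κ.support := by
        refine Finset.eq_of_subset_of_card_le ?_ ?_
        · exact Finset.insert_subset (Finset.mem_union_right _ hr) Finset.subset_union_left
        · rw [Finset.card_insert_of_notMem hrs, htn]
          exact hK.card_le hsC
      have hTK : insert r s ∈ K := hT ▸ hsC
      obtain ⟨g, hg, hg'⟩ := hψ _ hTK (by rw [Finset.card_insert_of_notMem hrs, htn])
      obtain ⟨φ, hφ⟩ := hK.exists_functional hTK (Pi.single r 1)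
      have hκT : κ.support ⊆ insert r s := hT ▸ Finset.subset_union_right
      have hφr : φ (vec r) = 1 := by rw [hφ r (Finset.mem_insert_self _ _), Pi.single_eq_same]
      have hφs : ∀ w ∈ s, φ (vec w) = 0 := fun w hw => by
        rw [hφ w (Finset.mem_insert_of_mem hw),
          Pi.single_eq_of_ne (by rintro rfl; exact hrs hw)]
      have hφv : φ (vec v) = κ r := by
        rw [hgv, Finset.sum_eq_single r]
        · rw [hφr, mul_one]
        · intro w hw hwr
          rw [hφs w ((Finset.mem_insert.1 (hκT hw)).resolve_left hwr), mul_zero]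
        · exact fun h => absurd hr h
      have hgS : g (vec v) = S := by
        rw [hgv, hS]
        exact Finset.sum_congr rfl fun w hw => by rw [hg w (hκT hw)]
      have hev : ∀ w ∈ {w : Λ | {w} ∈ K}, ∀ᶠ ε : ℝ in 𝓝[>] 0, w ∉ insert r s →
          g (vec w) - ε / κ r * φ (vec w) < ψ w := by
        intro w hw
        by_cases hwT : w ∈ insert r s
        · exact Eventually.of_forall fun ε h => absurd hwT h
        · refine nhdsWithin_le_nhds (?_ : ∀ᶠ ε : ℝ in 𝓝 0, _)
          have : Tendsto (fun ε : ℝ => g (vec w) - ε / κ r * φ (vec w)) (𝓝 0)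
              (𝓝 (g (vec w) - 0 / κ r * φ (vec w))) :=
            tendsto_const_nhds.sub ((tendsto_id.div_const _).mul_const _)
          filter_upwards [this.eventually_lt_const (by simpa using hg' w hw hwT)] with ε hε _
          exact hε
      filter_upwards [(eventually_all_finite hrays).2 hev, self_mem_nhdsWithin] with ε hε hε0 _
      have hε0' : 0 < ε := hε0
      -- The functional of the old cone is tilted about the span of `s`. As `φ (vec v) = κ r`, it
      -- drops by exactly `ε` at `v`; at `r` it falls strictly below `ψ`.
      refine ⟨g - (ε / κ r) • φ, fun w hw => ?_, fun w hw hwt => ?_⟩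
      · simp only [LinearMap.sub_apply, LinearMap.smul_apply, smul_eq_mul]
        rcases Finset.mem_insert.1 hw with rfl | hw
        · rw [Function.update_self, hgS, hφv, div_mul_cancel₀ _ (hpos r hr).ne']
        · rw [Function.update_of_ne (hvw w (hray s hs w hw)), hφs w hw,
            hg w (Finset.mem_insert_of_mem hw), mul_zero, sub_zero]
      · have hwv : w ≠ v := by
          rintro rfl
          exact hwt (Finset.mem_insert_self _ _)
        have hwK := (singleton_mem_starComplex hw).resolve_right hwv
        rw [Function.update_of_ne hwv]
        simp only [LinearMap.sub_apply, LinearMap.smul_apply, smul_eq_mul]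
        by_cases hwr : w = r
        · subst hwr
          rw [hφr, hg w (Finset.mem_insert_self _ _), mul_one]
          exact sub_lt_self _ (div_pos hε0' (hpos w hr))
        · refine hε w hwK fun h => ?_
          rcases Finset.mem_insert.1 h with h | h
          · exact hwr h
          · exact hwt (Finset.mem_insert_of_mem h)
  obtain ⟨ε, hε⟩ := ((eventually_all_finite hfin).2 key).exists
  exact ⟨_, hε⟩

theorem IsRegularFan.star (hK : IsRegularFan vec n K) {p : Λ × (Λ →₀ ℝ)}
    (hp : 0 ≤ p.2) (hp0 : p.2 ≠ 0) (hps : p.2.support ∈ K)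
    (hv : Finsupp.linearCombination ℝ vec p.2 = vec p.1) :
    IsRegularFan vec n (starComplex K p.1 p.2.support) := by
  by_cases hvK : {p.1} ∈ K
  · rw [hK.eq_single hvK hp hps hv, Finsupp.support_single _ one_ne_zero,
      hK.starComplex_singleton]
    exact hK
  have hvK' : ∀ s ∈ K, p.1 ∉ s := fun s hs h =>
    hvK (hK.down s hs _ (Finset.singleton_subset_iff.2 h))
  have hfin : (starComplex K p.1 p.2.support).Finite := by
    refine (hK.finite.union (hK.finite.image (insert p.1))).subset ?_
    rintro s (h | ⟨s, hs, -, -, rfl⟩)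
    · exact Or.inl h.1
    · exact Or.inr ⟨s, hs, rfl⟩
  refine ⟨?_, hfin, ?_, ?_, ?_, hK.starComplex_regular hp hps hv hvK' hfin⟩
  · rintro s (⟨hs, hCs⟩ | ⟨s, hs, hCs, hsC, rfl⟩) t hts
    · exact Or.inl ⟨hK.down s hs t hts, fun h => hCs (h.trans hts)⟩
    · by_cases hvt : p.1 ∈ t
      · have hsub : t.erase p.1 ⊆ s := Finset.subset_insert_iff.1 hts
        exact Or.inr ⟨t.erase p.1, hK.down s hs _ hsub, fun h => hCs (h.trans hsub),
          hK.down _ hsC _ (Finset.union_subset_union hsub le_rfl), (Finset.insert_erase hvt).symm⟩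
      · have hsub : t ⊆ s := (Finset.subset_insert_iff_of_notMem hvt).1 hts
        exact Or.inl ⟨hK.down s hs _ hsub, fun h => hCs (h.trans hsub)⟩
  · intro x
    obtain ⟨a, ha, has, rfl⟩ := hK.exists_rep x
    obtain ⟨b, hb⟩ := exists_isStep hp hp0 ha
    obtain ⟨h1, h2⟩ := hK.isRep_step hp has hb
    exact ⟨b, h1, h2, hb.linearCombination_eq hv⟩
  · intro b b' hb hb' hbs hbs' heq
    obtain ⟨a, ha, has, h⟩ := hK.exists_isStep_eq hp hvK' hb hbs
    obtain ⟨a', ha', has', h'⟩ := hK.exists_isStep_eq hp hvK' hb' hbs'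
    rw [h.linearCombination_eq hv, h'.linearCombination_eq hv] at heq
    have := hK.unique a a' ha ha' has has' heq
    subst this
    exact h.unique hp h'
  -- Exchanging a ray `r` of the carrier missing from `s` for the new ray turns a maximal cone into
  -- a maximal cone of the subdivision.
  · have key : ∀ s ∈ K, ¬ p.2.support ⊆ s → ∀ t ∈ K, p.2.support ⊆ t → s ⊆ t → t.card = n →
        ∃ t' ∈ starComplex K p.1 p.2.support, insert p.1 s ⊆ t' ∧
          t'.card = n := by
      intro s hs hCs t ht hCt hst htn
      obtain ⟨r, hr, hrs⟩ := Finset.not_subset.1 hCs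
      refine ⟨insert p.1 (t.erase r), Or.inr ⟨t.erase r, hK.down t ht _ (Finset.erase_subset _ _),
        fun h => by simpa using h hr, hK.down t ht _ (Finset.union_subset (Finset.erase_subset _ _)
          hCt), rfl⟩, Finset.insert_subset_insert _ fun w hw => ?_, ?_⟩
      · exact Finset.mem_erase.2 ⟨fun h => hrs (h ▸ hw), hst hw⟩
      · rw [Finset.card_insert_of_notMem (fun h => hvK' t ht (Finset.mem_of_mem_erase h)),
          Finset.card_erase_add_one (hCt hr), htn]
    rintro s (⟨hs, hCs⟩ | ⟨s, hs, hCs, hsC, rfl⟩)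
    · obtain ⟨t, ht, hst, htn⟩ := hK.pure s hs
      by_cases hCt : p.2.support ⊆ t
      · obtain ⟨t', ht', hsub, hc⟩ := key s hs hCs t ht hCt hst htn
        exact ⟨t', ht', (Finset.subset_insert _ _).trans hsub, hc⟩
      · exact ⟨t, Or.inl ⟨ht, hCt⟩, hst, htn⟩
    · obtain ⟨t, ht, hst, htn⟩ := hK.pure _ hsC
      exact key s hs hCs t ht (Finset.subset_union_right.trans hst)
        (Finset.subset_union_left.trans hst) htn

end Fan

/-! ### From combinatorial cones to convex cones -/

section Cones

variable {Λ E : Type*} [AddCommGroup E] [Module ℝ E] {vec : Λ → E} {n : ℕ} {K : Set (Finset Λ)}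

/-- The cones of the fan described by `K`. -/
def fanCones (vec : Λ → E) (K : Set (Finset Λ)) : Set (PointedCone ℝ E) :=
  {σ | ∃ s ∈ K, σ = PointedCone.hull ℝ (vec '' s)}

theorem mem_hull_image {s : Finset Λ} {x : E} : x ∈ PointedCone.hull ℝ (vec '' s) ↔
    ∃ a : Λ →₀ ℝ, 0 ≤ a ∧ a.support ⊆ s ∧ Finsupp.linearCombination ℝ vec a = x := by
  classical
  constructor
  · intro h
    induction h using Submodule.span_induction with
    | mem x hx =>
      obtain ⟨v, hv, rfl⟩ := hx
      exact ⟨Finsupp.single v 1, Finsupp.single_nonneg.2 zero_le_one,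
        Finsupp.support_single_subset.trans (Finset.singleton_subset_iff.2 hv), by simp⟩
    | zero => exact ⟨0, le_rfl, by simp, by simp⟩
    | add x y _ _ hx hy =>
      obtain ⟨a, ha, has, rfl⟩ := hx
      obtain ⟨b, hb, hbs, rfl⟩ := hy
      exact ⟨a + b, add_nonneg ha hb, Finsupp.support_add.trans (Finset.union_subset has hbs),
        by simp⟩
    | smul c x _ hx =>
      obtain ⟨a, ha, has, rfl⟩ := hx
      exact ⟨(c : ℝ) • a, smul_nonneg c.2 ha, Finsupp.support_smul.trans has, by
        rw [map_smul]; rfl⟩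
  · rintro ⟨a, ha, has, rfl⟩
    rw [Finsupp.linearCombination_apply]
    refine Submodule.sum_mem _ fun v hv => ?_
    exact Submodule.smul_mem _ (⟨a v, ha v⟩ : {c : ℝ // 0 ≤ c})
      (Submodule.subset_span ⟨v, has hv, rfl⟩)

theorem IsRegularFan.mem_hull_iff (hK : IsRegularFan vec n K) {s : Finset Λ} (hs : s ∈ K)
    {a : Λ →₀ ℝ} (ha : 0 ≤ a) (has : a.support ∈ K) :
    Finsupp.linearCombination ℝ vec a ∈ PointedCone.hull ℝ (vec '' s) ↔ a.support ⊆ s := by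
  rw [mem_hull_image]
  constructor
  · rintro ⟨b, hb, hbs, heq⟩
    rwa [← hK.unique b a hb ha (hK.down s hs _ hbs) has heq]
  · exact fun h => ⟨a, ha, h, rfl⟩

theorem IsRegularFan.hull_le_iff (hK : IsRegularFan vec n K) {s t : Finset Λ} (hs : s ∈ K)
    (ht : t ∈ K) :
    PointedCone.hull ℝ (vec '' t) ≤ PointedCone.hull ℝ (vec '' s) ↔ t ⊆ s := by
  constructor
  · intro h v hv
    have h1 : vec v ∈ PointedCone.hull ℝ (vec '' s) := h (Submodule.subset_span ⟨v, hv, rfl⟩)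
    have h2 := hK.mem_hull_iff hs (a := Finsupp.single v 1) (Finsupp.single_nonneg.2 zero_le_one)
      (by
        rw [Finsupp.support_single _ one_ne_zero]
        exact hK.down t ht _ (Finset.singleton_subset_iff.2 hv))
    rw [Finsupp.support_single _ one_ne_zero, Finset.singleton_subset_iff] at h2
    exact h2.1 (by simpa using h1)
  · exact fun h => Submodule.span_mono (Set.image_mono (Finset.coe_subset.2 h))

end Cones

/-! ### Combinatorial and geometric star subdivisions agree -/

section StarSubdivision

variable {Λ : Type*} [DecidableEq Λ] {n : ℕ} {vec : Λ → Fin n → ℝ} {K : Set (Finset Λ)}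

/-- By uniqueness of coefficients, a cone contains the new vector exactly when its generators
contain `p.2.support`, and inclusion of cones is inclusion of generating sets. The geometric
conditions thus become the combinatorial ones. -/
theorem IsRegularFan.starSubdivision_fanCones (hK : IsRegularFan vec n K) {p : Λ × (Λ →₀ ℝ)}
    (hp : 0 ≤ p.2) (hps : p.2.support ∈ K)
    (hv : Finsupp.linearCombination ℝ vec p.2 = vec p.1) :
    starSubdivision (fanCones vec K) (vec p.1) =
      fanCones vec (starComplex K p.1 p.2.support) := by
  have hmem : ∀ s ∈ K, (vec p.1 ∈ PointedCone.hull ℝ (vec '' s) ↔ p.2.support ⊆ s) :=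
    fun s hs => by rw [← hv, hK.mem_hull_iff hs hp hps]
  have hins : ∀ s : Finset Λ, PointedCone.hull ℝ (vec '' (insert p.1 s : Finset Λ)) =
      PointedCone.hull ℝ (vec '' s) ⊔ PointedCone.hull ℝ {vec p.1} := by
    intro s
    rw [Finset.coe_insert, Set.image_insert_eq, sup_comm]
    exact Submodule.span_insert _ _
  ext σ
  constructor
  · rintro (⟨⟨s, hs, rfl⟩, h⟩ | ⟨τ, ⟨t, ht, rfl⟩, h1, ⟨_, ⟨s, hs, rfl⟩, h2, h3⟩, rfl⟩)
    · exact ⟨s, Or.inl ⟨hs, fun h' => h ((hmem s hs).2 h')⟩, rfl⟩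
    · refine ⟨insert p.1 t, Or.inr ⟨t, ht, fun h' => h1 ((hmem t ht).2 h'), ?_, rfl⟩, ?_⟩
      · exact hK.down s hs _ (Finset.union_subset ((hK.hull_le_iff hs ht).1 h3) ((hmem s hs).1 h2))
      · rw [hins]
  · rintro ⟨_, ⟨hs, hCs⟩ | ⟨s, hs, hCs, hsC, rfl⟩, rfl⟩
    · exact Or.inl ⟨⟨_, hs, rfl⟩, fun h => hCs ((hmem _ hs).1 h)⟩
    · refine Or.inr ⟨_, ⟨s, hs, rfl⟩, fun h => hCs ((hmem s hs).1 h),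
        ⟨_, ⟨_, hsC, rfl⟩, (hmem _ hsC).2 Finset.subset_union_right,
          (hK.hull_le_iff hsC hs).2 Finset.subset_union_left⟩, hins s⟩

end StarSubdivision

/-! ### Fans over the boundary of a polytope -/

section Boundary

variable {Λ E ι : Type*} [AddCommGroup E] [Module ℝ E] {vec : Λ → E} {n : ℕ} {K : Set (Finset Λ)}
  {ℓ : ι → E →ₗ[ℝ] ℝ}

/-- The rays of each cone lie on a common facet of the polytope `{x | ∀ i, ℓ i x ≤ 1}`. -/
structure IsBoundaryFan (ℓ : ι → E →ₗ[ℝ] ℝ) (vec : Λ → E) (n : ℕ) (K : Set (Finset Λ)) : Prop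
    extends IsRegularFan vec n K where
  facewise : ∀ s ∈ K, ∃ i, ∀ v ∈ s, ℓ i (vec v) = 1
  ray_le : ∀ v, {v} ∈ K → ∀ i, ℓ i (vec v) ≤ 1

theorem linearCombination_le {φ ψ : Λ → ℝ} {a : Λ →₀ ℝ} (ha : 0 ≤ a)
    (h : ∀ v ∈ a.support, φ v ≤ ψ v) :
    Finsupp.linearCombination ℝ φ a ≤ Finsupp.linearCombination ℝ ψ a := by
  rw [Finsupp.linearCombination_apply, Finsupp.linearCombination_apply]
  exact Finset.sum_le_sum fun v hv => mul_le_mul_of_nonneg_left (h v hv) (ha v)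

theorem linearCombination_lt {φ ψ : Λ → ℝ} {a : Λ →₀ ℝ} (ha : 0 ≤ a)
    (h : ∀ v ∈ a.support, φ v ≤ ψ v) (hlt : ∃ v ∈ a.support, φ v < ψ v) :
    Finsupp.linearCombination ℝ φ a < Finsupp.linearCombination ℝ ψ a := by
  rw [Finsupp.linearCombination_apply, Finsupp.linearCombination_apply]
  obtain ⟨v, hv, hlt⟩ := hlt
  refine Finset.sum_lt_sum (fun v hv => mul_le_mul_of_nonneg_left (h v hv) (ha v)) ⟨v, hv, ?_⟩
  exact mul_lt_mul_of_pos_left hlt (lt_of_le_of_ne (ha v) (Finsupp.mem_support_iff.1 hv).symm)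

theorem linearCombination_congr {φ ψ : Λ → ℝ} {a : Λ →₀ ℝ} (h : ∀ v ∈ a.support, φ v = ψ v) :
    Finsupp.linearCombination ℝ φ a = Finsupp.linearCombination ℝ ψ a := by
  rw [Finsupp.linearCombination_apply, Finsupp.linearCombination_apply]
  exact Finset.sum_congr rfl fun v hv => congrArg (a v * ·) (h v hv)

theorem map_linearCombination (g : E →ₗ[ℝ] ℝ) (a : Λ →₀ ℝ) :
    g (Finsupp.linearCombination ℝ vec a) =
      Finsupp.linearCombination ℝ (fun v => g (vec v)) a := by
  rw [Finsupp.apply_linearCombination]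
  rfl

/-- The sum of the coefficients. -/
noncomputable abbrev coeffSum (a : Λ →₀ ℝ) : ℝ := Finsupp.linearCombination ℝ (fun _ => (1 : ℝ)) a

theorem coeffSum_nonneg {a : Λ →₀ ℝ} (ha : 0 ≤ a) : 0 ≤ coeffSum a := by
  have := linearCombination_le (φ := fun _ => 0) (ψ := fun _ => 1) ha fun _ _ => zero_le_one
  refine le_trans (le_of_eq ?_) this
  rw [Finsupp.linearCombination_apply]
  simp

/-- The coefficient sum plays the role of the gauge of the polytope: it equals `ℓ i` for a facet
carrying the cone, and bounds every other `ℓ i`. -/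
theorem IsBoundaryFan.le_one_iff (hK : IsBoundaryFan ℓ vec n K) {a : Λ →₀ ℝ} (ha : 0 ≤ a)
    (has : a.support ∈ K) :
    (∀ i, ℓ i (Finsupp.linearCombination ℝ vec a) ≤ 1) ↔ coeffSum a ≤ 1 := by
  constructor
  · intro h
    obtain ⟨i, hi⟩ := hK.facewise _ has
    refine le_trans (le_of_eq ?_) (h i)
    rw [map_linearCombination]
    exact linearCombination_congr fun v hv => (hi v hv).symm
  · intro h i
    rw [map_linearCombination]
    exact (linearCombination_le ha fun v hv => hK.ray_le v
      (hK.down _ has _ (Finset.singleton_subset_iff.2 hv)) i).trans h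

theorem IsBoundaryFan.star [DecidableEq Λ] (hK : IsBoundaryFan ℓ vec n K)
    {p : Λ × (Λ →₀ ℝ)} (hp : 0 ≤ p.2) (hps : p.2.support ∈ K)
    (hv : Finsupp.linearCombination ℝ vec p.2 = vec p.1) (hle : ∀ i, ℓ i (vec p.1) ≤ 1)
    (heq : ∃ i, ℓ i (vec p.1) = 1) :
    IsBoundaryFan ℓ vec n (starComplex K p.1 p.2.support) where
  toIsRegularFan := by
    refine hK.toIsRegularFan.star hp ?_ hps hv
    intro h0
    obtain ⟨i, hi⟩ := heq
    rw [← hv, h0] at hi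
    simp at hi
  facewise := by
    rintro s (⟨hs, -⟩ | ⟨s, hs, hCs, hsC, rfl⟩)
    · exact hK.facewise s hs
    · obtain ⟨i, hi⟩ := hK.facewise _ hsC
      refine ⟨i, fun v hvs => ?_⟩
      rcases Finset.mem_insert.1 hvs with rfl | hvs
      · refine le_antisymm (hle i) ?_
        obtain ⟨j, hj⟩ := heq
        -- Since `ℓ i` is 1 on all rays of the carrier and `ℓ j` is at most 1 there, the value of `ℓ
        -- i` at the new ray is at least `ℓ j (vec p.1) = 1`.
        rw [← hj, ← hv, map_linearCombination, map_linearCombination]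
        refine linearCombination_le hp fun v hvp => ?_
        rw [hi v (Finset.mem_union_right _ hvp)]
        exact hK.ray_le v (hK.down _ hps _ (Finset.singleton_subset_iff.2 hvp)) j
      · exact hi v (Finset.mem_union_left _ hvs)
  ray_le v hvK := by
    rcases singleton_mem_starComplex hvK with h | rfl
    · exact hK.ray_le v h
    · exact hle

theorem IsBoundaryFan.vec_ne_zero (hK : IsBoundaryFan ℓ vec n K) {s : Finset Λ} (hs : s ∈ K)
    {v : Λ} (hv : v ∈ s) : vec v ≠ 0 := by
  obtain ⟨i, hi⟩ := hK.facewise s hs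
  intro h
  have := hi v hv
  simp [h] at this

/-- The vertices `vec v` for `v ∈ s`, together with the origin if `z` holds. -/
def simplexVertices (vec : Λ → E) (s : Finset Λ) (z : Prop) : Set E :=
  {y | z ∧ y = 0 ∨ y ∈ vec '' s}

/-- The origin absorbs the weight `1 - coeffSum a` missing from a convex combination; without it the
coefficients must have sum 1. -/
theorem mem_convexHull_simplexVertices {s : Finset Λ} {z : Prop} {x : E} :
    x ∈ convexHull ℝ (simplexVertices vec s z) ↔ ∃ a : Λ →₀ ℝ, 0 ≤ a ∧ a.support ⊆ s ∧
      Finsupp.linearCombination ℝ vec a = x ∧ coeffSum a ≤ 1 ∧ (z ∨ coeffSum a = 1) := by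
  classical
  constructor
  · intro h
    refine convexHull_min (t := {x | ∃ a : Λ →₀ ℝ, 0 ≤ a ∧ a.support ⊆ s ∧
      Finsupp.linearCombination ℝ vec a = x ∧ coeffSum a ≤ 1 ∧ (z ∨ coeffSum a = 1)}) ?_ ?_ h
    · rintro y (⟨hz, rfl⟩ | ⟨v, hv, rfl⟩)
      · exact ⟨0, le_rfl, by simp, by simp, by simp [coeffSum], Or.inl hz⟩
      · exact ⟨Finsupp.single v 1, Finsupp.single_nonneg.2 zero_le_one,
          Finsupp.support_single_subset.trans (Finset.singleton_subset_iff.2 hv), by simp,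
          by simp [coeffSum], Or.inr (by simp [coeffSum])⟩
    · rintro x ⟨a, ha, has, rfl, ha1, haz⟩ y ⟨b, hb, hbs, rfl, hb1, hbz⟩ α β hα hβ hαβ
      have hsum : coeffSum (α • a + β • b) = α * coeffSum a + β * coeffSum b := by
        simp [coeffSum]
      refine ⟨α • a + β • b, add_nonneg (smul_nonneg hα ha) (smul_nonneg hβ hb), ?_, by simp, ?_,
        ?_⟩
      · exact Finsupp.support_add.trans (Finset.union_subset (Finsupp.support_smul.trans has)
          (Finsupp.support_smul.trans hbs))
      · rw [hsum]
        nlinarith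
      · rcases haz with h | haz
        · exact Or.inl h
        rcases hbz with h | hbz
        · exact Or.inl h
        · right
          rw [hsum, haz, hbz, mul_one, mul_one, hαβ]
  · rintro ⟨a, ha, has, rfl, ha1, haz⟩
    have hone : ∀ b : Λ →₀ ℝ, 0 ≤ b → b.support ⊆ s → coeffSum b = 1 →
        Finsupp.linearCombination ℝ vec b ∈ convexHull ℝ (simplexVertices vec s z) := by
      intro b hb hbs hb1
      rw [Finsupp.linearCombination_apply]
      refine (convex_convexHull ℝ _).sum_mem (fun v _ => hb v) ?_ fun v hv =>
        subset_convexHull ℝ _ (Or.inr ⟨v, hbs hv, rfl⟩)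
      rw [← hb1, coeffSum, Finsupp.linearCombination_apply, Finsupp.sum]
      simp
    rcases haz with hz | h1
    · have h0 : (0 : E) ∈ convexHull ℝ (simplexVertices vec s z) :=
        subset_convexHull ℝ _ (Or.inl ⟨hz, rfl⟩)
      have hnn := coeffSum_nonneg ha
      rcases hnn.eq_or_lt with h | h
      · have : a = 0 := by
          by_contra hne
          have h2 := linearCombination_lt (φ := fun _ => 0) (ψ := fun _ => 1) ha
            (fun _ _ => zero_le_one) (by
              obtain ⟨v, hv⟩ := Finsupp.support_nonempty_iff.2 hne
              exact ⟨v, hv, zero_lt_one⟩)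
          rw [← coeffSum, ← h, Finsupp.linearCombination_apply] at h2
          simp at h2
        simpa [this] using h0
      · have h2 := hone ((coeffSum a)⁻¹ • a) (smul_nonneg (inv_nonneg.2 hnn) ha)
          (Finsupp.support_smul.trans has) (by simp [coeffSum] at h ⊢; exact inv_mul_cancel₀ h.ne')
        have h3 := (convex_convexHull ℝ _).smul_mem_of_zero_mem h0 h2 ⟨hnn, ha1⟩
        rwa [map_smul, smul_inv_smul₀ h.ne'] at h3
    · exact hone a ha has h1

end Boundary

/-! ### The induced triangulation: coherence and unimodularity -/

section Triangulation

variable {Λ ι : Type*} {n : ℕ} {vec : Λ → Fin n → ℝ} {K : Set (Finset Λ)}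
  {ℓ : ι → (Fin n → ℝ) →ₗ[ℝ] ℝ}

/-- The finite sets of vertices of the form `simplexVertices vec s z` for `s ∈ K`. -/
theorem exists_eq_simplexVertices {E : Type*} [AddCommGroup E] [Module ℝ E] {vec : Λ → E}
    (hdown : ∀ s ∈ K, ∀ t ⊆ s, t ∈ K) {σ : Finset E}
    (h : ∃ s ∈ K, (σ : Set E) ⊆ simplexVertices vec s True) :
    ∃ s ∈ K, (σ : Set E) = simplexVertices vec s ((0 : E) ∈ σ) := by
  classical
  obtain ⟨s, hs, hsub⟩ := h
  refine ⟨s.filter fun v => vec v ∈ σ, hdown s hs _ (Finset.filter_subset _ _), ?_⟩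
  ext y
  constructor
  · intro hy
    rcases hsub hy with ⟨-, rfl⟩ | ⟨v, hv, rfl⟩
    · exact Or.inl ⟨hy, rfl⟩
    · exact Or.inr ⟨v, by simpa using ⟨hv, hy⟩, rfl⟩
  · rintro (⟨h, rfl⟩ | ⟨v, hv, rfl⟩)
    · exact h
    · exact (by simpa using hv : v ∈ s ∧ vec v ∈ σ).2

/-- The triangulation induced by a fan over the boundary of a polytope. -/
def IsBoundaryFan.triangulation (hK : IsBoundaryFan ℓ vec n K) :
    Geometry.SimplicialComplex ℝ (Fin n → ℝ) where
  faces := {σ | σ.Nonempty ∧ ∃ s ∈ K, (σ : Set (Fin n → ℝ)) ⊆ simplexVertices vec s True}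
  isRelLowerSet_faces := by
    rintro σ ⟨hσ, s, hs, hsub⟩
    exact ⟨hσ, fun τ hτ hne => ⟨hne, s, hs, (Finset.coe_subset.2 hτ).trans hsub⟩⟩
  indep := by
    rintro σ ⟨-, s, hs, hsub⟩
    have h1 : LinearIndepOn ℝ id (vec '' (s : Set Λ)) := (hK.linearIndepOn hs).id_image
    have h2 : ∀ v ∈ vec '' (s : Set Λ), v ≠ 0 := by
      rintro _ ⟨v, hv, rfl⟩
      exact hK.vec_ne_zero hs hv
    have h3 := (linearIndependent_set_iff_affineIndependent_vadd_union_singleton ℝ h2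
      (0 : Fin n → ℝ)).1 h1
    refine h3.mono ?_
    intro y hy
    rcases hsub hy with ⟨-, rfl⟩ | h
    · simp
    · simpa using Or.inr h
  inter_subset_convexHull := by
    rintro σ τ ⟨-, hσ⟩ ⟨-, hτ⟩
    obtain ⟨s, hs, hσs⟩ := exists_eq_simplexVertices hK.down hσ
    obtain ⟨t, ht, hτt⟩ := exists_eq_simplexVertices hK.down hτ
    classical
    rintro x ⟨hx1, hx2⟩
    rw [hσs, mem_convexHull_simplexVertices] at hx1
    rw [hτt, mem_convexHull_simplexVertices] at hx2
    obtain ⟨a, ha, has, rfl, ha1, haz⟩ := hx1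
    obtain ⟨b, hb, hbt, heq, -, hbz⟩ := hx2
    -- A common point has the same coefficients in both simplices, so these are supported in `s ∩
    -- t`.
    have hab := hK.unique b a hb ha (hK.down t ht _ hbt) (hK.down s hs _ has) heq
    subst hab
    have hmem : Finsupp.linearCombination ℝ vec b ∈ convexHull ℝ
        (simplexVertices vec (s ∩ t) ((0 : Fin n → ℝ) ∈ σ ∧ (0 : Fin n → ℝ) ∈ τ)) :=
      mem_convexHull_simplexVertices.2
        ⟨b, hb, Finset.subset_inter has hbt, rfl, ha1, by tauto⟩
    refine convexHull_mono ?_ hmem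
    rintro y (⟨⟨h1, h2⟩, rfl⟩ | ⟨v, hv, rfl⟩)
    · exact ⟨h1, h2⟩
    · rw [Finset.coe_inter] at hv
      refine ⟨?_, ?_⟩
      · rw [hσs]; exact Or.inr ⟨v, hv.1, rfl⟩
      · rw [hτt]; exact Or.inr ⟨v, hv.2, rfl⟩

theorem finite_simplexVertices {s : Finset Λ} {z : Prop} : (simplexVertices vec s z).Finite := by
  refine ((Set.finite_singleton (0 : Fin n → ℝ)).union (s.finite_toSet.image vec)).subset ?_
  rintro y (⟨-, rfl⟩ | h)
  · exact Or.inl rfl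
  · exact Or.inr h

variable (hK : IsBoundaryFan ℓ vec n K)

theorem IsBoundaryFan.triangulation_finite : hK.triangulation.faces.Finite := by
  have hf : (⋃ s ∈ K, simplexVertices vec s True).Finite :=
    hK.finite.biUnion fun s _ => finite_simplexVertices
  refine (hf.finite_subsets.preimage (Finset.coe_injective.injOn)).subset ?_
  rintro σ ⟨-, s, hs, hsub⟩
  exact hsub.trans (Set.subset_biUnion_of_mem (u := fun s => simplexVertices vec s True) hs)

theorem IsBoundaryFan.exists_face {s : Finset Λ} (hs : s ∈ K) :
    ∃ σ ∈ hK.triangulation.faces, (σ : Set (Fin n → ℝ)) = simplexVertices vec s True := by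
  have hf : (simplexVertices vec s True).Finite := finite_simplexVertices
  exact ⟨hf.toFinset, ⟨⟨0, by simp [simplexVertices]⟩, s, hs, by simp⟩, by simp⟩

theorem IsBoundaryFan.triangulation_space : hK.triangulation.space = {x | ∀ i, ℓ i x ≤ 1} := by
  ext x
  rw [Geometry.SimplicialComplex.mem_space_iff, Set.mem_ofPred_eq]
  constructor
  · rintro ⟨σ, ⟨-, s, hs, hsub⟩, hx⟩
    obtain ⟨a, ha, has, rfl, ha1, -⟩ := mem_convexHull_simplexVertices.1 (convexHull_mono hsub hx)
    exact (hK.le_one_iff ha (hK.down s hs _ has)).2 ha1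
  · intro hx
    obtain ⟨a, ha, has, rfl⟩ := hK.exists_rep x
    obtain ⟨σ, hσ, hσs⟩ := hK.exists_face has
    refine ⟨σ, hσ, ?_⟩
    rw [hσs, mem_convexHull_simplexVertices]
    exact ⟨a, ha, le_rfl, rfl, (hK.le_one_iff ha has).1 hx, Or.inl trivial⟩

theorem IsBoundaryFan.isLatticeTriangulation (hlat : ∀ v, {v} ∈ K → IsLatticePoint (vec v)) :
    IsLatticeTriangulation hK.triangulation {x | ∀ i, ℓ i x ≤ 1} := by
  refine ⟨hK.triangulation_finite, hK.triangulation_space, ?_⟩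
  rintro y ⟨-, s, hs, hsub⟩
  rcases hsub (by simp : y ∈ ((({y} : Finset (Fin n → ℝ))) : Set (Fin n → ℝ))) with
    ⟨-, rfl⟩ | ⟨v, hv, rfl⟩
  · exact ⟨0, by simp⟩
  · exact hlat v (hK.down s hs _ (Finset.singleton_subset_iff.2 hv))

theorem IsBoundaryFan.exists_of_mem_facets {σ : Finset (Fin n → ℝ)}
    (hσ : σ ∈ hK.triangulation.facets) :
    ∃ s ∈ K, s.card = n ∧ (σ : Set (Fin n → ℝ)) = simplexVertices vec s True := by
  obtain ⟨⟨-, s, hs, hsub⟩, hmax⟩ := hσ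
  obtain ⟨t, ht, hst, htn⟩ := hK.pure s hs
  obtain ⟨τ, hτ, hτt⟩ := hK.exists_face ht
  refine ⟨t, ht, htn, ?_⟩
  rw [hmax hτ, hτt]
  rw [← Finset.coe_subset, hτt]
  refine hsub.trans ?_
  rintro y (h | ⟨v, hv, rfl⟩)
  · exact Or.inl h
  · exact Or.inr ⟨v, hst hv, rfl⟩

theorem IsBoundaryFan.zero_mem_facets {σ : Finset (Fin n → ℝ)}
    (hσ : σ ∈ hK.triangulation.facets) : (0 : Fin n → ℝ) ∈ σ := by
  obtain ⟨s, -, -, h⟩ := hK.exists_of_mem_facets hσ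
  rw [← Finset.mem_coe, h]
  exact Or.inl ⟨trivial, rfl⟩

theorem hull_simplexVertices {s : Finset Λ} {z : Prop} :
    PointedCone.hull ℝ (simplexVertices vec s z) = PointedCone.hull ℝ (vec '' s) := by
  refine le_antisymm (Submodule.span_le.2 ?_) (Submodule.span_mono fun y hy => Or.inr hy)
  rintro y (⟨-, rfl⟩ | hy)
  · exact Submodule.zero_mem _
  · exact Submodule.subset_span hy

theorem IsBoundaryFan.triangulationFan_eq :
    triangulationFan hK.triangulation = fanCones vec K := by
  ext C
  constructor
  · rintro ⟨σ, ⟨-, hσ⟩, rfl⟩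
    obtain ⟨s, hs, h⟩ := exists_eq_simplexVertices hK.down hσ
    exact ⟨s, hs, by rw [h, hull_simplexVertices]⟩
  · rintro ⟨s, hs, rfl⟩
    obtain ⟨σ, hσ, h⟩ := hK.exists_face hs
    exact ⟨σ, hσ, by rw [h, hull_simplexVertices]⟩

/-- Extend `ψ` linearly along each cone. The functional of a maximal cone lies below the resulting
`f` everywhere, with equality on that cone and strict inequality off it; so `f` is a maximum of
linear functionals, hence convex. -/
theorem IsBoundaryFan.isCoherent : IsCoherent hK.triangulation {x | ∀ i, ℓ i x ≤ 1} := by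
  obtain ⟨ψ, hψ⟩ := hK.regular
  choose rep hrep0 hrepK hrep using hK.exists_rep
  set f : (Fin n → ℝ) → ℝ := fun x => Finsupp.linearCombination ℝ ψ (rep x) with hf
  have hgf : ∀ t ∈ K, ∀ g : (Fin n → ℝ) →ₗ[ℝ] ℝ, (∀ v ∈ t, g (vec v) = ψ v) →
      ∀ x, (rep x).support ⊆ t → f x = g x := by
    intro t ht g hg x hx
    conv_rhs => rw [← hrep x, map_linearCombination]
    exact linearCombination_congr fun v hv => (hg v (hx hv)).symm
  have hray : ∀ x, ∀ v ∈ (rep x).support, {v} ∈ K := fun x v hv =>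
    hK.down _ (hrepK x) _ (Finset.singleton_subset_iff.2 hv)
  have hle : ∀ t ∈ K, ∀ g : (Fin n → ℝ) →ₗ[ℝ] ℝ, (∀ v ∈ t, g (vec v) = ψ v) →
      (∀ v, {v} ∈ K → v ∉ t → g (vec v) < ψ v) → ∀ x, g x ≤ f x := by
    intro t ht g hg hg' x
    conv_lhs => rw [← hrep x, map_linearCombination]
    refine linearCombination_le (hrep0 x) fun v hv => ?_
    by_cases h : v ∈ t
    · exact (hg v h).le
    · exact (hg' v (hray x v hv) h).le
  refine ⟨f, ⟨?_, ?_⟩, ?_⟩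
  · rw [Set.ofPred_forall]
    exact convex_iInter fun i => convex_halfSpace_le (ℓ i).isLinear 1
  · intro x _ y _ α β hα hβ hαβ
    obtain ⟨t, ht, hsub, htn⟩ := hK.pure _ (hrepK (α • x + β • y))
    obtain ⟨g, hg, hg'⟩ := hψ t ht htn
    rw [hgf t ht g hg _ hsub, map_add, map_smul, map_smul]
    exact add_le_add (smul_le_smul_of_nonneg_left (hle t ht g hg hg' x) hα)
      (smul_le_smul_of_nonneg_left (hle t ht g hg hg' y) hβ)
  · intro σ hσ
    obtain ⟨t, ht, htn, hσt⟩ := hK.exists_of_mem_facets hσ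
    obtain ⟨g, hg, hg'⟩ := hψ t ht htn
    refine ⟨g.toAffineMap, fun x hx => ?_, fun x hxP hx => ?_⟩
    · rw [hσt, mem_convexHull_simplexVertices] at hx
      obtain ⟨a, ha, hat, hax, -⟩ := hx
      have h1 : rep x = a := hK.unique _ _ (hrep0 x) ha (hrepK x) (hK.down t ht _ hat)
        ((hrep x).trans hax.symm)
      exact hgf t ht g hg x (h1 ▸ hat)
    -- A point of the polytope lying in the cone over `t` has coefficient sum at most 1, so it would
    -- lie in the simplex itself.
    · have hns : ¬ (rep x).support ⊆ t := by
        intro hsub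
        apply hx
        rw [hσt, mem_convexHull_simplexVertices]
        refine ⟨rep x, hrep0 x, hsub, hrep x, ?_, Or.inl trivial⟩
        rw [← hK.le_one_iff (hrep0 x) (hrepK x), hrep x]
        exact hxP
      obtain ⟨v, hv, hvt⟩ := Finset.not_subset.1 hns
      change g x < f x
      conv_lhs => rw [← hrep x, map_linearCombination]
      refine linearCombination_lt (hrep0 x) (fun w hw => ?_) ⟨v, hv, hg' v (hray x v hv) hvt⟩
      by_cases h : w ∈ t
      · exact (hg w h).le
      · exact (hg' w (hray x w hw) h).le

theorem abs_det_eq_one_of_mul_eq_one {m : ℕ} {A B : Matrix (Fin m) (Fin m) ℤ} (h : B * A = 1) :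
    |A.det| = 1 := by
  have : IsUnit A.det := by
    have h1 := congrArg Matrix.det h
    rw [Matrix.det_mul, Matrix.det_one, mul_comm] at h1
    exact IsUnit.of_mul_eq_one _ h1
  exact Int.isUnit_iff_abs_eq.1 this

/-- Every lattice point of a maximal cone is an integral combination of its generators. Translating
into the cone extends this to all unit vectors, so the integer matrix of generators has an integer
inverse. -/
theorem IsBoundaryFan.isUnimodular (hlat : ∀ v, {v} ∈ K → IsLatticePoint (vec v))
    (hint : ∀ y, IsLatticePoint y → ∃ a : Λ →₀ ℝ, 0 ≤ a ∧ a.support ∈ K ∧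
      Finsupp.linearCombination ℝ vec a = y ∧ ∀ v, ∃ z : ℕ, a v = z) :
    IsUnimodular hK.triangulation := by
  classical
  intro σ hσ
  obtain ⟨t, ht, htn, hσt⟩ := hK.exists_of_mem_facets hσ
  let e : Fin n ≃ t := (t.equivFinOfCardEq htn).symm
  have hray : ∀ i, {(e i : Λ)} ∈ K := fun i =>
    hK.down t ht _ (Finset.singleton_subset_iff.2 (e i).2)
  choose A hA using fun i => hlat (e i) (hray i)
  have hli : LinearIndependent ℝ fun i => vec (e i) := by
    have h1 : LinearIndependent ℝ fun v : (t : Set Λ) => vec v := hK.linearIndepOn ht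
    exact h1.comp e e.injective
  have hspan : Submodule.span ℝ (Set.range fun i => vec (e i)) = ⊤ :=
    hli.span_eq_top_of_card_eq_finrank' (by simp)
  have hZ : ∀ j : Fin n, ∃ B : Fin n → ℤ,
      ∑ i, (B i : ℝ) • vec (e i) = Pi.single j (1 : ℝ) := by
    intro j
    obtain ⟨c, hc⟩ := (Submodule.mem_span_range_iff_exists_fun ℝ).1
      (hspan ▸ Submodule.mem_top : (Pi.single j (1 : ℝ) : Fin n → ℝ) ∈
        Submodule.span ℝ (Set.range fun i => vec (e i)))
    -- Adding `N` times every generator moves the unit vector into the cone, where `hint` and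
    -- uniqueness of coefficients apply.
    obtain ⟨N, hN⟩ : ∃ N : ℕ, ∀ i, |c i| ≤ N := by
      obtain ⟨N, hN⟩ := exists_nat_ge (∑ i, |c i|)
      exact ⟨N, fun i => (Finset.single_le_sum (f := fun i => |c i|)
        (fun i _ => abs_nonneg _) (Finset.mem_univ i)).trans hN⟩
    set a : Λ →₀ ℝ := ∑ i, Finsupp.single (e i : Λ) (c i + N) with ha
    have ha0 : 0 ≤ a := Finset.sum_nonneg fun i _ => Finsupp.single_nonneg.2 (by
      have := (abs_le.1 (hN i)).1
      linarith)
    have hae : ∀ i, a (e i) = c i + N := by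
      intro i
      rw [ha, Finsupp.finsetSum_apply, Finset.sum_eq_single i]
      · simp
      · intro k _ hk
        exact Finsupp.single_eq_of_ne fun h => hk (e.injective (Subtype.ext h.symm))
      · simp
    have has : a.support ⊆ t := by
      refine Finsupp.support_finsetSum.trans (Finset.biUnion_subset.2 fun i _ => ?_)
      exact Finsupp.support_single_subset.trans (Finset.singleton_subset_iff.2 (e i).2)
    have hay : Finsupp.linearCombination ℝ vec a =
        Pi.single j (1 : ℝ) + ∑ i, (N : ℝ) • vec (e i) := by
      rw [ha, map_sum, ← hc, ← Finset.sum_add_distrib]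
      exact Finset.sum_congr rfl fun i _ => by simp
    have hy : IsLatticePoint (Finsupp.linearCombination ℝ vec a) := by
      refine ⟨Pi.single j 1 + ∑ i, (N : ℤ) • A i, fun k => ?_⟩
      rw [hay]
      simp only [Pi.add_apply, Finset.sum_apply, Pi.smul_apply, smul_eq_mul, hA]
      push_cast
      congr 1
      by_cases h : k = j
      · subst h; simp
      · simp [h]
    obtain ⟨b, hb0, hbK, hby, hbz⟩ := hint _ hy
    have hab := hK.unique b a hb0 ha0 hbK (hK.down t ht _ has) hby
    subst hab
    choose z hz using hbz
    refine ⟨fun i => z (e i) - N, ?_⟩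
    rw [← hc]
    refine Finset.sum_congr rfl fun i _ => ?_
    congr 1
    have h1 := hae i
    rw [hz] at h1
    push_cast
    linarith
  choose B hB using hZ
  have hBA : (Matrix.of B) * (Matrix.of A) = 1 := by
    ext j k
    have h1 := congrFun (hB j) k
    simp only [Finset.sum_apply, Pi.smul_apply, smul_eq_mul, hA] at h1
    rw [Matrix.mul_apply, Matrix.one_apply]
    have h2 : ((∑ i, B j i * A i k : ℤ) : ℝ) = ((if j = k then 1 else 0 : ℤ) : ℝ) := by
      push_cast
      rw [h1]
      by_cases h : j = k
      · subst h; simp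
      · simp [h, Ne.symm h]
    exact_mod_cast h2
  refine ⟨Fin.cons 0 fun i => vec (e i), ?_, ?_⟩
  · rw [hσt, Fin.range_cons]
    ext y
    constructor
    · rintro (rfl | ⟨i, rfl⟩)
      · exact Or.inl ⟨trivial, rfl⟩
      · exact Or.inr ⟨e i, (e i).2, rfl⟩
    · rintro (⟨-, rfl⟩ | ⟨v, hv, rfl⟩)
      · exact Or.inl rfl
      · exact Or.inr ⟨e.symm ⟨v, hv⟩, by simp⟩
  · have h1 : (Matrix.of fun i j : Fin n => (Fin.cons 0 fun i => vec (e i) :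
        Fin (n + 1) → Fin n → ℝ) i.succ j - (Fin.cons 0 fun i => vec (e i) :
        Fin (n + 1) → Fin n → ℝ) 0 j) = (Matrix.of A).map (Int.castRingHom ℝ) := by
      ext i j
      simp [hA]
    rw [normalizedVolume, h1, ← RingHom.mapMatrix_apply, ← RingHom.map_det]
    have h2 := abs_det_eq_one_of_mul_eq_one hBA
    rw [Int.coe_castRingHom, ← Int.cast_abs, h2, Int.cast_one]

end Triangulation

/-! ### Iterating the star subdivisions -/

section Fold

variable {Λ ι : Type*} [DecidableEq Λ] {n : ℕ} {vec : Λ → Fin n → ℝ}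
  {ℓ : ι → (Fin n → ℝ) →ₗ[ℝ] ℝ}

/-- Successive star subdivisions of a fan over the boundary of a polytope. -/
theorem IsBoundaryFan.exists_foldl {K₀ : Set (Finset Λ)} {init : Λ → Λ →₀ ℝ}
    (P : List (Λ × (Λ →₀ ℝ)))
    (hinit : ∀ p ∈ P, 0 ≤ init p.1 ∧ (init p.1).support ∈ K₀ ∧
      Finsupp.linearCombination ℝ vec (init p.1) = vec p.1)
    (hle : ∀ p ∈ P, ∀ i, ℓ i (vec p.1) ≤ 1) (heq : ∀ p ∈ P, ∃ i, ℓ i (vec p.1) = 1)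
    (hlat : ∀ p ∈ P, IsLatticePoint (vec p.1)) :
    ∀ (A : List (Λ × (Λ →₀ ℝ))) (K : Set (Finset Λ)), IsBoundaryFan ℓ vec n K →
      (∀ v, {v} ∈ K → IsLatticePoint (vec v)) →
      (∀ a b, 0 ≤ a → a.support ∈ K₀ → IsRun A a b → 0 ≤ b ∧ b.support ∈ K ∧
        Finsupp.linearCombination ℝ vec b = Finsupp.linearCombination ℝ vec a) →
      IsAdapted init A P →
      ∃ K', IsBoundaryFan ℓ vec n K' ∧ (∀ v, {v} ∈ K' → IsLatticePoint (vec v)) ∧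
        (∀ a b, 0 ≤ a → a.support ∈ K₀ → IsRun (A ++ P) a b → 0 ≤ b ∧ b.support ∈ K' ∧
          Finsupp.linearCombination ℝ vec b = Finsupp.linearCombination ℝ vec a) ∧
        fanCones vec K' = (P.map fun p => vec p.1).foldl starSubdivision (fanCones vec K) := by
  induction P with
  | nil =>
    intro A K hK hKlat hrun _
    exact ⟨K, hK, hKlat, by simpa using hrun, rfl⟩
  | cons p P ih =>
    intro A K hK hKlat hrun had
    obtain ⟨h1, h2, h3⟩ := hinit p (by simp)
    -- Adaptedness makes `p.2` the coefficients of the new ray in the current fan, as the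
    -- subdivision requires.
    obtain ⟨hp, hps, hpv⟩ := hrun _ _ h1 h2 had.1
    rw [h3] at hpv
    have hK' := hK.star hp hps hpv (hle p (by simp)) (heq p (by simp))
    have hlat' : ∀ v, {v} ∈ starComplex K p.1 p.2.support → IsLatticePoint (vec v) := by
      intro v hv
      rcases singleton_mem_starComplex hv with h | rfl
      · exact hKlat v h
      · exact hlat p (by simp)
    obtain ⟨K'', r1, r2, r3, r4⟩ := ih (fun q hq => hinit q (by simp [hq]))
      (fun q hq => hle q (by simp [hq])) (fun q hq => heq q (by simp [hq]))
      (fun q hq => hlat q (by simp [hq])) (A ++ [p]) _ hK' hlat' (by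
        intro a b ha has hab
        obtain ⟨c, hac, hcb⟩ := isRun_append.1 hab
        obtain ⟨b', hcb, rfl⟩ := hcb
        obtain ⟨hc0, hcK, hcv⟩ := hrun a c ha has hac
        obtain ⟨q1, q2⟩ := hK.isRep_step hp hcK hcb
        exact ⟨q1, q2, (hcb.linearCombination_eq hpv).trans hcv⟩) had.2
    refine ⟨K'', r1, r2, by simpa using r3, ?_⟩
    rw [r4, List.map_cons, List.foldl_cons, hK.starSubdivision_fanCones hp hps hpv]

end Fold

/-! ### The polytope of projective space -/

section Polytope

variable {n : ℕ}

/-- The linear functionals which are at most `1` on the polytope. -/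
noncomputable def facetFunctional (n : ℕ) (i : Fin (n + 1)) : (Fin n → ℝ) →ₗ[ℝ] ℝ :=
  Fin.lastCases (motive := fun _ => (Fin n → ℝ) →ₗ[ℝ] ℝ) (∑ j, LinearMap.proj j)
    (fun j => -LinearMap.proj j) i

@[simp] theorem facetFunctional_castSucc (j : Fin n) (y : Fin n → ℝ) :
    facetFunctional n j.castSucc y = -y j := by
  simp [facetFunctional]

@[simp] theorem facetFunctional_last (y : Fin n → ℝ) :
    facetFunctional n (Fin.last n) y = ∑ j, y j := by
  simp [facetFunctional]

theorem sum_facetFunctional (y : Fin n → ℝ) : ∑ i, facetFunctional n i y = 0 := by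
  rw [Fin.sum_univ_castSucc]
  simp

theorem ext_facetFunctional {y z : Fin n → ℝ}
    (h : ∀ i, facetFunctional n i y = facetFunctional n i z) : y = z := by
  ext j
  simpa using h j.castSucc

/-- The lattice point with homogeneous coordinates `u`. -/
def labelVec (n : ℕ) (u : Fin (n + 1) → ℕ) : Fin n → ℝ := fun j => (u j.castSucc : ℝ) - 1

theorem isLatticePoint_labelVec (u : Fin (n + 1) → ℕ) : IsLatticePoint (labelVec n u) :=
  ⟨fun j => u j.castSucc - 1, fun j => by simp [labelVec]⟩

theorem facetFunctional_labelVec {u : Fin (n + 1) → ℕ} (hu : ∑ i, u i = n + 1)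
    (i : Fin (n + 1)) : facetFunctional n i (labelVec n u) = 1 - u i := by
  induction i using Fin.lastCases with
  | last =>
    rw [facetFunctional_last]
    rw [Fin.sum_univ_castSucc] at hu
    have hu' : (∑ j : Fin n, (u j.castSucc : ℝ)) + u (Fin.last n) = n + 1 := by exact_mod_cast hu
    simp [labelVec, Finset.sum_sub_distrib]
    linarith
  | cast j => simp [labelVec]

theorem labelVec_injOn {u v : Fin (n + 1) → ℕ} (hu : ∑ i, u i = n + 1) (hv : ∑ i, v i = n + 1)
    (h : labelVec n u = labelVec n v) : u = v := by
  ext i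
  have h1 := facetFunctional_labelVec hu i
  rw [h, facetFunctional_labelVec hv i] at h1
  have : (u i : ℝ) = v i := by linarith
  exact_mod_cast this

/-- The vertices of the polytope. -/
def polytopeVertex (n : ℕ) (i : Fin (n + 1)) : Fin n → ℝ := labelVec n (Pi.single i (n + 1))

theorem facetFunctional_polytopeVertex (i k : Fin (n + 1)) :
    facetFunctional n k (polytopeVertex n i) = 1 - if k = i then (n + 1 : ℝ) else 0 := by
  rw [polytopeVertex, facetFunctional_labelVec (by simp)]
  by_cases h : k = i
  · subst h; simp
  · simp [h]

theorem facetFunctional_combination (x : Fin (n + 1) → ℝ) (k : Fin (n + 1)) :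
    facetFunctional n k (∑ i, x i • polytopeVertex n i) = ∑ i, x i - (n + 1) * x k := by
  rw [map_sum]
  simp only [map_smul, smul_eq_mul, facetFunctional_polytopeVertex, mul_sub, mul_one,
    Finset.sum_sub_distrib, mul_ite, mul_zero, Finset.sum_ite_eq, Finset.mem_univ, if_true]
  ring

/-- The barycentric coordinates with respect to the vertices of the polytope. -/
noncomputable def baryCoord (y : Fin n → ℝ) (i : Fin (n + 1)) : ℝ :=
  (1 - facetFunctional n i y) / (n + 1)

theorem sum_baryCoord (y : Fin n → ℝ) : ∑ i, baryCoord y i = 1 := by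
  simp only [baryCoord]
  rw [← Finset.sum_div, Finset.sum_sub_distrib, sum_facetFunctional]
  have : (n + 1 : ℝ) ≠ 0 := by positivity
  simpa using div_self this

theorem combination_baryCoord (y : Fin n → ℝ) :
    ∑ i, baryCoord y i • polytopeVertex n i = y := by
  refine ext_facetFunctional fun k => ?_
  rw [facetFunctional_combination, sum_baryCoord, baryCoord]
  have : (n + 1 : ℝ) ≠ 0 := by positivity
  field_simp
  ring

theorem projectiveSpacePolytope_eq_convexHull :
    projectiveSpacePolytope n = convexHull ℝ (Set.range (polytopeVertex n)) := by
  rw [projectiveSpacePolytope]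
  congr 1
  ext y
  constructor
  · rintro (rfl | ⟨i, rfl⟩)
    · refine ⟨Fin.last n, ?_⟩
      ext j
      simp [polytopeVertex, labelVec, (Fin.castSucc_lt_last j).ne]
    · refine ⟨i.castSucc, ?_⟩
      ext j
      by_cases h : j = i
      · subst h; simp [polytopeVertex, labelVec]
      · simp [polytopeVertex, labelVec, h]
  · rintro ⟨i, rfl⟩
    induction i using Fin.lastCases with
    | last =>
      left
      ext j
      simp [polytopeVertex, labelVec, (Fin.castSucc_lt_last j).ne]
    | cast i =>
      right
      refine ⟨i, ?_⟩
      ext j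
      by_cases h : j = i
      · subst h; simp [polytopeVertex, labelVec]
      · simp [polytopeVertex, labelVec, h]

theorem projectiveSpacePolytope_eq :
    projectiveSpacePolytope n = {y | ∀ i, facetFunctional n i y ≤ 1} := by
  rw [projectiveSpacePolytope_eq_convexHull]
  refine Set.Subset.antisymm (convexHull_min ?_ ?_) fun y hy => ?_
  · rintro _ ⟨i, rfl⟩ k
    rw [facetFunctional_polytopeVertex]
    split_ifs
    · have : (0 : ℝ) ≤ n := Nat.cast_nonneg n
      linarith
    · linarith
  · rw [Set.ofPred_forall]
    exact convex_iInter fun i => convex_halfSpace_le (facetFunctional n i).isLinear 1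
  · rw [← combination_baryCoord y]
    refine (convex_convexHull ℝ _).sum_mem (fun i _ => ?_) (sum_baryCoord y) fun i _ =>
      subset_convexHull ℝ _ ⟨i, rfl⟩
    exact div_nonneg (sub_nonneg.2 (hy i)) (by positivity)

theorem mem_projectiveSpacePolytope {y : Fin n → ℝ} :
    y ∈ projectiveSpacePolytope n ↔ ∀ i, facetFunctional n i y ≤ 1 := by
  rw [projectiveSpacePolytope_eq]
  rfl

theorem continuous_facetFunctional (i : Fin (n + 1)) : Continuous (facetFunctional n i) :=
  (facetFunctional n i).continuous_of_finiteDimensional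

theorem interior_projectiveSpacePolytope :
    interior (projectiveSpacePolytope n) = {y | ∀ i, facetFunctional n i y < 1} := by
  refine Set.Subset.antisymm (fun y hy i => ?_) (interior_maximal ?_ ?_)
  · by_contra h
    have h1 : facetFunctional n i y = 1 :=
      le_antisymm (mem_projectiveSpacePolytope.1 (interior_subset hy) i) (not_lt.1 h)
    -- Scaling an interior point by slightly more than 1 stays in the polytope, which is impossible
    -- where a functional equals 1.
    have h2 : Filter.Tendsto (fun t : ℝ => (1 + t) • y) (nhds 0) (nhds ((1 + 0 : ℝ) • y)) :=
      ((tendsto_const_nhds.add Filter.tendsto_id)).smul tendsto_const_nhds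
    rw [add_zero, one_smul] at h2
    have h3 : ∀ᶠ t : ℝ in nhdsWithin 0 (Set.Ioi 0), (1 + t) • y ∈ projectiveSpacePolytope n :=
      nhdsWithin_le_nhds (h2 (mem_interior_iff_mem_nhds.1 hy))
    obtain ⟨t, ht, ht0⟩ := (h3.and self_mem_nhdsWithin).exists
    have h4 := mem_projectiveSpacePolytope.1 ht i
    rw [map_smul, h1, smul_eq_mul, mul_one] at h4
    have : 0 < t := ht0
    linarith
  · exact fun y hy => mem_projectiveSpacePolytope.2 fun i => (hy i).le
  · rw [Set.ofPred_forall]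
    exact isOpen_iInter_of_finite fun i => isOpen_lt (continuous_facetFunctional i) continuous_const

theorem mem_frontier_projectiveSpacePolytope {y : Fin n → ℝ} :
    y ∈ frontier (projectiveSpacePolytope n) ↔
      (∀ i, facetFunctional n i y ≤ 1) ∧ ∃ i, facetFunctional n i y = 1 := by
  have hc : IsClosed (projectiveSpacePolytope n) := by
    rw [projectiveSpacePolytope_eq, Set.ofPred_forall]
    exact isClosed_iInter fun i => isClosed_le (continuous_facetFunctional i) continuous_const
  rw [hc.frontier_eq, interior_projectiveSpacePolytope, Set.mem_sdiff, mem_projectiveSpacePolytope]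
  refine and_congr_right fun h => ?_
  change ¬ (∀ i, facetFunctional n i y < 1) ↔ _
  push Not
  exact exists_congr fun i => ⟨fun h' => le_antisymm (h i) h', fun h' => h'.ge⟩

theorem isReflexive_projectiveSpacePolytope : IsReflexive (projectiveSpacePolytope n) := by
  refine ⟨⟨Set.range (polytopeVertex n), Set.finite_range _, ?_,
    projectiveSpacePolytope_eq_convexHull⟩, ?_, ?_⟩
  · rintro _ ⟨i, rfl⟩
    exact isLatticePoint_labelVec _
  · rw [interior_projectiveSpacePolytope]
    intro i
    simp
  -- The vertices of the dual represent the negatives of the facet functionals.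
  · let q : Fin (n + 1) → Fin n → ℝ :=
      Fin.lastCases (motive := fun _ => Fin n → ℝ) (fun _ => -1) fun j => Pi.single j 1
    have hq : ∀ x (i : Fin (n + 1)), ∑ j, x j * q i j = -facetFunctional n i x := by
      intro x i
      induction i using Fin.lastCases with
      | last => simp [q]
      | cast i => simp [q, Pi.single_apply]
    refine ⟨Set.range q, Set.finite_range _, ?_, ?_⟩
    · rintro _ ⟨i, rfl⟩
      induction i using Fin.lastCases with
      | last => exact ⟨fun _ => -1, fun j => by simp [q]⟩
      | cast i =>
        refine ⟨Pi.single i 1, fun j => ?_⟩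
        by_cases h : j = i
        · subst h; simp [q]
        · simp [q, h]
    · refine Set.Subset.antisymm (fun y hy => ?_) (convexHull_min ?_ ?_)
      · have hn : (0 : ℝ) < n + 1 := by positivity
        have hv : ∀ i, -1 ≤ ∑ j, polytopeVertex n i j * y j := fun i => hy _ (by
          rw [projectiveSpacePolytope_eq_convexHull]
          exact subset_convexHull ℝ _ ⟨i, rfl⟩)
        set s : ℝ := ∑ j, y j with hs
        have h0 : 0 ≤ (1 - s) / (n + 1) := by
          refine div_nonneg ?_ hn.le
          have := hv (Fin.last n)
          simp only [polytopeVertex, labelVec] at this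
          simp [(Fin.castSucc_lt_last _).ne] at this
          linarith
        have hj : ∀ j, 0 ≤ y j + (1 - s) / (n + 1) := by
          intro j
          have := hv j.castSucc
          have h1 : ∑ k, polytopeVertex n j.castSucc k * y k = (n + 1) * y j - s := by
            have : ∀ k, polytopeVertex n j.castSucc k * y k =
                (if k = j then (n + 1) * y k else 0) - y k := by
              intro k
              by_cases h : k = j
              · subst h; simp [polytopeVertex, labelVec]; ring
              · simp [polytopeVertex, labelVec, h]
            simp_rw [this]
            rw [Finset.sum_sub_distrib, ← hs]
            simp
          rw [h1] at this
          rw [← sub_nonneg] at *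
          have h2 : y j + (1 - s) / (n + 1) - 0 = ((n + 1) * y j - s - -1) / (n + 1) := by
            field_simp
            ring
          rw [h2]
          exact div_nonneg this hn.le
        -- Barycentric coordinates of `y` in the dual simplex; each is nonnegative by the dual
        -- inequality at one vertex of the polytope.
        set w : Fin (n + 1) → ℝ := Fin.lastCases (motive := fun _ => ℝ) ((1 - s) / (n + 1))
          fun j => y j + (1 - s) / (n + 1) with hw
        have hy' : ∑ i, w i • q i = y := by
          rw [Fin.sum_univ_castSucc]
          ext k
          simp [w, q, Finset.sum_apply, Pi.single_apply]
        rw [← hy']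
        refine (convex_convexHull ℝ _).sum_mem (fun i _ => ?_) ?_ fun i _ =>
          subset_convexHull ℝ _ ⟨i, rfl⟩
        · induction i using Fin.lastCases with
          | last => simpa [w] using h0
          | cast i => simpa [w] using hj i
        · rw [Fin.sum_univ_castSucc]
          simp only [w, Fin.lastCases_castSucc, Fin.lastCases_last, Finset.sum_add_distrib, ← hs,
            Finset.sum_const, Finset.card_univ, Fintype.card_fin, nsmul_eq_mul]
          field_simp
          ring
      · rintro _ ⟨i, rfl⟩ x hx
        rw [hq]
        have := mem_projectiveSpacePolytope.1 hx i
        linarith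
      · have : polarDual (projectiveSpacePolytope n) =
            ⋂ x ∈ projectiveSpacePolytope n, {y | -1 ≤ ∑ i, x i * y i} := by
          ext y
          simp [polarDual]
        rw [this]
        refine convex_iInter₂ fun x _ => convex_halfSpace_ge ?_ (-1)
        exact ⟨fun a b => by simp [mul_add, Finset.sum_add_distrib],
          fun c a => by simp [Finset.mul_sum, mul_left_comm]⟩

end Polytope

/-! ### Faces of the polytope as subsets of its vertices -/

section Faces

variable {n : ℕ}

/-- The face of the polytope with vertices `polytopeVertex n i` for `i ∈ S`. -/
def polytopeFace (S : Finset (Fin (n + 1))) : Set (Fin n → ℝ) :=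
  {y | (∀ i, facetFunctional n i y ≤ 1) ∧ ∀ i, i ∉ S → facetFunctional n i y = 1}

theorem polytopeVertex_mem_polytopeFace {S : Finset (Fin (n + 1))} {i : Fin (n + 1)}
    (hi : i ∈ S) : polytopeVertex n i ∈ polytopeFace S := by
  refine ⟨fun k => ?_, fun k hk => ?_⟩
  · rw [facetFunctional_polytopeVertex]
    split_ifs
    · have : (0 : ℝ) ≤ n := Nat.cast_nonneg n
      linarith
    · linarith
  · rw [facetFunctional_polytopeVertex, if_neg (by rintro rfl; exact hk hi), sub_zero]

theorem baryCoord_nonneg {y : Fin n → ℝ} (hy : ∀ i, facetFunctional n i y ≤ 1)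
    (i : Fin (n + 1)) : 0 ≤ baryCoord y i :=
  div_nonneg (sub_nonneg.2 (hy i)) (by positivity)

theorem baryCoord_eq_zero_iff {y : Fin n → ℝ} {i : Fin (n + 1)} :
    baryCoord y i = 0 ↔ facetFunctional n i y = 1 := by
  have : (n + 1 : ℝ) ≠ 0 := by positivity
  rw [baryCoord, div_eq_zero_iff, or_iff_left this, sub_eq_zero, eq_comm]

theorem combination_of_mem_polytopeFace {S : Finset (Fin (n + 1))} {y : Fin n → ℝ}
    (hy : y ∈ polytopeFace S) :
    ∑ i ∈ S, baryCoord y i = 1 ∧ ∑ i ∈ S, baryCoord y i • polytopeVertex n i = y := by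
  have h0 : ∀ i, i ∉ S → baryCoord y i = 0 := fun i hi => baryCoord_eq_zero_iff.2 (hy.2 i hi)
  constructor
  · rw [← sum_baryCoord y]
    exact Finset.sum_subset (Finset.subset_univ S) fun i _ hi => h0 i hi
  · conv_rhs => rw [← combination_baryCoord y]
    exact Finset.sum_subset (Finset.subset_univ S) fun i _ hi => by rw [h0 i hi, zero_smul]

theorem polytopeFace_empty : polytopeFace (∅ : Finset (Fin (n + 1))) = ∅ := by
  ext y
  simp only [Set.mem_empty_iff_false, iff_false]
  intro hy
  have := (combination_of_mem_polytopeFace hy).1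
  simp at this

/-- The sum of the facet functionals with index outside `S` is maximal exactly where all of them
equal 1. -/
theorem isExposed_polytopeFace (S : Finset (Fin (n + 1))) :
    IsExposed ℝ (projectiveSpacePolytope n) (polytopeFace S) := by
  intro hne
  obtain ⟨j, hj⟩ : S.Nonempty := by
    rw [Finset.nonempty_iff_ne_empty]
    rintro rfl
    rw [polytopeFace_empty] at hne
    simp at hne
  let l : (Fin n → ℝ) →ₗ[ℝ] ℝ := ∑ i ∈ Sᶜ, facetFunctional n i
  have hl : ∀ y, l y = ∑ i ∈ Sᶜ, facetFunctional n i y := fun y => by simp [l]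
  refine ⟨LinearMap.toContinuousLinearMap l, ?_⟩
  ext y
  simp only [Set.mem_ofPred_eq, LinearMap.coe_toContinuousLinearMap', mem_projectiveSpacePolytope]
  constructor
  · rintro ⟨h1, h2⟩
    refine ⟨h1, fun z hz => ?_⟩
    rw [hl, hl]
    exact Finset.sum_le_sum fun i hi => (hz i).trans (h2 i (Finset.mem_compl.1 hi)).ge
  · rintro ⟨h1, h2⟩
    refine ⟨h1, fun i hi => ?_⟩
    have hv := polytopeVertex_mem_polytopeFace hj
    have h3 := h2 _ hv.1
    rw [hl, hl, Finset.sum_congr rfl fun i hi => hv.2 i (Finset.mem_compl.1 hi)] at h3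
    have h4 := (Finset.sum_eq_sum_iff_of_le fun i (_ : i ∈ Sᶜ) => h1 i).1
      (le_antisymm (Finset.sum_le_sum fun i _ => h1 i) h3)
    exact h4 i (Finset.mem_compl.2 hi)

/-- In barycentric coordinates a linear functional is a weighted mean of its vertex values, so it is
maximal precisely where only maximizing vertices carry weight. -/
theorem exists_eq_polytopeFace {F : Set (Fin n → ℝ)}
    (hF : IsExposed ℝ (projectiveSpacePolytope n) F) : ∃ S, F = polytopeFace S := by
  rcases F.eq_empty_or_nonempty with rfl | hne
  · exact ⟨∅, polytopeFace_empty.symm⟩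
  obtain ⟨l, rfl⟩ := hF hne
  obtain ⟨j, -, hj⟩ := Finset.exists_max_image Finset.univ (fun i => l (polytopeVertex n i))
    Finset.univ_nonempty
  set M := l (polytopeVertex n j) with hM
  have hl : ∀ y, l y = ∑ i, baryCoord y i * l (polytopeVertex n i) := by
    intro y
    conv_lhs => rw [← combination_baryCoord y]
    simp
  have hle : ∀ y, (∀ i, facetFunctional n i y ≤ 1) → l y ≤ M := by
    intro y hy
    rw [hl, ← one_mul M, ← sum_baryCoord y, Finset.sum_mul]
    exact Finset.sum_le_sum fun i hi =>
      mul_le_mul_of_nonneg_left (hj i hi) (baryCoord_nonneg hy i)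
  have hjP : ∀ i, facetFunctional n i (polytopeVertex n j) ≤ 1 :=
    (polytopeVertex_mem_polytopeFace (Finset.mem_univ j)).1
  refine ⟨Finset.univ.filter fun i => l (polytopeVertex n i) = M, ?_⟩
  ext y
  simp only [polytopeFace, Set.mem_ofPred_eq, mem_projectiveSpacePolytope, Finset.mem_filter,
    Finset.mem_univ, true_and]
  refine and_congr_right fun hy => ?_
  have hlM : (∀ z, (∀ i, facetFunctional n i z ≤ 1) → l z ≤ l y) ↔ l y = M :=
    ⟨fun h => le_antisymm (hle y hy) (h _ hjP), fun h z hz => h ▸ hle z hz⟩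
  have hsum : ∑ i, baryCoord y i * M = M := by
    rw [← Finset.sum_mul, sum_baryCoord, one_mul]
  have hiff := Finset.sum_eq_sum_iff_of_le fun i hi =>
    mul_le_mul_of_nonneg_left (hj i hi) (baryCoord_nonneg hy i)
  rw [hsum, ← hl] at hiff
  rw [hlM, hiff]
  refine forall_congr' fun i => ?_
  rw [← baryCoord_eq_zero_iff, mul_eq_mul_left_iff]
  simp only [Finset.mem_univ, true_implies]
  tauto

theorem polytopeFace_eq_iff {S : Finset (Fin (n + 1))} :
    polytopeFace S = projectiveSpacePolytope n ↔ S = Finset.univ := by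
  constructor
  · intro h
    rw [Finset.eq_univ_iff_forall]
    intro i
    by_contra hi
    have h1 : polytopeVertex n i ∈ polytopeFace S := by
      rw [h, mem_projectiveSpacePolytope]
      exact (polytopeVertex_mem_polytopeFace (Finset.mem_univ i)).1
    have h2 := h1.2 i hi
    rw [facetFunctional_polytopeVertex, if_pos rfl] at h2
    have : (0 : ℝ) < n + 1 := by positivity
    linarith
  · rintro rfl
    ext y
    simp [polytopeFace, mem_projectiveSpacePolytope]

/-- The generating sets of the cones over the proper faces of the polytope. -/
def boundaryComplex (n : ℕ) : Set (Finset (Fin (n + 1) → ℕ)) :=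
  {s | ∃ S : Finset (Fin (n + 1)), S ≠ Finset.univ ∧ s = S.image fun i => Pi.single i (n + 1)}

theorem hull_polytopeFace (S : Finset (Fin (n + 1))) :
    PointedCone.hull ℝ (polytopeFace S) = PointedCone.hull ℝ
      (labelVec n '' (S.image fun i => (Pi.single i (n + 1) : Fin (n + 1) → ℕ) : Finset _)) := by
  refine le_antisymm (Submodule.span_le.2 fun y hy => ?_) (Submodule.span_mono ?_)
  · rw [← (combination_of_mem_polytopeFace hy).2]
    refine Submodule.sum_mem _ fun i hi => ?_
    refine Submodule.smul_mem _ (⟨baryCoord y i, baryCoord_nonneg hy.1 i⟩ : {c : ℝ // 0 ≤ c})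
      (Submodule.subset_span ⟨Pi.single i (n + 1), ?_, rfl⟩)
    exact Finset.mem_coe.2 (Finset.mem_image_of_mem _ hi)
  · rintro _ ⟨u, hu, rfl⟩
    obtain ⟨i, hi, rfl⟩ := Finset.mem_image.1 (Finset.mem_coe.1 hu)
    exact polytopeVertex_mem_polytopeFace hi

theorem faceFan_eq_fanCones :
    faceFan (projectiveSpacePolytope n) = fanCones (labelVec n) (boundaryComplex n) := by
  ext σ
  constructor
  · rintro ⟨F, hF, hne, rfl⟩
    obtain ⟨S, rfl⟩ := exists_eq_polytopeFace hF
    exact ⟨_, ⟨S, fun h => hne (polytopeFace_eq_iff.2 h), rfl⟩, hull_polytopeFace S⟩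
  · rintro ⟨_, ⟨S, hS, rfl⟩, rfl⟩
    exact ⟨polytopeFace S, isExposed_polytopeFace S, fun h => hS (polytopeFace_eq_iff.1 h),
      (hull_polytopeFace S).symm⟩

theorem affineIndependent_polytopeVertex : AffineIndependent ℝ (polytopeVertex n) := by
  rw [affineIndependent_iff]
  intro s w hw h k hk
  have h1 := congrArg (facetFunctional n k) h
  rw [map_sum, map_zero] at h1
  simp only [map_smul, smul_eq_mul, facetFunctional_polytopeVertex, mul_sub, mul_one,
    Finset.sum_sub_distrib, mul_ite, mul_zero, Finset.sum_ite_eq, hk, if_true, hw] at h1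
  have : (n + 1 : ℝ) ≠ 0 := by positivity
  have h2 : w k * (n + 1) = 0 := by linarith
  exact (mul_eq_zero.1 h2).resolve_right this

theorem polytopeFace_eq_convexHull (S : Finset (Fin (n + 1))) :
    polytopeFace S = convexHull ℝ (polytopeVertex n '' S) := by
  refine Set.Subset.antisymm (fun y hy => ?_) (convexHull_min ?_ ?_)
  · obtain ⟨h1, h2⟩ := combination_of_mem_polytopeFace hy
    rw [← h2]
    exact (convex_convexHull ℝ _).sum_mem (fun i _ => baryCoord_nonneg hy.1 i) h1 fun i hi =>
      subset_convexHull ℝ _ ⟨i, hi, rfl⟩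
  · rintro _ ⟨i, hi, rfl⟩
    exact polytopeVertex_mem_polytopeFace hi
  · intro y hy z hz a b ha hb hab
    refine ⟨fun i => ?_, fun i hi => ?_⟩
    · have h1 := hy.1 i
      have h2 := hz.1 i
      simp only [map_add, map_smul, smul_eq_mul]
      nlinarith
    · simp only [map_add, map_smul, smul_eq_mul, hy.2 i hi, hz.2 i hi]
      linarith

/-- The vertices with index in `labelSupport u` span the smallest face, and they are affinely
independent. -/
theorem faceDim_labelVec {u : Fin (n + 1) → ℕ} (hu : ∑ i, u i = n + 1) :
    faceDim (projectiveSpacePolytope n) (labelVec n u) = (labelSupport u).card - 1 := by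
  classical
  have hmem : ∀ S, labelVec n u ∈ polytopeFace S ↔ labelSupport u ⊆ S := by
    intro S
    simp only [polytopeFace, Set.mem_ofPred_eq, facetFunctional_labelVec hu]
    constructor
    · rintro ⟨-, h⟩ i hi
      by_contra hiS
      have h1 := h i hiS
      have h2 : (u i : ℝ) = 0 := by linarith
      exact mem_labelSupport.1 hi (by exact_mod_cast h2)
    · intro h
      refine ⟨fun i => by have : (0 : ℝ) ≤ u i := Nat.cast_nonneg _; linarith, fun i hi => ?_⟩
      have : u i = 0 := by
        by_contra h0
        exact hi (h (mem_labelSupport.2 h0))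
      simp [this]
  have hInter : ⋂₀ {F : Set (Fin n → ℝ) | IsExposed ℝ (projectiveSpacePolytope n) F ∧
      labelVec n u ∈ F} = polytopeFace (labelSupport u) := by
    refine Set.Subset.antisymm (Set.sInter_subset_of_mem
      ⟨isExposed_polytopeFace _, (hmem _).2 le_rfl⟩) (Set.subset_sInter ?_)
    rintro F ⟨hF, hx⟩
    obtain ⟨S, rfl⟩ := exists_eq_polytopeFace hF
    have hS := (hmem S).1 hx
    exact fun y hy => ⟨hy.1, fun i hi => hy.2 i fun h => hi (hS h)⟩
  have hne : (labelSupport u).card ≠ 0 := by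
    intro h0
    rw [Finset.card_eq_zero] at h0
    have : ∑ i, u i = 0 := Finset.sum_eq_zero fun i _ => by
      by_contra hi
      have := mem_labelSupport.2 hi
      rw [h0] at this
      simp at this
    omega
  rw [faceDim, hInter, polytopeFace_eq_convexHull, ← direction_affineSpan, affineSpan_convexHull,
    direction_affineSpan, ← Finset.coe_image]
  exact affineIndependent_polytopeVertex.finrank_vectorSpan_image_finset
    (Nat.succ_pred_eq_of_ne_zero hne).symm

end Faces

/-! ### The initial fan and homogeneous coordinates -/

section BoundaryComplex

variable {n : ℕ}

theorem facetFunctional_vertexState (x : Fin (n + 1) → ℝ) (k : Fin (n + 1)) :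
    facetFunctional n k (Finsupp.linearCombination ℝ (labelVec n) (vertexState (n + 1) x)) =
      (∑ i, x i) / (n + 1) - x k := by
  have h : Finsupp.linearCombination ℝ (labelVec n) (vertexState (n + 1) x) =
      ∑ i, (x i / (n + 1)) • polytopeVertex n i := by
    simp [vertexState, polytopeVertex]
  have hn : (n + 1 : ℝ) ≠ 0 := by positivity
  rw [h, facetFunctional_combination, ← Finset.sum_div]
  field_simp

theorem support_vertexState {d : ℕ} (hd : d ≠ 0) (x : Fin (n + 1) → ℝ) :
    (vertexState d x).support = (Finset.univ.filter fun i => x i ≠ 0).image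
      fun i => Pi.single i d := by
  ext r
  rw [Finset.mem_image]
  constructor
  · intro hr
    obtain ⟨i, rfl, hi⟩ := exists_of_mem_support_vertexState hr
    exact ⟨i, by simpa using hi, rfl⟩
  · rintro ⟨i, hi, rfl⟩
    exact mem_support_vertexState hd (by simpa using hi)

theorem support_vertexState_mem {x : Fin (n + 1) → ℝ} (h : ∃ i, x i = 0) :
    (vertexState (n + 1) x).support ∈ boundaryComplex n := by
  obtain ⟨i, hi⟩ := h
  refine ⟨_, fun h => ?_, support_vertexState n.succ_ne_zero x⟩
  have := h ▸ Finset.mem_univ i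
  simp [hi] at this

theorem exists_eq_vertexState {a : (Fin (n + 1) → ℕ) →₀ ℝ} (ha : 0 ≤ a)
    (has : a.support ∈ boundaryComplex n) :
    ∃ x : Fin (n + 1) → ℝ, (∀ i, 0 ≤ x i) ∧ (∃ i, x i = 0) ∧ a = vertexState (n + 1) x := by
  obtain ⟨S, hS, h⟩ := has
  obtain ⟨j, hj⟩ : ∃ j, j ∉ S := by
    by_contra hc
    push Not at hc
    exact hS (Finset.eq_univ_iff_forall.2 hc)
  have hinj := single_injective (I := Fin (n + 1)) n.succ_ne_zero
  have hn : ((n + 1 : ℕ) : ℝ) ≠ 0 := Nat.cast_ne_zero.2 n.succ_ne_zero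
  refine ⟨fun i => (n + 1 : ℕ) * a (Pi.single i (n + 1)),
    fun i => mul_nonneg (Nat.cast_nonneg _) (ha _), ⟨j, ?_⟩, ?_⟩
  · have : (Pi.single j (n + 1) : Fin (n + 1) → ℕ) ∉ a.support := by
      rw [h, Finset.mem_image]
      rintro ⟨i, hi, hij⟩
      exact hj (hinj hij ▸ hi)
    change ((n + 1 : ℕ) : ℝ) * a (Pi.single j (n + 1)) = 0
    rw [Finsupp.notMem_support_iff.1 this, mul_zero]
  · ext r
    by_cases hr : ∃ i, r = Pi.single i (n + 1)
    · obtain ⟨i, rfl⟩ := hr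
      rw [vertexState_single n.succ_ne_zero, mul_div_cancel_left₀ _ hn]
    · push Not at hr
      rw [vertexState_eq_zero fun i hi => absurd hi (hr i), ← Finsupp.notMem_support_iff, h,
        Finset.mem_image]
      rintro ⟨i, -, hi⟩
      exact hr i hi.symm

/-- Homogeneous coordinates with minimum `0`. -/
theorem exists_homogeneous (y : Fin n → ℝ) : ∃ k, (∀ i, facetFunctional n i y ≤
    facetFunctional n k y) ∧ Finsupp.linearCombination ℝ (labelVec n) (vertexState (n + 1)
      fun i => facetFunctional n k y - facetFunctional n i y) = y := by
  obtain ⟨k, -, hk⟩ := Finset.exists_max_image Finset.univ (fun i => facetFunctional n i y)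
    Finset.univ_nonempty
  refine ⟨k, fun i => hk i (Finset.mem_univ i), ext_facetFunctional fun i => ?_⟩
  have hn : (n + 1 : ℝ) ≠ 0 := by positivity
  rw [facetFunctional_vertexState, Finset.sum_sub_distrib, sum_facetFunctional]
  simp only [Finset.sum_const, Finset.card_univ, Fintype.card_fin, nsmul_eq_mul]
  push_cast
  field_simp
  ring

theorem isBoundaryFan_boundaryComplex :
    IsBoundaryFan (facetFunctional n) (labelVec n) n (boundaryComplex n) where
  down := by
    rintro _ ⟨S, hS, rfl⟩ t ht
    obtain ⟨R, hR, rfl⟩ := Finset.subset_image_iff.1 ht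
    exact ⟨R, fun h => hS (Finset.univ_subset_iff.1 (h ▸ Finset.coe_subset.1 hR)), rfl⟩
  finite := by
    refine (Set.finite_range fun S : Finset (Fin (n + 1)) =>
      S.image fun i => (Pi.single i (n + 1) : Fin (n + 1) → ℕ)).subset ?_
    rintro _ ⟨S, -, rfl⟩
    exact ⟨S, rfl⟩
  exists_rep y := by
    obtain ⟨k, hk, hy⟩ := exists_homogeneous y
    exact ⟨_, vertexState_nonneg fun i => sub_nonneg.2 (hk i),
      support_vertexState_mem ⟨k, sub_self _⟩, hy⟩
  unique a b ha hb has hbs heq := by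
    obtain ⟨x, hx, ⟨i, hi⟩, rfl⟩ := exists_eq_vertexState ha has
    obtain ⟨z, hz, ⟨j, hj⟩, rfl⟩ := exists_eq_vertexState hb hbs
    -- Homogeneous coordinates are determined up to a constant; here both are nonnegative with a
    -- zero, so the constant is 0.
    have h : ∀ k, (∑ i, x i) / (n + 1) - x k = (∑ i, z i) / (n + 1) - z k := fun k => by
      rw [← facetFunctional_vertexState, heq, facetFunctional_vertexState]
    congr 1
    ext k
    have h1 := h i
    have h2 := h j
    have h3 := h k
    have h4 := hz i
    have h5 := hx j
    rw [hi] at h1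
    rw [hj] at h2
    linarith
  pure := by
    rintro _ ⟨S, hS, rfl⟩
    obtain ⟨j, hj⟩ : ∃ j, j ∉ S := by
      by_contra hc
      push Not at hc
      exact hS (Finset.eq_univ_iff_forall.2 hc)
    refine ⟨_, ⟨Finset.univ.erase j, fun h => ?_, rfl⟩, Finset.image_subset_image fun i hi =>
      Finset.mem_erase.2 ⟨fun h => hj (h ▸ hi), Finset.mem_univ i⟩, ?_⟩
    · have := h ▸ Finset.mem_univ j
      simp at this
    · rw [Finset.card_image_of_injective _ (single_injective n.succ_ne_zero),
        Finset.card_erase_of_mem (Finset.mem_univ j)]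
      simp
  regular := by
    -- The support function is 1 on all vertices; the functional of the facet opposite `j` takes the
    -- value `-n` at the vertex `j`.
    refine ⟨fun _ => 1, ?_⟩
    rintro _ ⟨S, hS, rfl⟩ hcard
    rw [Finset.card_image_of_injective _ (single_injective n.succ_ne_zero)] at hcard
    obtain ⟨j, hj⟩ : ∃ j, j ∉ S := by
      by_contra hc
      push Not at hc
      exact hS (Finset.eq_univ_iff_forall.2 hc)
    have hSj : insert j S = Finset.univ := by
      rw [← Finset.card_eq_iff_eq_univ, Finset.card_insert_of_notMem hj, hcard, Fintype.card_fin]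
    refine ⟨facetFunctional n j, fun v hv => ?_, fun v hv hvS => ?_⟩
    · obtain ⟨i, hi, rfl⟩ := Finset.mem_image.1 hv
      have := facetFunctional_polytopeVertex i j
      rw [if_neg (by rintro rfl; exact hj hi), sub_zero] at this
      exact this
    · obtain ⟨R, -, hR⟩ := hv
      obtain ⟨i, hi, rfl⟩ := Finset.mem_image.1 (hR ▸ Finset.mem_singleton_self v)
      have hij : i = j := by
        have h1 : i ∈ insert j S := hSj ▸ Finset.mem_univ i
        rcases Finset.mem_insert.1 h1 with h | h
        · exact h
        · exact absurd (Finset.mem_image_of_mem _ h) hvS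
      subst hij
      have h1 := facetFunctional_polytopeVertex i i
      rw [if_pos rfl] at h1
      have h2 : (0 : ℝ) < n + 1 := by positivity
      change facetFunctional n i (polytopeVertex n i) < 1
      linarith
  facewise := by
    rintro _ ⟨S, hS, rfl⟩
    obtain ⟨j, hj⟩ : ∃ j, j ∉ S := by
      by_contra hc
      push Not at hc
      exact hS (Finset.eq_univ_iff_forall.2 hc)
    refine ⟨j, fun v hv => ?_⟩
    obtain ⟨i, hi, rfl⟩ := Finset.mem_image.1 hv
    have := facetFunctional_polytopeVertex i j
    rw [if_neg (by rintro rfl; exact hj hi), sub_zero] at this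
    exact this
  ray_le v hv i := by
    obtain ⟨R, -, hR⟩ := hv
    obtain ⟨j, -, rfl⟩ := Finset.mem_image.1 (hR ▸ Finset.mem_singleton_self v)
    exact (polytopeVertex_mem_polytopeFace (Finset.mem_univ j)).1 i

theorem vertexState_realLabel {u : Fin (n + 1) → ℕ} (hu : ∑ i, u i = n + 1)
    (hs : labelSupport u ≠ Finset.univ) :
    0 ≤ vertexState (n + 1) (realLabel u) ∧
      (vertexState (n + 1) (realLabel u)).support ∈ boundaryComplex n ∧
      Finsupp.linearCombination ℝ (labelVec n) (vertexState (n + 1) (realLabel u)) =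
        labelVec n u := by
  have hn : (n + 1 : ℝ) ≠ 0 := by positivity
  refine ⟨vertexState_nonneg (realLabel_nonneg u), support_vertexState_mem ?_,
    ext_facetFunctional fun k => ?_⟩
  · by_contra h
    push Not at h
    refine hs (Finset.eq_univ_iff_forall.2 fun i => mem_labelSupport.2 fun h0 => h i ?_)
    simp [h0]
  · rw [facetFunctional_vertexState, facetFunctional_labelVec hu, ← Nat.cast_sum, hu]
    push_cast
    rw [div_self hn]

theorem exists_facetFunctional_labelVec_eq_one {u : Fin (n + 1) → ℕ} (hu : ∑ i, u i = n + 1)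
    (hs : labelSupport u ≠ Finset.univ) : ∃ i, facetFunctional n i (labelVec n u) = 1 := by
  by_contra h
  push Not at h
  refine hs (Finset.eq_univ_iff_forall.2 fun i => mem_labelSupport.2 fun h0 => h i ?_)
  simp [facetFunctional_labelVec hu, h0]

theorem facetFunctional_labelVec_le {u : Fin (n + 1) → ℕ} (hu : ∑ i, u i = n + 1)
    (i : Fin (n + 1)) : facetFunctional n i (labelVec n u) ≤ 1 := by
  rw [facetFunctional_labelVec hu]
  have : (0 : ℝ) ≤ u i := Nat.cast_nonneg _
  linarith

theorem exists_int_facetFunctional {y : Fin n → ℝ} (hy : IsLatticePoint y) (i : Fin (n + 1)) :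
    ∃ z : ℤ, facetFunctional n i y = z := by
  obtain ⟨m, hm⟩ := hy
  induction i using Fin.lastCases with
  | last => exact ⟨∑ j, m j, by simp [hm]⟩
  | cast j => exact ⟨-m j, by simp [hm]⟩

/-- A lattice point on the boundary has homogeneous coordinates. -/
theorem exists_labelVec_eq {y : Fin n → ℝ} (hy : IsLatticePoint y)
    (hy' : y ∈ frontier (projectiveSpacePolytope n)) :
    ∃ u : Fin (n + 1) → ℕ, ∑ i, u i = n + 1 ∧ labelSupport u ≠ Finset.univ ∧
      labelVec n u = y := by
  rw [mem_frontier_projectiveSpacePolytope] at hy'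
  choose z hz using exists_int_facetFunctional hy
  have hz1 : ∀ i, z i ≤ 1 := fun i => by
    have := hy'.1 i
    rw [hz] at this
    exact_mod_cast this
  have hcast : ∀ i, (((1 - z i).toNat : ℕ) : ℝ) = 1 - facetFunctional n i y := by
    intro i
    have : (((1 - z i).toNat : ℕ) : ℤ) = 1 - z i := Int.toNat_of_nonneg (by linarith [hz1 i])
    rw [hz]
    exact_mod_cast congrArg (Int.cast : ℤ → ℝ) this
  have hsum : ∑ i, (1 - z i).toNat = n + 1 := by
    have : ((∑ i, (1 - z i).toNat : ℕ) : ℝ) = (n + 1 : ℕ) := by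
      rw [Nat.cast_sum, Finset.sum_congr rfl fun i _ => hcast i, Finset.sum_sub_distrib,
        sum_facetFunctional]
      simp
    exact_mod_cast this
  refine ⟨fun i => (1 - z i).toNat, hsum, fun h => ?_, ext_facetFunctional fun i => ?_⟩
  · obtain ⟨i, hi⟩ := hy'.2
    have h1 := h ▸ Finset.mem_univ i
    rw [mem_labelSupport] at h1
    apply h1
    have h2 := hcast i
    rw [hi, sub_self] at h2
    exact_mod_cast h2
  · rw [facetFunctional_labelVec hsum, hcast]
    ring

/-- The ray is traded for itself, so coefficients do not change. -/
theorem isStep_single {Λ : Type*} {v : Λ} {a : Λ →₀ ℝ} (ha : 0 ≤ a) :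
    IsStep (v, Finsupp.single v 1) a a := by
  classical
  refine ⟨a v, ha v, ?_, ⟨v, ?_, by simp⟩, by simp⟩
  · intro w
    by_cases h : w = v
    · subst h; simp
    · simpa [Finsupp.single_eq_of_ne h] using ha w
  · rw [Finsupp.support_single _ one_ne_zero]
    exact Finset.mem_singleton_self v

/-- The trivial star subdivisions at the vertices of the polytope. -/
noncomputable def vertexProgram (n : ℕ) : List ((Fin (n + 1) → ℕ) × ((Fin (n + 1) → ℕ) →₀ ℝ)) :=
  (List.finRange (n + 1)).map fun i =>
    (Pi.single i (n + 1), Finsupp.single (Pi.single i (n + 1)) 1)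

theorem isRun_vertexProgram {a : (Fin (n + 1) → ℕ) →₀ ℝ} (ha : 0 ≤ a) :
    IsRun (vertexProgram n) a a := by
  rw [vertexProgram]
  induction List.finRange (n + 1) with
  | nil => rfl
  | cons i l ih => exact ⟨a, isStep_single ha, ih⟩

theorem isAdapted_vertexProgram {init : (Fin (n + 1) → ℕ) → (Fin (n + 1) → ℕ) →₀ ℝ}
    {A : List ((Fin (n + 1) → ℕ) × ((Fin (n + 1) → ℕ) →₀ ℝ))}
    (h : ∀ i, IsRun A (init (Pi.single i (n + 1))) (Finsupp.single (Pi.single i (n + 1)) 1)) :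
    IsAdapted init A (vertexProgram n) := by
  rw [vertexProgram]
  induction List.finRange (n + 1) generalizing A with
  | nil => trivial
  | cons i l ih =>
    exact ⟨h i, ih fun j => isRun_append.2
      ⟨_, h j, _, isStep_single (Finsupp.single_nonneg.2 zero_le_one), rfl⟩⟩

end BoundaryComplex

/-! ### Enumerating the boundary points -/

section ProjectiveSpace

/-- Star subdivisions at all lattice points of the boundary of the polytope, which express every
lattice point integrally. -/
theorem exists_boundaryProgram (n : ℕ) :
    ∃ P : List ((Fin (n + 1) → ℕ) × ((Fin (n + 1) → ℕ) →₀ ℝ)),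
      IsAdapted (fun u => vertexState (n + 1) (realLabel u)) [] P ∧
      (P.map Prod.fst).Nodup ∧
      (∀ u, u ∈ P.map Prod.fst ↔ ∑ i, u i = n + 1 ∧ labelSupport u ≠ Finset.univ) ∧
      ((P.map Prod.fst).Pairwise fun u v => (labelSupport v).card ≤ (labelSupport u).card) ∧
      ∀ x : Fin (n + 1) → ℕ, labelSupport x ≠ Finset.univ → n + 1 ∣ ∑ i, x i →
        ∃ N : (Fin (n + 1) → ℕ) →₀ ℝ, IsRun P (vertexState (n + 1) (realLabel x)) N ∧
          ∀ r, ∃ z : ℕ, N r = z := by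
  have hlower : IsLowerSet
      ((Finset.univ.erase Finset.univ : Finset (Finset (Fin (n + 1)))) :
        Set (Finset (Fin (n + 1)))) := by
    intro S R hRS hS
    simp only [Finset.coe_erase, Finset.coe_univ, Set.mem_sdiff, Set.mem_univ, true_and,
      Set.mem_singleton_iff] at hS ⊢
    rintro rfl
    exact hS (Finset.univ_subset_iff.1 hRS)
  obtain ⟨Ts, P, hTs, hP, hint⟩ := hasProgram (I := Fin (n + 1)) (n + 1) n.succ_ne_zero _ hlower
  have hn : ((n + 1 : ℕ) : ℝ) ≠ 0 := Nat.cast_ne_zero.2 n.succ_ne_zero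
  -- For `n = 0` the polytope is all of `ℝ⁰` and has empty boundary, so its vertex must not be
  -- listed.
  set Q := if n = 0 then [] else vertexProgram n with hQ
  have hQrun : ∀ a, 0 ≤ a → IsRun Q a a := by
    intro a ha
    rw [hQ]
    split_ifs
    · rfl
    · exact isRun_vertexProgram ha
  have hQmem : ∀ u, u ∈ Q.map Prod.fst ↔ n ≠ 0 ∧ ∃ i, u = Pi.single i (n + 1) := by
    intro u
    rw [hQ]
    split_ifs with h
    · simp [h]
    · simp [vertexProgram, h, eq_comm]
  have hQnodup : (Q.map Prod.fst).Nodup := by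
    rw [hQ]
    split_ifs
    · simp
    · rw [vertexProgram, List.map_map]
      exact (List.nodup_finRange _).map (single_injective n.succ_ne_zero)
  have hQcard : ∀ u ∈ Q.map Prod.fst, (labelSupport u).card = 1 := by
    intro u hu
    obtain ⟨-, i, rfl⟩ := (hQmem u).1 hu
    rw [labelSupport_single n.succ_ne_zero, Finset.card_singleton]
  have hPcard : ∀ u ∈ P.map Prod.fst, 2 ≤ (labelSupport u).card := fun u hu =>
    ((hTs _).1 ((hP.mem_iff u).1 hu).2).2.1
  refine ⟨P ++ Q, isAdapted_append.2 ⟨hP.adapted, ?_⟩, ?_, fun u => ?_, ?_, fun x hx hdvd => ?_⟩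
  · rw [hQ]
    split_ifs
    · trivial
    · refine isAdapted_vertexProgram fun i => ?_
      have h := hP.isRun_self (x := Pi.single i (n + 1)) fun T hT hTi => by
        rw [labelSupport_single n.succ_ne_zero] at hTi
        have h1 := Finset.card_le_card hTi
        have h2 := ((hTs T).1 hT).2.1
        rw [Finset.card_singleton] at h1
        omega
      have h2 : vertexState (n + 1) (realLabel (Pi.single i (n + 1) : Fin (n + 1) → ℕ)) =
          Finsupp.single (Pi.single i (n + 1)) 1 := by
        have h3 : realLabel (Pi.single i (n + 1) : Fin (n + 1) → ℕ) =
            Pi.single i ((n + 1 : ℕ) : ℝ) := by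
          ext j
          by_cases hj : j = i
          · subst hj; simp [realLabel]
          · simp [realLabel, hj]
        rw [h3, vertexState_piSingle, div_self hn]
      rw [List.nil_append]
      simpa only [h2] using h
  · rw [List.map_append]
    refine hP.nodup.append hQnodup fun u hu hu' => ?_
    have h1 := hPcard u hu
    have h2 := hQcard u hu'
    omega
  · rw [List.map_append, List.mem_append, hP.mem_iff, hQmem, hTs]
    constructor
    · rintro (⟨h, h1, -⟩ | ⟨h, i, rfl⟩)
      · exact ⟨h, (Finset.mem_erase.1 h1).1⟩
      · refine ⟨by simp, fun h1 => h ?_⟩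
        rw [labelSupport_single n.succ_ne_zero] at h1
        have h2 := congrArg Finset.card h1
        rw [Finset.card_singleton, Finset.card_univ, Fintype.card_fin] at h2
        omega
    · rintro ⟨h, h1⟩
      by_cases h2 : 2 ≤ (labelSupport u).card
      · exact Or.inl ⟨h, Finset.mem_erase.2 ⟨h1, Finset.mem_univ _⟩, h2,
          (card_labelSupport_le_sum u).trans h.le⟩
      · obtain ⟨i, hi⟩ := Finset.card_le_one_iff_subset_singleton.1
          (by omega : (labelSupport u).card ≤ 1)
        have hu := eq_single_of_labelSupport_subset hi
        rw [h] at hu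
        refine Or.inr ⟨?_, i, hu⟩
        rintro rfl
        refine h1 ?_
        rw [hu, labelSupport_single (by simp)]
        exact Finset.eq_univ_of_forall fun j => Finset.mem_singleton.2 (Fin.ext (by omega))
  · rw [List.map_append, List.pairwise_append]
    refine ⟨hP.sorted, List.pairwise_of_forall_mem_list fun u hu v hv => ?_,
      fun u hu v hv => ?_⟩
    · rw [hQcard u hu, hQcard v hv]
    · rw [hQcard v hv]
      exact one_le_two.trans (hPcard u hu)
  · obtain ⟨N, h1, h2, h3, -⟩ := hint x (Finset.mem_erase.2 ⟨hx, Finset.mem_univ _⟩) hdvd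
    exact ⟨N, isRun_append.2 ⟨N, h1, hQrun N h2⟩, h3⟩

variable {n : ℕ}

/-- Homogeneous coordinates of a lattice point. -/
theorem exists_vertexState_eq {y : Fin n → ℝ} (hy : IsLatticePoint y) :
    ∃ x : Fin (n + 1) → ℕ, labelSupport x ≠ Finset.univ ∧ n + 1 ∣ ∑ i, x i ∧
      Finsupp.linearCombination ℝ (labelVec n) (vertexState (n + 1) (realLabel x)) = y := by
  obtain ⟨k, hk, hy'⟩ := exists_homogeneous y
  choose z hz using exists_int_facetFunctional hy
  have hzk : ∀ i, z i ≤ z k := fun i => by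
    have := hk i
    rw [hz, hz] at this
    exact_mod_cast this
  have hcast : ∀ i, (((z k - z i).toNat : ℕ) : ℤ) = z k - z i := fun i =>
    Int.toNat_of_nonneg (sub_nonneg.2 (hzk i))
  refine ⟨fun i => (z k - z i).toNat, fun h => ?_, ?_, ?_⟩
  · have h1 := h ▸ Finset.mem_univ k
    rw [mem_labelSupport, sub_self] at h1
    exact h1 rfl
  · have hz0 : ∑ i, z i = 0 := by
      have := sum_facetFunctional y
      simp only [hz] at this
      exact_mod_cast this
    rw [← Int.natCast_dvd_natCast, Nat.cast_sum, Finset.sum_congr rfl fun i _ => hcast i,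
      Finset.sum_sub_distrib, hz0]
    simp
  · rw [← hy']
    congr 2
    ext i
    change (((z k - z i).toNat : ℕ) : ℝ) = _
    rw [hz, hz]
    exact_mod_cast congrArg (Int.cast : ℤ → ℝ) (hcast i)

end ProjectiveSpace

end ToricTriangulation

open ToricTriangulation in
theorem mainTheorem8 (n : ℕ) :
    ToricTriangulation.IsReflexive (ToricTriangulation.projectiveSpacePolytope n) ∧
    ∃ T : Geometry.SimplicialComplex ℝ (Fin n → ℝ),
      ToricTriangulation.IsRegularProjectiveTriangulation T
        (ToricTriangulation.projectiveSpacePolytope n) ∧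
      ∃ L : List (Fin n → ℝ),
        L.Nodup ∧
        (∀ v, v ∈ L ↔ ToricTriangulation.IsLatticePoint v ∧
          v ∈ frontier (ToricTriangulation.projectiveSpacePolytope n)) ∧
        L.Pairwise (fun v w =>
          ToricTriangulation.faceDim (ToricTriangulation.projectiveSpacePolytope n) w ≤
            ToricTriangulation.faceDim (ToricTriangulation.projectiveSpacePolytope n) v) ∧
        ToricTriangulation.triangulationFan T =
          L.foldl ToricTriangulation.starSubdivision
            (ToricTriangulation.faceFan (ToricTriangulation.projectiveSpacePolytope n)) := by
  refine ⟨isReflexive_projectiveSpacePolytope, ?_⟩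
  obtain ⟨P, hadapted, hnodup, hmem, hsorted, hint⟩ := exists_boundaryProgram n
  have hP : ∀ p ∈ P, ∑ i, p.1 i = n + 1 ∧ labelSupport p.1 ≠ Finset.univ := fun p hp =>
    (hmem p.1).1 (List.mem_map_of_mem hp)
  have hmap : (P.map fun p => labelVec n p.1) = (P.map Prod.fst).map (labelVec n) := by
    rw [List.map_map]
    rfl
  obtain ⟨K, hK, hlat, hrun, hfan⟩ := IsBoundaryFan.exists_foldl (K₀ := boundaryComplex n)
    (init := fun u => vertexState (n + 1) (realLabel u)) P
    (fun p hp => vertexState_realLabel (hP p hp).1 (hP p hp).2)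
    (fun p hp => facetFunctional_labelVec_le (hP p hp).1)
    (fun p hp => exists_facetFunctional_labelVec_eq_one (hP p hp).1 (hP p hp).2)
    (fun p _ => isLatticePoint_labelVec p.1) [] (boundaryComplex n) isBoundaryFan_boundaryComplex
    (fun v _ => isLatticePoint_labelVec v) (fun a b ha has hab => hab ▸ ⟨ha, has, rfl⟩) hadapted
  refine ⟨hK.triangulation, ⟨?_, ?_, ?_, fun s hs => hK.zero_mem_facets hs⟩,
    P.map fun p => labelVec n p.1, ?_, fun v => ?_, ?_, ?_⟩
  · rw [projectiveSpacePolytope_eq]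
    exact hK.isLatticeTriangulation hlat
  · refine hK.isUnimodular hlat fun y hy => ?_
    -- Natural homogeneous coordinates of `y` with a zero entry are fed to the program, which
    -- returns natural coefficients in the final fan.
    obtain ⟨x, hx, hdvd, hxy⟩ := exists_vertexState_eq hy
    obtain ⟨N, hN, hNz⟩ := hint x hx hdvd
    obtain ⟨h1, h2, h3⟩ := hrun _ N (vertexState_nonneg (realLabel_nonneg x))
      (support_vertexState_mem (by
        by_contra h
        push Not at h
        refine hx (Finset.eq_univ_iff_forall.2 fun i => mem_labelSupport.2 fun h0 => h i ?_)
        simp [h0])) hN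
    exact ⟨N, h1, h2, h3.trans hxy, hNz⟩
  · rw [projectiveSpacePolytope_eq]
    exact hK.isCoherent
  · rw [hmap]
    exact hnodup.map_on fun u hu v hv h => labelVec_injOn ((hmem u).1 hu).1 ((hmem v).1 hv).1 h
  · rw [hmap, List.mem_map]
    constructor
    · rintro ⟨u, hu, rfl⟩
      obtain ⟨h1, h2⟩ := (hmem u).1 hu
      exact ⟨isLatticePoint_labelVec u, mem_frontier_projectiveSpacePolytope.2
        ⟨facetFunctional_labelVec_le h1, exists_facetFunctional_labelVec_eq_one h1 h2⟩⟩
    · rintro ⟨h1, h2⟩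
      obtain ⟨u, h3, h4, rfl⟩ := exists_labelVec_eq h1 h2
      exact ⟨u, (hmem u).2 ⟨h3, h4⟩, rfl⟩
  · rw [hmap, List.pairwise_map]
    refine hsorted.imp_of_mem fun hu hv h => ?_
    rw [faceDim_labelVec ((hmem _).1 hu).1, faceDim_labelVec ((hmem _).1 hv).1]
    exact Nat.sub_le_sub_right h 1
  · rw [hK.triangulationFan_eq, hfan, faceFan_eq_fanCones]
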